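/- Let $\mathbb S^2$ and $\mathbb B^3$ be the unit sphere and the open unit ball of $\mathbb R^3$, let $\eta_0$ be the normalized surface measure on $\mathbb S^2$, and for $w\in\mathbb B^3$ and $|x|\le 1$ put $$g_w(x)=\frac{(1-|w|^2)\,x+(1+|x|^2+2\langle w,x\rangle)\,w}{1+|w|^2|x|^2+2\langle w,x\rangle},\qquad \eta_w=(g_w)_*\eta_0 .$$ For a probability measure $\mu$ on $\mathbb S^2$ let $$V_\mu(w)=\frac{1-|w|^2}{2}\int_{\mathbb S^2}g_{-w}(\zeta)\,d\mu(\zeta),\qquad w\in\mathbb B^3,$$ and let the conformal barycenter $B(\mu)$ be the unique zero of $V_\mu$ in $\mathbb B^3$, when there is exactly one. For a measurable $\phi:\mathbb S^2\to\mathbb S^2$ such that $\phi_*\eta_0$ has no atoms, the Douady–Earle extension $E(\phi)$ is the map of $\overline{\mathbb B^3}$ with $E(\phi)=\phi$ on $\mathbb S^2$ and $E(\phi)(x)=B(\phi_*\eta_x)$ for $x\in\mathbb B^3$. Identify $z=x_1+ix_2\in\mathbb C$ with $(x_1,x_2,0)\in\mathbb R^3$, so that $\mathbb D=\{|z|<1\}$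 is the equatorial disc of $\mathbb B^3$. Let $S:\overline{\mathbb C}\to\mathbb S^2$ be the stereographic projection $S(z)=\frac{1}{1+|z|^2}(2\operatorname{Re}z,\,2\operatorname{Im}z,\,1-|z|^2)$, $S(\infty)=-\mathbf e_3$, and for $f:\overline{\mathbb C}\to\overline{\mathbb C}$ put $\widehat f=S\circ f\circ S^{-1}$. **Proposition.** Let $d\ge 1$ and let $$f(z)=\sigma\prod_{j=1}^d\frac{z+a_j}{1+\overline{a_j}z},\qquad |\sigma|=1,\quad |a_j|<1,$$ be a finite Blaschke product, regarded as a rational map of $\overline{\mathbb C}$. Then $\widehat f$ is measurable, $\widehat f_*\eta_0$ has no atoms, and for every $x\in\mathbb B^3$ the field $V_{\widehat f_*\eta_x}$ has exactly one zero in $\mathbb B^3$, so that $\Phi=E(\widehat f)$ is defined. Moreover: 1. $\Phi(\mathbb D)=\mathbb D$. 2. $\Phi$ preserves the upper and the lower half: it maps each of the hemispheres $\{x\in\mathbb S^2: x_3>0\}$ and $\{x\in\mathbb S^2: x_3<0\}$ into itself, and each of the half-balls $\{x\in\mathbb B^3: x_3>0\}$ and $\{x\in\mathbb B^3: x_3<0\}$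 into itself. 3. There is a real-analytic function $g:\mathbb D\to\,]0,\infty[$ such that at every $z\in\mathbb D$ the partial derivative $\partial\Phi/\partial x_3$ exists and $\frac{\partial\Phi}{\partial x_3}(z)=g(z)\,\mathbf e_3$. 4. If $f(z)=z^d$, then there is a real-valued function $h$, real-analytic on $[0,1[$ (that is, on a neighbourhood of each point of $[0,1[$ in $\mathbb R$), such that $h(r)\to1$ as $r\nearrow1$ and $\Phi(z)=z^d\,h(|z|^2)$ for all $z\in\mathbb D$. -/

import Mathlib

open MeasureTheory Metric Set Filter Topology
open scoped ComplexConjugate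

/-- Euclidean three-space, with its Euclidean norm. -/
abbrev R3 : Type := EuclideanSpace ℝ (Fin 3)

/-- The unit sphere in three-space, as a type. -/
abbrev S2 : Type := sphere (0 : R3) 1

noncomputable section

/-! ### The Möbius maps of the ball and harmonic measure -/

/-- The Möbius map `g_w` of the closed unit ball; it takes `0` to `w`, and its inverse is `g_{-w}`. -/
def moebius (w x : R3) : R3 :=
  (1 + ‖w‖ ^ 2 * ‖x‖ ^ 2 + 2 * inner ℝ w x)⁻¹ •
    ((1 - ‖w‖ ^ 2) • x + (1 + ‖x‖ ^ 2 + 2 * inner ℝ w x) • w)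

theorem norm_moebius_of_mem_sphere {w x : R3} (hw : ‖w‖ < 1) (hx : ‖x‖ = 1) :
    ‖moebius w x‖ = 1 := by
  have hpos : 0 < 1 + ‖w‖ ^ 2 * ‖x‖ ^ 2 + 2 * inner ℝ w x := by
    have h1 : -(‖w‖ * ‖x‖) ≤ inner ℝ w x :=
      neg_le_of_abs_le (abs_real_inner_le_norm w x)
    rw [hx] at h1 ⊢
    nlinarith [sq_nonneg (1 - ‖w‖)]
  have hsq : ‖(1 - ‖w‖ ^ 2) • x + (1 + ‖x‖ ^ 2 + 2 * inner ℝ w x) • w‖ ^ 2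
      = (1 + ‖w‖ ^ 2 * ‖x‖ ^ 2 + 2 * inner ℝ w x) ^ 2 := by
    rw [norm_add_sq_real, norm_smul, norm_smul, real_inner_smul_left, real_inner_smul_right,
      mul_pow, mul_pow, Real.norm_eq_abs, Real.norm_eq_abs, sq_abs, sq_abs, hx,
      real_inner_comm w x]
    ring
  have hn : ‖(1 - ‖w‖ ^ 2) • x + (1 + ‖x‖ ^ 2 + 2 * inner ℝ w x) • w‖
      = 1 + ‖w‖ ^ 2 * ‖x‖ ^ 2 + 2 * inner ℝ w x :=
    (sq_eq_sq₀ (norm_nonneg _) hpos.le).1 hsq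
  rw [moebius, norm_smul, hn, Real.norm_eq_abs, abs_of_pos (inv_pos.2 hpos),
    inv_mul_cancel₀ hpos.ne']

/-- The restriction of `g_w` to the unit sphere, for `w` in the open unit ball. -/
def moebiusSphere (w : ball (0 : R3) 1) (ζ : S2) : S2 :=
  ⟨moebius w ζ, mem_sphere_zero_iff_norm.2 (norm_moebius_of_mem_sphere
    (mem_ball_zero_iff.1 w.2) (mem_sphere_zero_iff_norm.1 ζ.2))⟩

/-- The surface measure of the unit sphere, normalized to total mass one. -/
def uniformS2 : Measure S2 :=
  ((volume : Measure R3).toSphere univ)⁻¹ • (volume : Measure R3).toSphere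

/-- The harmonic measure with center `x`: the push-forward of the uniform measure by `g_x`. -/
def harmonicMeasure (x : ball (0 : R3) 1) : Measure S2 :=
  uniformS2.map (moebiusSphere x)

/-! ### The conformal barycenter and the Douady-Earle extension -/

/-- The vector field `V_μ` on the open unit ball. -/
def baryField (μ : Measure S2) (w : R3) : R3 :=
  ((1 - ‖w‖ ^ 2) / 2) • ∫ ζ : S2, moebius (-w) (ζ : R3) ∂μ

/-- `w` is the one and only zero of `V_μ` in the open unit ball. -/
def IsConformalBarycenter (μ : Measure S2) (w : R3) : Prop :=
  (w ∈ ball (0 : R3) 1 ∧ baryField μ w = 0) ∧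
    ∀ w' ∈ ball (0 : R3) 1, baryField μ w' = 0 → w' = w

open Classical in
/-- The conformal barycenter `B(μ)`: the unique zero of `V_μ` in the open unit ball
(and `0` by convention if `V_μ` does not have exactly one zero there). -/
def conformalBarycenter (μ : Measure S2) : R3 :=
  if h : ∃ w, IsConformalBarycenter μ w then h.choose else 0

open Classical in
/-- The Douady-Earle extension `E(φ)` of a self-map `φ` of the sphere to the closed unit ball
(set to `0` outside the closed ball). -/
def douadyEarle (φ : S2 → S2) (x : R3) : R3 :=
  if hs : x ∈ sphere (0 : R3) 1 then φ ⟨x, hs⟩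
  else if hb : x ∈ ball (0 : R3) 1 then
    conformalBarycenter ((harmonicMeasure ⟨x, hb⟩).map φ)
  else 0

/-- The maps to which the Douady-Earle extension applies: measurable self-maps of the sphere that
push the uniform measure forward to a measure without atoms. -/
def IsExtendable (φ : S2 → S2) : Prop :=
  Measurable φ ∧ ∀ ζ : S2, uniformS2.map φ {ζ} = 0

/-! ### Stereographic projection -/

theorem stereo_aux (z : ℂ) :
    (!₂[2 * z.re / (1 + ‖z‖ ^ 2), 2 * z.im / (1 + ‖z‖ ^ 2),
      (1 - ‖z‖ ^ 2) / (1 + ‖z‖ ^ 2)] : R3) ∈ sphere (0 : R3) 1 := by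
  have h : (1 + ‖z‖ ^ 2) ≠ 0 := by positivity
  rw [mem_sphere_zero_iff_norm, EuclideanSpace.norm_eq, Real.sqrt_eq_one]
  simp only [Fin.sum_univ_three, Real.norm_eq_abs, sq_abs]
  simp only [Matrix.cons_val_zero, Matrix.cons_val_one, Matrix.cons_val]
  have h2 : ‖z‖ ^ 2 = z.re ^ 2 + z.im ^ 2 := by
    rw [Complex.sq_norm, Complex.normSq_apply]; ring
  rw [h2] at h ⊢
  field_simp
  ring

theorem neg_e3_mem_sphere : (-EuclideanSpace.single 2 1 : R3) ∈ sphere (0 : R3) 1 := by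
  simp

/-- The stereographic projection of the Riemann sphere onto the unit sphere,
`z ↦ (2 Re z, 2 Im z, 1 - |z|²) / (1 + |z|²)` and `∞ ↦ (0, 0, -1)`. -/
def stereo (p : OnePoint ℂ) : S2 :=
  p.elim ⟨-EuclideanSpace.single 2 1, neg_e3_mem_sphere⟩ fun z =>
    ⟨!₂[2 * z.re / (1 + ‖z‖ ^ 2), 2 * z.im / (1 + ‖z‖ ^ 2), (1 - ‖z‖ ^ 2) / (1 + ‖z‖ ^ 2)],
      stereo_aux z⟩

/-- The inverse of the stereographic projection. -/
def stereoInv (ζ : S2) : OnePoint ℂ :=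
  if (ζ : R3) 2 = -1 then OnePoint.infty
  else (((⟨(ζ : R3) 0 / (1 + (ζ : R3) 2), (ζ : R3) 1 / (1 + (ζ : R3) 2)⟩ : ℂ)) : OnePoint ℂ)

theorem stereoInv_stereo (p : OnePoint ℂ) : stereoInv (stereo p) = p := by
  induction p using OnePoint.rec with
  | infty => simp [stereo, stereoInv]
  | coe z =>
    have h : (1 + ‖z‖ ^ 2) ≠ 0 := by positivity
    have h3 : (1 - ‖z‖ ^ 2) / (1 + ‖z‖ ^ 2) ≠ -1 := by
      intro h'
      rw [div_eq_iff h] at h'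
      linarith
    have h4 : 1 + (1 - ‖z‖ ^ 2) / (1 + ‖z‖ ^ 2) = 2 / (1 + ‖z‖ ^ 2) := by
      field_simp; ring
    rw [stereoInv, if_neg (show ((stereo z : S2) : R3) 2 ≠ -1 from h3)]
    simp only [stereo, OnePoint.elim_some, Matrix.cons_val_zero, Matrix.cons_val_one,
      Matrix.cons_val]
    refine congrArg OnePoint.some ?_
    apply Complex.ext
    · simp only [h4]; field_simp
    · simp only [h4]; field_simp

theorem stereo_stereoInv (ζ : S2) : stereo (stereoInv ζ) = ζ := by
  have hn : (ζ : R3) 0 ^ 2 + (ζ : R3) 1 ^ 2 + (ζ : R3) 2 ^ 2 = 1 := by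
    have h := mem_sphere_zero_iff_norm.1 ζ.2
    rw [EuclideanSpace.norm_eq, Real.sqrt_eq_one] at h
    simpa [Fin.sum_univ_three] using h
  by_cases h : (ζ : R3) 2 = -1
  · have h0 : (ζ : R3) 0 = 0 := by nlinarith [sq_nonneg ((ζ : R3) 0), sq_nonneg ((ζ : R3) 1)]
    have h1 : (ζ : R3) 1 = 0 := by nlinarith [sq_nonneg ((ζ : R3) 0), sq_nonneg ((ζ : R3) 1)]
    apply Subtype.ext
    ext i
    fin_cases i <;> simp [stereoInv, stereo, h, h0, h1]
  · have hne : 1 + (ζ : R3) 2 ≠ 0 := fun h' => h (by linarith)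
    have hz : ‖(⟨(ζ : R3) 0 / (1 + (ζ : R3) 2), (ζ : R3) 1 / (1 + (ζ : R3) 2)⟩ : ℂ)‖ ^ 2
        = (1 - (ζ : R3) 2) / (1 + (ζ : R3) 2) := by
      rw [Complex.sq_norm, Complex.normSq_apply]
      field_simp
      linarith
    have h5 : 1 + (1 - (ζ : R3) 2) / (1 + (ζ : R3) 2) = 2 / (1 + (ζ : R3) 2) := by
      field_simp; ring
    apply Subtype.ext
    ext i
    simp only [stereoInv, if_neg h, stereo, OnePoint.elim_some, hz, h5]
    fin_cases i
    · simp; field_simp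
    · simp; field_simp
    · simp; field_simp; ring

/-- The stereographic projection as a bijection. -/
def stereoEquiv : OnePoint ℂ ≃ S2 where
  toFun := stereo
  invFun := stereoInv
  left_inv := stereoInv_stereo
  right_inv := stereo_stereoInv

/-- The conjugate `f̂` of a self-map `f` of the Riemann sphere by stereographic projection. -/
def sphereConj (f : OnePoint ℂ → OnePoint ℂ) : S2 → S2 :=
  fun ζ => stereoEquiv (f (stereoEquiv.symm ζ))

/-! ### Finite Blaschke products -/

open Classical in
/-- The finite Blaschke product `σ ∏ (z + a_j) / (1 + conj a_j z)`, as a self-map of the Riemann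
sphere: its value is `∞` at the poles, and its value at `∞` is its limit there. -/
def blaschke {d : ℕ} (σ : ℂ) (a : Fin d → ℂ) (p : OnePoint ℂ) : OnePoint ℂ :=
  p.elim
    (if ∃ j, a j = 0 then OnePoint.infty else ((σ * ∏ j, (conj (a j))⁻¹ : ℂ) : OnePoint ℂ))
    fun z => if ∃ j, 1 + conj (a j) * z = 0 then OnePoint.infty
      else ((σ * ∏ j, (z + a j) / (1 + conj (a j) * z) : ℂ) : OnePoint ℂ)

/-! ### The equatorial disc and the two halves -/

/-- The third vector of the standard basis. -/
def e3 : R3 := EuclideanSpace.single 2 1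

/-- The complex plane as the coordinate plane `x₃ = 0`. -/
def planePt (z : ℂ) : R3 := !₂[z.re, z.im, 0]

/-- The unit disc, in the coordinate plane. -/
def equatorialDisc : Set R3 := planePt '' ball (0 : ℂ) 1

def upperHemisphere : Set R3 := {x | ‖x‖ = 1 ∧ 0 < x 2}

def lowerHemisphere : Set R3 := {x | ‖x‖ = 1 ∧ x 2 < 0}

def upperHalfBall : Set R3 := {x | ‖x‖ < 1 ∧ 0 < x 2}

def lowerHalfBall : Set R3 := {x | ‖x‖ < 1 ∧ x 2 < 0}

end

/-!
The proof works in the Klein model of hyperbolic space. With `y = 2 w / (1 + ‖w‖²)` the equation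
`V_μ(w) = 0` becomes `∫ (1 - ⟪y, ζ⟫)⁻¹ ζ dμ = (1 - ‖y‖²)⁻¹ y` (`baryField_eq_zero_iff`), which says
that `y` is a critical point of `∫ log (1 - ⟪y, ζ⟫) dμ - log (1 - ‖y‖²) / 2`. For a probability
measure without atoms this energy is positive near the sphere and vanishes at the center, so it has
a critical point (`exists_kleinCritical`). An elementary identity with a square as its remainder
(`klein_comparison`) shows that there is only one (`KleinCritical.eq`), and its infinitesimal form
that the Hessian there is definite (`KleinCritical.integral_sq_lt`).

The harmonic measure with center `x` has an explicit density (`harmonicMeasure_eq_withDensity`),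
which is obtained from a change of variables on the light cone. The barycenter equation for
`φ_* η_x` is therefore a finite-dimensional equation `K (x, y) = 0`, where `K` is composed of
continuous linear maps and of products and inverses in the Banach algebra of continuous functions on
the sphere; hence `K` is analytic, and by the implicit function theorem so is the extension
(`contDiffAt_douadyEarle`). It has the boundary values `φ` by dominated convergence
(`tendsto_douadyEarle_nhdsWithin_ball`). All this holds for any continuous `φ` with finite fibres.

A finite Blaschke product commutes with the reflection in the unit circle. Its extension commutes
with the reflection in the equatorial plane, so it maps the disc to itself and has vertical normal
derivatives there. The harmonic measures with center in the upper half-ball charge the upper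
hemisphere more than the lower one, which places the barycenters in the upper half-ball
(`kleinExtension_two_pos`). The infinitesimal version, applied to the equation `K (x, y) = 0`, shows
that the normal derivative points upwards (`fderiv_douadyEarle_e3_two_pos`). The disc is covered
because `z ^ d`, and with it any Blaschke product of degree `d ≥ 1` shifted by a point of the disc,
has no continuous logarithm on the circle (`exists_eq_of_eqOn_circle`).

For `f(z) = z ^ d` the extension `F` to the disc satisfies `F (τ z) = τ ^ d F z` for unimodular `τ`.
Differentiating in `τ` gives `d F = z ∂F - z̄ ∂̄F`, and `∂F`, `∂̄F` are equivariant with the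
exponents `d - 1` and `d + 1`; by induction `F = O(|z| ^ d)` (`HasRotationWeight.isBigO`). So the
real-analytic function `F(r) / r ^ d` extends to `r = 0`. It is even, hence an analytic function of
`r²` (`exists_radial_profile`).
-/

open scoped Pointwise ContDiff

noncomputable section

/-! ### The uniform measure and harmonic measures on the sphere -/

theorem norm_S2 (ζ : S2) : ‖(ζ : R3)‖ = 1 := mem_sphere_zero_iff_norm.1 ζ.2

theorem abs_inner_S2_le (w : R3) (ζ : S2) : |inner ℝ w (ζ : R3)| ≤ ‖w‖ := by
  simpa [norm_S2] using abs_real_inner_le_norm w (ζ : R3)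

theorem inner_S2_le (w : R3) (ζ : S2) : inner ℝ w (ζ : R3) ≤ ‖w‖ :=
  (le_abs_self _).trans (abs_inner_S2_le w ζ)

/-- Polar coordinates for the Lebesgue integral on three-space. -/
theorem lintegral_polar {F : R3 → ENNReal} (hF : Measurable F) :
    ∫⁻ X, F X = ∫⁻ ζ : S2, ∫⁻ r : Ioi (0 : ℝ), F ((r : ℝ) • (ζ : R3))
      ∂(Measure.volumeIoiPow 2) ∂((volume : Measure R3).toSphere) := by
  have h := (volume : Measure R3).measurePreserving_homeomorphUnitSphereProd
  have hdim : Module.finrank ℝ R3 - 1 = 2 := by simp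
  rw [hdim] at h
  have h1 : ∫⁻ X, F X = ∫⁻ X : ({0}ᶜ : Set R3), F X ∂(Measure.comap Subtype.val volume) := by
    rw [lintegral_subtype_comap (measurableSet_singleton _).compl,
      Measure.restrict_eq_self_of_ae_mem]
    exact compl_mem_ae_iff.2 (measure_singleton _)
  rw [h1, ← lintegral_prod (fun p : S2 × Ioi (0 : ℝ) => F ((p.2 : ℝ) • (p.1 : R3))),
    ← h.lintegral_comp_emb (homeomorphUnitSphereProd R3).measurableEmbedding]
  · refine lintegral_congr fun X => ?_
    rw [← homeomorphUnitSphereProd_symm_apply_coe, Homeomorph.symm_apply_apply]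
  · refine (hF.comp ?_).aemeasurable
    fun_prop

/-- The action on the space components of the Lorentz boost that induces `g_w` on the projectivized
light cone, up to a constant factor. It is positively homogeneous, and `g_w ζ` is the direction
of the image of `ζ`. -/
def coneMap (w X : R3) : R3 :=
  (1 - ‖w‖ ^ 2) • X + (2 * (‖X‖ + inner ℝ w X)) • w

theorem coneMap_smul (w X : R3) {r : ℝ} (hr : 0 ≤ r) : coneMap w (r • X) = r • coneMap w X := by
  simp only [coneMap, norm_smul, inner_smul_right, Real.norm_eq_abs, abs_of_nonneg hr, smul_add,
    smul_smul]
  congr 2 <;> ring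

theorem norm_coneMap (w X : R3) :
    ‖coneMap w X‖ = (1 + ‖w‖ ^ 2) * ‖X‖ + 2 * inner ℝ w X := by
  have h0 : 0 ≤ (1 + ‖w‖ ^ 2) * ‖X‖ + 2 * inner ℝ w X := by
    have := neg_le_of_abs_le (abs_real_inner_le_norm w X)
    nlinarith [mul_nonneg (sq_nonneg (1 - ‖w‖)) (norm_nonneg X)]
  rw [← sq_eq_sq₀ (norm_nonneg _) h0, coneMap, norm_add_sq_real, norm_smul, norm_smul,
    real_inner_smul_left, real_inner_smul_right, mul_pow, mul_pow, Real.norm_eq_abs,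
    Real.norm_eq_abs, sq_abs, sq_abs, real_inner_comm w X]
  ring

theorem inner_coneMap (w X : R3) :
    inner ℝ w (coneMap w X) = (1 + ‖w‖ ^ 2) * inner ℝ w X + 2 * ‖w‖ ^ 2 * ‖X‖ := by
  rw [coneMap, inner_add_right, inner_smul_right, inner_smul_right, real_inner_self_eq_norm_sq]
  ring

theorem coneMap_neg_coneMap (w X : R3) :
    coneMap (-w) (coneMap w X) = ((1 - ‖w‖ ^ 2) ^ 2) • X := by
  rw [coneMap, norm_coneMap, inner_neg_left, inner_coneMap, norm_neg, coneMap]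
  module

theorem moebius_eq_coneMap (w : R3) (ζ : S2) :
    moebius w ζ = ‖coneMap w ζ‖⁻¹ • coneMap w ζ := by
  rw [norm_coneMap, moebius, coneMap, norm_S2]
  congr 2 <;> [ring; (congr 2; ring)]

theorem norm_coneMap_pos {w : R3} (hw : ‖w‖ < 1) {X : R3} (hX : X ≠ 0) : 0 < ‖coneMap w X‖ := by
  refine norm_pos_iff.2 fun h => hX ?_
  have h1 := coneMap_neg_coneMap w X
  rw [h] at h1
  have h2 : (1 - ‖w‖ ^ 2) ^ 2 ≠ 0 := pow_ne_zero _ (by nlinarith [norm_nonneg w])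
  have h3 : coneMap (-w) 0 = 0 := by simp [coneMap]
  rw [h3] at h1
  exact (smul_eq_zero.1 h1.symm).resolve_left h2

theorem hasFDerivAt_coneMap (w : R3) {X : R3} (hX : X ≠ 0) :
    HasFDerivAt (coneMap w) ((1 - ‖w‖ ^ 2) • ContinuousLinearMap.id ℝ R3 +
      (ContinuousLinearMap.smulRight ((2 : ℝ) • ((‖X‖⁻¹ • innerSL ℝ X) + innerSL ℝ w)) w)) X := by
  have hn : HasFDerivAt (fun X : R3 => ‖X‖) (‖X‖⁻¹ • innerSL ℝ X) X := by
    have h1 := (hasStrictFDerivAt_norm_sq X).hasFDerivAt.sqrt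
      (pow_ne_zero _ (norm_ne_zero_iff.2 hX))
    simp only [Real.sqrt_sq (norm_nonneg _)] at h1
    convert! h1 using 1
    ext v
    simp
    field_simp
  have hi : HasFDerivAt (fun X : R3 => inner ℝ w X) (innerSL ℝ w) X :=
    (innerSL ℝ w).hasFDerivAt
  exact ((hasFDerivAt_id X).const_smul (1 - ‖w‖ ^ 2)).add (((hn.add hi).const_mul 2).smul_const w)

/-- The derivative of the cone map is a multiple of a transvection, so its determinant is
explicit. -/
theorem det_deriv_coneMap {w : R3} (hw : ‖w‖ < 1) {X : R3} (hX : X ≠ 0) :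
    ((1 - ‖w‖ ^ 2) • ContinuousLinearMap.id ℝ R3 +
      (ContinuousLinearMap.smulRight ((2 : ℝ) • ((‖X‖⁻¹ • innerSL ℝ X) + innerSL ℝ w)) w)).det
      = (1 - ‖w‖ ^ 2) ^ 2 * (‖coneMap w X‖ / ‖X‖) := by
  have hs : (1 - ‖w‖ ^ 2) ≠ 0 := by nlinarith [norm_nonneg w]
  have hX' := norm_ne_zero_iff.2 hX
  have h : (((1 - ‖w‖ ^ 2) • ContinuousLinearMap.id ℝ R3 + (ContinuousLinearMap.smulRight
      ((2 : ℝ) • ((‖X‖⁻¹ • innerSL ℝ X) + innerSL ℝ w)) w) : R3 →L[ℝ] R3) : R3 →ₗ[ℝ] R3)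
      = (1 - ‖w‖ ^ 2) • LinearMap.transvection
        ((((2 : ℝ) • ((‖X‖⁻¹ • innerSL ℝ X) + innerSL ℝ w) : R3 →L[ℝ] ℝ) : R3 →ₗ[ℝ] ℝ))
        ((1 - ‖w‖ ^ 2)⁻¹ • w) := by
    ext1 v
    simp only [LinearMap.smul_apply, LinearMap.transvection.apply, smul_add, smul_smul,
      ContinuousLinearMap.coe_coe, add_apply, smul_apply,
      ContinuousLinearMap.smulRight_apply, ContinuousLinearMap.id_apply]
    congr 2
    field_simp
  rw [ContinuousLinearMap.det, h, LinearMap.det_smul, LinearMap.transvection.det, norm_coneMap]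
  simp [real_inner_comm w X]
  field_simp
  ring

/-- The density of the harmonic measure with center `x` with respect to the uniform measure: the
square of the conformal factor of `g_{-x}`. -/
def harmonicDensity (x : R3) (ζ : S2) : ℝ :=
  ((1 - ‖x‖ ^ 2) / (1 + ‖x‖ ^ 2 - 2 * inner ℝ x (ζ : R3))) ^ 2

theorem harmonicDensity_denom_pos {x : R3} (hx : ‖x‖ < 1) (ζ : S2) :
    0 < 1 + ‖x‖ ^ 2 - 2 * inner ℝ x (ζ : R3) := by
  nlinarith [inner_S2_le x ζ]

theorem continuous_moebiusSphere (x : ball (0 : R3) 1) : Continuous (moebiusSphere x) := by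
  refine Continuous.subtype_mk ?_ _
  have h : (fun ζ : S2 => moebius (x : R3) (ζ : R3))
      = fun ζ : S2 => ‖coneMap (x : R3) ζ‖⁻¹ • coneMap (x : R3) ζ :=
    funext fun ζ => moebius_eq_coneMap x ζ
  have hc : Continuous fun ζ : S2 => coneMap (x : R3) ζ := by unfold coneMap; fun_prop
  rw [h]
  refine (hc.norm.inv₀ fun ζ => ?_).smul hc
  exact (norm_coneMap_pos (mem_ball_zero_iff.1 x.2) (ne_zero_of_mem_unit_sphere ζ)).ne'

theorem continuous_harmonicDensity {x : R3} (hx : ‖x‖ < 1) : Continuous (harmonicDensity x) := by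
  unfold harmonicDensity
  refine (continuous_const.div (by fun_prop) fun ζ => ?_).pow 2
  exact (harmonicDensity_denom_pos hx ζ).ne'

theorem mem_Ioo_smul_sphere {B : Set S2} {B' : Set R3} (hB : B = Subtype.val ⁻¹' B') {Z : R3} :
    Z ∈ Ioo (0 : ℝ) 1 • (Subtype.val '' B) ↔ Z ≠ 0 ∧ ‖Z‖ < 1 ∧ ‖Z‖⁻¹ • Z ∈ B' := by
  subst hB
  constructor
  · rintro ⟨r, hr, _, ⟨ζ, hζ, rfl⟩, rfl⟩
    have h1 : ‖r • (ζ : R3)‖ = r := by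
      rw [norm_smul, norm_S2, mul_one, Real.norm_eq_abs, abs_of_pos hr.1]
    refine ⟨smul_ne_zero hr.1.ne' (ne_zero_of_mem_unit_sphere ζ), ?_, ?_⟩
    · simpa only [h1] using hr.2
    · simp only [h1, smul_smul, inv_mul_cancel₀ hr.1.ne', one_smul]
      exact hζ
  · rintro ⟨h0, h1, h2⟩
    have h3 := norm_ne_zero_iff.2 h0
    refine ⟨‖Z‖, ⟨norm_pos_iff.2 h0, h1⟩, ‖Z‖⁻¹ • Z, ⟨⟨‖Z‖⁻¹ • Z, ?_⟩, h2, rfl⟩, ?_⟩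
    · simp [norm_smul, h3]
    · simp [smul_smul, h3]

/-- The change of variables `g_x` in the surface measure. It is deduced from the change of
variables for Lebesgue measure under the homogeneous map `coneMap (-x)`, applied to a cone over the
sphere and read in polar coordinates. -/
theorem toSphere_preimage_moebiusSphere (x : ball (0 : R3) 1) {A : Set S2}
    (hA : MeasurableSet A) :
    (volume : Measure R3).toSphere (moebiusSphere x ⁻¹' A)
      = ∫⁻ ζ in A, ENNReal.ofReal (harmonicDensity x ζ) ∂(volume : Measure R3).toSphere := by
  obtain ⟨A', hA', rfl⟩ := hA
  have hx : ‖(x : R3)‖ < 1 := mem_ball_zero_iff.1 x.2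
  have hnx : ‖-(x : R3)‖ < 1 := by rwa [norm_neg]
  set s : ℝ := 1 - ‖(x : R3)‖ ^ 2 with hs
  have hs0 : 0 < s := by rw [hs]; nlinarith [norm_nonneg (x : R3)]
  set C : Set R3 := Ioo (0 : ℝ) 1 • (Subtype.val '' (moebiusSphere x ⁻¹' (Subtype.val ⁻¹' A')))
    with hC
  have hcm : Continuous (coneMap (-(x : R3))) := by unfold coneMap; fun_prop
  set D : Set R3 := {Y | Y ≠ 0 ∧ ‖coneMap (-(x : R3)) Y‖ < s ^ 2 ∧ ‖Y‖⁻¹ • Y ∈ A'} with hD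
  have hDm : MeasurableSet D := by
    refine (measurableSet_singleton (0 : R3)).compl.inter (MeasurableSet.inter ?_ ?_)
    · exact (isOpen_lt hcm.norm continuous_const).measurableSet
    · exact (measurable_norm.inv.smul measurable_id) hA'
  -- The dilate of the cone over the preimage is the image of `D` under the inverse cone map.
  have himg : coneMap (-(x : R3)) '' D = (s ^ 2) • C := by
    have hpre : moebiusSphere x ⁻¹' (Subtype.val ⁻¹' A')
        = Subtype.val ⁻¹' {Z : R3 | ‖coneMap (x : R3) Z‖⁻¹ • coneMap (x : R3) Z ∈ A'} := by
      ext ζ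
      simp only [mem_preimage, moebiusSphere, mem_ofPred_eq]
      rw [← moebius_eq_coneMap]
    ext Z
    rw [mem_smul_set_iff_inv_smul_mem₀ (by positivity), hC, mem_Ioo_smul_sphere hpre]
    have key : ∀ Y : R3, Y ≠ 0 → ∀ t : ℝ, 0 < t →
        ‖coneMap (x : R3) (t • Y)‖⁻¹ • coneMap (x : R3) (t • Y)
          = ‖coneMap (x : R3) Y‖⁻¹ • coneMap (x : R3) Y := by
      intro Y hY t ht
      rw [coneMap_smul _ _ ht.le, norm_smul, Real.norm_eq_abs, abs_of_pos ht, smul_smul]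
      congr 1
      field_simp
    have key2 : ∀ Y : R3, coneMap (x : R3) (coneMap (-(x : R3)) Y) = (s ^ 2) • Y := by
      intro Y
      have := coneMap_neg_coneMap (-(x : R3)) Y
      rwa [neg_neg, norm_neg] at this
    have hs2 : ‖(s ^ 2)⁻¹ • Z‖ = (s ^ 2)⁻¹ * ‖Z‖ := by
      rw [norm_smul, Real.norm_eq_abs, abs_of_pos (by positivity)]
    constructor
    · rintro ⟨Y, ⟨hY0, hY1, hY2⟩, rfl⟩
      have hne : coneMap (-(x : R3)) Y ≠ 0 := norm_pos_iff.1 (norm_coneMap_pos hnx hY0)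
      refine ⟨smul_ne_zero (by positivity) hne, ?_, ?_⟩
      · rw [hs2, inv_mul_lt_iff₀ (by positivity)]
        simpa using hY1
      · have hne' : (s ^ 2)⁻¹ • coneMap (-(x : R3)) Y ≠ 0 := smul_ne_zero (by positivity) hne
        rw [mem_ofPred_eq, key _ hne' _ (inv_pos.2 (norm_pos_iff.2 hne')),
          key _ hne _ (inv_pos.2 (by positivity)), key2, norm_smul, smul_smul,
          Real.norm_eq_abs, abs_of_pos (by positivity)]
        convert hY2 using 2
        field_simp
    · rintro ⟨hZ0, hZ1, hZ2⟩
      have hZne : Z ≠ 0 := fun h => hZ0 (by simp [h])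
      have hcne : coneMap (x : R3) Z ≠ 0 := norm_pos_iff.1 (norm_coneMap_pos hx hZne)
      refine ⟨(s ^ 2)⁻¹ • coneMap (x : R3) Z, ⟨smul_ne_zero (by positivity) hcne, ?_, ?_⟩, ?_⟩
      · rw [coneMap_smul _ _ (by positivity), coneMap_neg_coneMap, smul_smul,
          inv_mul_cancel₀ (by positivity), one_smul]
        rw [hs2, inv_mul_lt_iff₀ (by positivity)] at hZ1
        simpa using hZ1
      · rw [mem_ofPred_eq, key _ hZ0 _ (inv_pos.2 (norm_pos_iff.2 hZ0)),
          key _ hZne _ (inv_pos.2 (by positivity))] at hZ2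
        rw [norm_smul, smul_smul, Real.norm_eq_abs, abs_of_pos (by positivity)]
        convert hZ2 using 2
        field_simp
      · rw [coneMap_smul _ _ (by positivity), coneMap_neg_coneMap, smul_smul,
          inv_mul_cancel₀ (by positivity), one_smul]
  have hinj : InjOn (coneMap (-(x : R3))) D := by
    intro Y _ Y' _ h
    have h1 := congrArg (coneMap (x : R3)) h
    have h2 := coneMap_neg_coneMap (-(x : R3)) Y
    have h3 := coneMap_neg_coneMap (-(x : R3)) Y'
    rw [neg_neg, norm_neg] at h2 h3
    rw [h2, h3] at h1
    exact smul_right_injective _ (by positivity) h1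
  have hcv := lintegral_abs_det_fderiv_eq_addHaar_image (volume : Measure R3) hDm
    (fun Y hY => (hasFDerivAt_coneMap (-(x : R3)) hY.1).hasFDerivWithinAt) hinj
  have hdet : ∀ Y ∈ D, ENNReal.ofReal |((1 - ‖-(x : R3)‖ ^ 2) • ContinuousLinearMap.id ℝ R3 +
      (ContinuousLinearMap.smulRight ((2 : ℝ) • ((‖Y‖⁻¹ • innerSL ℝ Y) + innerSL ℝ (-(x : R3))))
        (-(x : R3)))).det| = ENNReal.ofReal (s ^ 2 * (‖coneMap (-(x : R3)) Y‖ / ‖Y‖)) := by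
    intro Y hY
    rw [det_deriv_coneMap hnx hY.1, abs_of_nonneg (by positivity), norm_neg]
  rw [setLIntegral_congr_fun hDm hdet, himg, Measure.addHaar_smul_of_nonneg _ (by positivity),
    ← lintegral_indicator hDm, lintegral_polar] at hcv
  swap
  · refine Measurable.indicator ?_ hDm
    exact ((hcm.norm.measurable.div measurable_norm).const_mul _).ennreal_ofReal
  have hinner : ∀ ζ : S2, ∫⁻ r : Ioi (0 : ℝ), D.indicator
      (fun Y => ENNReal.ofReal (s ^ 2 * (‖coneMap (-(x : R3)) Y‖ / ‖Y‖))) ((r : ℝ) • (ζ : R3))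
      ∂(Measure.volumeIoiPow 2)
      = (Subtype.val ⁻¹' A' : Set S2).indicator (fun ζ =>
        ENNReal.ofReal (s ^ 6 / 3) * ENNReal.ofReal (harmonicDensity x ζ)) ζ := by
    intro ζ
    have hn : ‖coneMap (-(x : R3)) ζ‖ = 1 + ‖(x : R3)‖ ^ 2 - 2 * inner ℝ (x : R3) (ζ : R3) := by
      rw [norm_coneMap, norm_S2, inner_neg_left, norm_neg]; ring
    have hpos := harmonicDensity_denom_pos hx ζ
    set n : ℝ := 1 + ‖(x : R3)‖ ^ 2 - 2 * inner ℝ (x : R3) (ζ : R3) with hndef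
    have hmem : ∀ r : Ioi (0 : ℝ), ((r : ℝ) • (ζ : R3)) ∈ D ↔
        r ∈ Iio (⟨s ^ 2 / n, div_pos (by positivity) hpos⟩ : Ioi (0 : ℝ)) ∧ (ζ : R3) ∈ A' := by
      intro r
      have hr : (0 : ℝ) < r := r.2
      rw [hD, mem_ofPred_eq, coneMap_smul _ _ hr.le, norm_smul, norm_smul, hn, norm_S2, mul_one,
        Real.norm_eq_abs, abs_of_pos hr, smul_smul, inv_mul_cancel₀ hr.ne', one_smul, mem_Iio,
        ← Subtype.coe_lt_coe, lt_div_iff₀ hpos]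
      simp [hr.ne', ne_zero_of_mem_unit_sphere ζ]
    by_cases hζ : (ζ : R3) ∈ A'
    · rw [indicator_of_mem (show ζ ∈ Subtype.val ⁻¹' A' from hζ)]
      have h1 : ∀ r : Ioi (0 : ℝ), D.indicator
          (fun Y => ENNReal.ofReal (s ^ 2 * (‖coneMap (-(x : R3)) Y‖ / ‖Y‖))) ((r : ℝ) • (ζ : R3))
          = (Iio (⟨s ^ 2 / n, div_pos (by positivity) hpos⟩ : Ioi (0 : ℝ))).indicator
            (fun _ => ENNReal.ofReal (s ^ 2 * n)) r := by
        intro r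
        have hr : (0 : ℝ) < r := r.2
        by_cases hm : ((r : ℝ) • (ζ : R3)) ∈ D
        · rw [indicator_of_mem hm, indicator_of_mem ((hmem r).1 hm).1, coneMap_smul _ _ hr.le,
            norm_smul, norm_smul, hn, norm_S2, Real.norm_eq_abs, abs_of_pos hr]
          congr 1
          field_simp
        · rw [indicator_of_notMem hm, indicator_of_notMem]
          exact fun h => hm ((hmem r).2 ⟨h, hζ⟩)
      rw [lintegral_congr h1, lintegral_indicator measurableSet_Iio, setLIntegral_const,
        Measure.volumeIoiPow_apply_Iio, ← ENNReal.ofReal_mul (by positivity),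
        ← ENNReal.ofReal_mul (by positivity), harmonicDensity, ← hndef, ← hs]
      congr 1
      push_cast
      field_simp
      ring
    · rw [indicator_of_notMem (show ζ ∉ Subtype.val ⁻¹' A' from hζ)]
      refine (lintegral_congr fun r => ?_).trans lintegral_zero
      exact indicator_of_notMem (fun h => hζ ((hmem r).1 h).2) _
  have hAm : MeasurableSet (Subtype.val ⁻¹' A' : Set S2) := measurable_subtype_coe hA'
  rw [lintegral_congr hinner, lintegral_indicator hAm, lintegral_const_mul _
    (continuous_harmonicDensity hx).measurable.ennreal_ofReal] at hcv
  rw [Measure.toSphere_apply' _ ((continuous_moebiusSphere x).measurable hAm), ← hC]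
  have hdim : Module.finrank ℝ R3 = 3 := by simp
  rw [hdim] at hcv ⊢
  have e1 : ENNReal.ofReal ((s ^ 2) ^ 3) = ENNReal.ofReal (s ^ 6 / 3) * 3 := by
    rw [show (3 : ENNReal) = ENNReal.ofReal 3 by simp, ← ENNReal.ofReal_mul (by positivity)]
    congr 1; ring
  rw [e1, mul_assoc] at hcv
  exact ((ENNReal.mul_right_inj (by simpa using by positivity) ENNReal.ofReal_ne_top).1 hcv).symm

instance : IsProbabilityMeasure uniformS2 := by
  constructor
  rw [uniformS2, Measure.smul_apply, smul_eq_mul]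
  refine ENNReal.inv_mul_cancel ?_ (measure_ne_top _ _)
  rw [Measure.measure_univ_ne_zero]
  exact Measure.toSphere_ne_zero _

/-- The Poisson-type formula for harmonic measures. -/
theorem harmonicMeasure_eq_withDensity (x : ball (0 : R3) 1) :
    harmonicMeasure x
      = uniformS2.withDensity (fun ζ => ENNReal.ofReal (harmonicDensity x ζ)) := by
  ext A hA
  rw [harmonicMeasure, Measure.map_apply (continuous_moebiusSphere x).measurable hA,
    withDensity_apply _ hA, uniformS2, Measure.restrict_smul, lintegral_smul_measure,
    Measure.smul_apply, toSphere_preimage_moebiusSphere x hA]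

theorem uniformS2_apply_eq_zero {A : Set S2} (hA : MeasurableSet A)
    (h : (volume : Measure R3) (Ioo (0 : ℝ) 1 • (Subtype.val '' A)) = 0) : uniformS2 A = 0 := by
  rw [uniformS2, Measure.smul_apply, Measure.toSphere_apply' _ hA, h]
  simp

theorem uniformS2_submodule {W : Submodule ℝ R3} (hW : W ≠ ⊤) :
    uniformS2 {ζ : S2 | (ζ : R3) ∈ W} = 0 := by
  refine uniformS2_apply_eq_zero
    (measurable_subtype_coe W.closed_of_finiteDimensional.measurableSet) ?_
  refine measure_mono_null ?_ (Measure.addHaar_submodule volume W hW)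
  rintro _ ⟨r, -, _, ⟨ζ, hζ, rfl⟩, rfl⟩
  exact W.smul_mem r hζ

instance : NullSingletonClass uniformS2 := by
  constructor
  intro ζ
  have hW : Submodule.span ℝ {(ζ : R3)} ≠ ⊤ := by
    intro h
    have h1 : Module.finrank ℝ (Submodule.span ℝ {(ζ : R3)}) = 3 := by rw [h]; simp
    have h2 := finrank_span_singleton (K := ℝ) (ne_zero_of_mem_unit_sphere ζ)
    omega
  refine measure_mono_null ?_ (uniformS2_submodule hW)
  rintro _ rfl
  exact Submodule.mem_span_singleton_self _

/-- The equator is negligible. -/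
theorem ae_uniformS2_coord_two_ne_zero : ∀ᵐ ζ : S2 ∂uniformS2, (ζ : R3) 2 ≠ 0 := by
  have hW : LinearMap.ker (EuclideanSpace.proj (2 : Fin 3) : R3 →L[ℝ] ℝ).toLinearMap
      ≠ ⊤ := by
    intro h
    have : (EuclideanSpace.single 2 1 : R3) ∈
        LinearMap.ker (EuclideanSpace.proj (2 : Fin 3) : R3 →L[ℝ] ℝ).toLinearMap := by
      rw [h]; trivial
    simp at this
  rw [ae_iff]
  refine measure_mono_null ?_ (uniformS2_submodule hW)
  intro ζ hζ
  simpa using hζ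

/-- The action of a linear isometry of three-space on the unit sphere. -/
def sphereIsometry (U : R3 ≃ₗᵢ[ℝ] R3) (ζ : S2) : S2 :=
  ⟨U ζ, by simp⟩

@[simp]
theorem coe_sphereIsometry (U : R3 ≃ₗᵢ[ℝ] R3) (ζ : S2) : (sphereIsometry U ζ : R3) = U ζ := rfl

theorem continuous_sphereIsometry (U : R3 ≃ₗᵢ[ℝ] R3) : Continuous (sphereIsometry U) :=
  Continuous.subtype_mk (U.continuous.comp continuous_subtype_val) _

theorem map_sphereIsometry_uniformS2 (U : R3 ≃ₗᵢ[ℝ] R3) :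
    uniformS2.map (sphereIsometry U) = uniformS2 := by
  ext A hA
  have hU := (continuous_sphereIsometry U).measurable
  rw [Measure.map_apply hU hA, uniformS2, Measure.smul_apply, Measure.smul_apply,
    Measure.toSphere_apply' _ hA, Measure.toSphere_apply' _ (hU hA)]
  congr 2
  have h : Ioo (0 : ℝ) 1 • (Subtype.val '' (sphereIsometry U ⁻¹' A))
      = U ⁻¹' (Ioo (0 : ℝ) 1 • (Subtype.val '' A)) := by
    ext X
    constructor
    · rintro ⟨r, hr, _, ⟨ζ, hζ, rfl⟩, rfl⟩
      exact ⟨r, hr, U ζ, ⟨_, hζ, rfl⟩, (map_smul U r (ζ : R3)).symm⟩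
    · rintro ⟨r, hr, _, ⟨ζ, hζ, rfl⟩, h⟩
      refine ⟨r, hr, U.symm ζ, ⟨sphereIsometry U.symm ζ, ?_, rfl⟩, ?_⟩
      · have : sphereIsometry U (sphereIsometry U.symm ζ) = ζ := Subtype.ext (by simp)
        rwa [mem_preimage, this]
      · apply U.injective
        rw [← h]
        simp
  rw [h]
  exact U.measurePreserving.measure_preimage_equiv (f := U.toHomeomorph.toMeasurableEquiv) _

theorem integral_sphereIsometry {E : Type*} [NormedAddCommGroup E] [NormedSpace ℝ E]
    (U : R3 ≃ₗᵢ[ℝ] R3) {k : S2 → E} (hk : Continuous k) :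
    ∫ ζ, k (sphereIsometry U ζ) ∂uniformS2 = ∫ ζ, k ζ ∂uniformS2 := by
  conv_rhs => rw [← map_sphereIsometry_uniformS2 U]
  rw [integral_map (continuous_sphereIsometry U).aemeasurable
    hk.aestronglyMeasurable]

theorem moebius_map (U : R3 ≃ₗᵢ[ℝ] R3) (w x : R3) : moebius (U w) (U x) = U (moebius w x) := by
  simp [moebius, map_add]

/-- The image of a point of the open ball under a linear isometry. -/
def ballIsometry (U : R3 ≃ₗᵢ[ℝ] R3) (x : ball (0 : R3) 1) : ball (0 : R3) 1 :=
  ⟨U x, by rw [mem_ball_zero_iff, U.norm_map]; exact mem_ball_zero_iff.1 x.2⟩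

theorem harmonicMeasure_ballIsometry (U : R3 ≃ₗᵢ[ℝ] R3) (x : ball (0 : R3) 1) :
    harmonicMeasure (ballIsometry U x) = (harmonicMeasure x).map (sphereIsometry U) := by
  rw [harmonicMeasure, harmonicMeasure, Measure.map_map (continuous_sphereIsometry U).measurable
    (continuous_moebiusSphere x).measurable]
  conv_lhs => rw [← map_sphereIsometry_uniformS2 U]
  rw [Measure.map_map (continuous_moebiusSphere _).measurable
    (continuous_sphereIsometry U).measurable]
  congr 1
  ext1 ζ
  exact Subtype.ext (moebius_map U x ζ)

instance (x : ball (0 : R3) 1) : IsProbabilityMeasure (harmonicMeasure x) :=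
  Measure.isProbabilityMeasure_map (continuous_moebiusSphere x).aemeasurable

theorem integral_harmonicMeasure (x : ball (0 : R3) 1) {E : Type*} [NormedAddCommGroup E]
    [NormedSpace ℝ E] (k : S2 → E) :
    ∫ ζ, k ζ ∂(harmonicMeasure x) = ∫ ζ, harmonicDensity x ζ • k ζ ∂uniformS2 := by
  rw [harmonicMeasure_eq_withDensity]
  rw [integral_withDensity_eq_integral_toReal_smul
    (continuous_harmonicDensity (mem_ball_zero_iff.1 x.2)).measurable.ennreal_ofReal (by simp)]
  refine integral_congr_ae (Eventually.of_forall fun ζ => ?_)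
  simp only
  rw [ENNReal.toReal_ofReal (by unfold harmonicDensity; positivity)]

theorem integrable_of_continuous {E : Type*} [NormedAddCommGroup E] {μ : Measure S2}
    [IsFiniteMeasure μ] {k : S2 → E} (hk : Continuous k) : Integrable k μ :=
  hk.integrable_of_hasCompactSupport (HasCompactSupport.of_compactSpace k)

/-! ### Barycenters in the Klein model -/

/-- The passage from the Poincaré to the Klein model of hyperbolic space. -/
def toKlein (w : R3) : R3 := (2 / (1 + ‖w‖ ^ 2)) • w

/-- The passage from the Klein to the Poincaré model of hyperbolic space. -/
def ofKlein (y : R3) : R3 := (1 + √(1 - ‖y‖ ^ 2))⁻¹ • y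

theorem one_sub_norm_toKlein_sq (w : R3) :
    1 - ‖toKlein w‖ ^ 2 = ((1 - ‖w‖ ^ 2) / (1 + ‖w‖ ^ 2)) ^ 2 := by
  rw [toKlein, norm_smul, mul_pow, Real.norm_eq_abs, sq_abs]
  field_simp
  ring

theorem norm_toKlein_lt_one {w : R3} (hw : ‖w‖ < 1) : ‖toKlein w‖ < 1 := by
  have h : 0 < 1 - ‖toKlein w‖ ^ 2 := by
    have : 0 < 1 - ‖w‖ ^ 2 := by nlinarith [norm_nonneg w]
    rw [one_sub_norm_toKlein_sq]; positivity
  nlinarith [norm_nonneg (toKlein w)]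

theorem ofKlein_toKlein {w : R3} (hw : ‖w‖ < 1) : ofKlein (toKlein w) = w := by
  have h : 0 < 1 - ‖w‖ ^ 2 := by nlinarith [norm_nonneg w]
  rw [ofKlein, one_sub_norm_toKlein_sq, Real.sqrt_sq (by positivity), toKlein, smul_smul]
  have : (1 + (1 - ‖w‖ ^ 2) / (1 + ‖w‖ ^ 2))⁻¹ * (2 / (1 + ‖w‖ ^ 2)) = 1 := by
    field_simp; ring
  rw [this, one_smul]

theorem one_add_norm_ofKlein_sq {y : R3} (hy : ‖y‖ ≤ 1) :
    1 + ‖ofKlein y‖ ^ 2 = 2 / (1 + √(1 - ‖y‖ ^ 2)) := by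
  have h1 := Real.sq_sqrt (show 0 ≤ 1 - ‖y‖ ^ 2 by nlinarith [norm_nonneg y])
  have h2 := Real.sqrt_nonneg (1 - ‖y‖ ^ 2)
  rw [ofKlein, norm_smul, mul_pow, Real.norm_eq_abs, sq_abs]
  set t := √(1 - ‖y‖ ^ 2)
  have h3 : ‖y‖ ^ 2 = 1 - t ^ 2 := by linarith
  rw [h3]
  field_simp
  ring

theorem toKlein_ofKlein {y : R3} (hy : ‖y‖ ≤ 1) : toKlein (ofKlein y) = y := by
  rw [toKlein, one_add_norm_ofKlein_sq hy, ofKlein, smul_smul]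
  have h2 := Real.sqrt_nonneg (1 - ‖y‖ ^ 2)
  have : 2 / (2 / (1 + √(1 - ‖y‖ ^ 2))) * (1 + √(1 - ‖y‖ ^ 2))⁻¹ = 1 := by
    field_simp
  rw [this, one_smul]

theorem norm_ofKlein_lt_one {y : R3} (hy : ‖y‖ < 1) : ‖ofKlein y‖ < 1 := by
  have h := one_add_norm_ofKlein_sq hy.le
  have h1 : 0 < √(1 - ‖y‖ ^ 2) := Real.sqrt_pos.2 (by nlinarith [norm_nonneg y])
  have h2 : 2 / (1 + √(1 - ‖y‖ ^ 2)) < 2 := by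
    rw [div_lt_iff₀ (by positivity)]; linarith
  nlinarith [norm_nonneg (ofKlein y)]

theorem one_sub_inner_pos {y : R3} (hy : ‖y‖ < 1) (ζ : S2) : 0 < 1 - inner ℝ y (ζ : R3) := by
  linarith [inner_S2_le y ζ]

theorem one_sub_norm_sq_pos {y : R3} (hy : ‖y‖ < 1) : 0 < 1 - ‖y‖ ^ 2 := by
  nlinarith [norm_nonneg y]

theorem continuous_one_sub_inner_inv {y : R3} (hy : ‖y‖ < 1) :
    Continuous fun ζ : S2 => (1 - inner ℝ y (ζ : R3))⁻¹ :=
  Continuous.inv₀ (by fun_prop) fun ζ => (one_sub_inner_pos hy ζ).ne'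

/-- The equation for the barycenter of `μ` in the Klein model: criticality of
`y ↦ ∫ log (1 - ⟪y, ζ⟫) ∂μ - log (1 - ‖y‖²) / 2`. -/
def KleinCritical (μ : Measure S2) (y : R3) : Prop :=
  ∫ ζ : S2, (1 - inner ℝ y (ζ : R3))⁻¹ • (ζ : R3) ∂μ = (1 - ‖y‖ ^ 2)⁻¹ • y

theorem KleinCritical.integral_inner_div {μ : Measure S2} [IsFiniteMeasure μ] {y : R3}
    (hy : ‖y‖ < 1) (h : KleinCritical μ y) (v : R3) :
    ∫ ζ : S2, inner ℝ v (ζ : R3) / (1 - inner ℝ y (ζ : R3)) ∂μ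
      = inner ℝ v y / (1 - ‖y‖ ^ 2) := by
  have h1 : Integrable (fun ζ : S2 => (1 - inner ℝ y (ζ : R3))⁻¹ • (ζ : R3)) μ :=
    integrable_of_continuous ((continuous_one_sub_inner_inv hy).smul continuous_subtype_val)
  have h2 := integral_inner (𝕜 := ℝ) h1 v
  rw [h, inner_smul_right] at h2
  rw [div_eq_inv_mul, ← h2]
  refine integral_congr_ae (Eventually.of_forall fun ζ => ?_)
  simp only [inner_smul_right]
  rw [div_eq_inv_mul]

theorem integral_one_sub_inner_inv {μ : Measure S2} [IsProbabilityMeasure μ] {y : R3}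
    (hy : ‖y‖ < 1) :
    ∫ ζ : S2, (1 - inner ℝ y (ζ : R3))⁻¹ ∂μ
      = 1 + inner ℝ y (∫ ζ : S2, (1 - inner ℝ y (ζ : R3))⁻¹ • (ζ : R3) ∂μ) := by
  have h1 : Integrable (fun ζ : S2 => (1 - inner ℝ y (ζ : R3))⁻¹ • (ζ : R3)) μ :=
    integrable_of_continuous ((continuous_one_sub_inner_inv hy).smul continuous_subtype_val)
  rw [← integral_inner h1 y]
  have h2 : ∫ ζ : S2, (1 : ℝ) ∂μ = 1 := by simp
  refine Eq.trans ?_ (congrArg (fun c => c + _) h2)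
  rw [← integral_add (integrable_const _) (h1.const_inner y)]
  refine integral_congr_ae (Eventually.of_forall fun ζ => ?_)
  have := (one_sub_inner_pos hy ζ).ne'
  simp only [inner_smul_right]
  field_simp
  ring

/-- Both equations say that `I = ∫ (1 - ⟪y, ζ⟫)⁻¹ • ζ ∂μ`, where `y = toKlein w`, is a multiple of
`w`; pairing `I` with `y` determines the factor, because `∫ (1 - ⟪y, ζ⟫)⁻¹ ∂μ = 1 + ⟪y, I⟫`. -/
theorem baryField_eq_zero_iff {μ : Measure S2} [IsProbabilityMeasure μ] {w : R3} (hw : ‖w‖ < 1) :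
    baryField μ w = 0 ↔ KleinCritical μ (toKlein w) := by
  have hy := norm_toKlein_lt_one hw
  have hq := one_sub_norm_sq_pos hw
  have hp : 0 < 1 + ‖w‖ ^ 2 := by positivity
  have hJ := integral_one_sub_inner_inv (μ := μ) hy
  have hI1 : Integrable (fun ζ : S2 => (1 - inner ℝ (toKlein w) (ζ : R3))⁻¹ • (ζ : R3)) μ :=
    integrable_of_continuous ((continuous_one_sub_inner_inv hy).smul continuous_subtype_val)
  have hI2 : Integrable (fun ζ : S2 => (1 - inner ℝ (toKlein w) (ζ : R3))⁻¹) μ :=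
    integrable_of_continuous (continuous_one_sub_inner_inv hy)
  unfold KleinCritical
  set I := ∫ ζ : S2, (1 - inner ℝ (toKlein w) (ζ : R3))⁻¹ • (ζ : R3) ∂μ with hI
  have hm : ∀ ζ : S2, moebius (-w) (ζ : R3) = ((1 - ‖w‖ ^ 2) / (1 + ‖w‖ ^ 2)) •
      ((1 - inner ℝ (toKlein w) (ζ : R3))⁻¹ • (ζ : R3) -
        (1 - inner ℝ (toKlein w) (ζ : R3))⁻¹ • w) - w := by
    intro ζ
    have hu := one_sub_inner_pos hy ζ
    have hD : 1 + ‖w‖ ^ 2 - 2 * inner ℝ w (ζ : R3)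
        = (1 + ‖w‖ ^ 2) * (1 - inner ℝ (toKlein w) (ζ : R3)) := by
      rw [toKlein, real_inner_smul_left]; field_simp
    have hD' : inner ℝ w (ζ : R3) = ((1 + ‖w‖ ^ 2) -
      (1 + ‖w‖ ^ 2) * (1 - inner ℝ (toKlein w) (ζ : R3))) / 2 := by linarith
    rw [moebius, inner_neg_left, norm_neg, norm_S2,
      show 1 + ‖w‖ ^ 2 * 1 ^ 2 + 2 * -inner ℝ w (ζ : R3)
        = (1 + ‖w‖ ^ 2) * (1 - inner ℝ (toKlein w) (ζ : R3)) by rw [← hD]; ring, hD']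
    have hu' := hu.ne'
    set u := 1 - inner ℝ (toKlein w) (ζ : R3)
    match_scalars <;> field_simp
    ring
  have hint : ∫ ζ : S2, moebius (-w) (ζ : R3) ∂μ
      = ((1 - ‖w‖ ^ 2) / (1 + ‖w‖ ^ 2)) • (I - (1 + inner ℝ (toKlein w) I) • w) - w := by
    rw [integral_congr_ae (Eventually.of_forall hm), integral_sub, integral_smul, integral_sub hI1
      (hI2.smul_const w), integral_smul_const, hJ]
    · simp [hI]
    · exact (hI1.sub (hI2.smul_const w)).smul ((1 - ‖w‖ ^ 2) / (1 + ‖w‖ ^ 2))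
    · exact integrable_const _
  rw [baryField, smul_eq_zero_iff_right (by positivity), hint, one_sub_norm_toKlein_sq]
  constructor
  · intro h
    set α := 1 + inner ℝ (toKlein w) I + (1 + ‖w‖ ^ 2) / (1 - ‖w‖ ^ 2) with hα
    have h1 : I = α • w := by
      have h2 : I - (1 + inner ℝ (toKlein w) I) • w
          = ((1 + ‖w‖ ^ 2) / (1 - ‖w‖ ^ 2)) • w := by
        have h3 := sub_eq_zero.1 h
        rw [eq_comm, ← inv_smul_eq_iff₀ (by positivity), inv_div] at h3
        exact h3.symm
      rw [hα, add_smul, ← h2]; abel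
    have h4 : α = 1 + α * (2 / (1 + ‖w‖ ^ 2) * ‖w‖ ^ 2) + (1 + ‖w‖ ^ 2) / (1 - ‖w‖ ^ 2) := by
      conv_lhs => rw [hα, h1]
      rw [inner_smul_right, toKlein, real_inner_smul_left, real_inner_self_eq_norm_sq]
    have h5 : α = 2 * (1 + ‖w‖ ^ 2) / (1 - ‖w‖ ^ 2) ^ 2 := by
      field_simp at h4 ⊢
      linear_combination h4
    rw [h1, h5, toKlein, smul_smul]
    congr 1
    field_simp
  · intro h
    have h1 : I = (2 * (1 + ‖w‖ ^ 2) / (1 - ‖w‖ ^ 2) ^ 2) • w := by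
      rw [h, toKlein, smul_smul]
      congr 1
      field_simp
    rw [h1, inner_smul_right, toKlein, real_inner_smul_left, real_inner_self_eq_norm_sq]
    match_scalars
    field_simp
    ring

/-! ### Uniqueness and nondegeneracy of the barycenter -/

/-- A line meets the sphere in the zeros of a quadratic polynomial. -/
theorem finite_setOf_mem_line (y : R3) {v : R3} (hv : v ≠ 0) :
    {ζ : S2 | ∃ t : ℝ, (ζ : R3) = y + t • v}.Finite := by
  have hv' : ‖v‖ ^ 2 ≠ 0 := pow_ne_zero _ (norm_ne_zero_iff.2 hv)
  set p : Polynomial ℝ := Polynomial.C (‖v‖ ^ 2) * Polynomial.X ^ 2 +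
    Polynomial.C (2 * inner ℝ y v) * Polynomial.X + Polynomial.C (‖y‖ ^ 2 - 1) with hp
  have hp0 : p ≠ 0 := fun h => hv' (by
    have := Polynomial.leadingCoeff_quadratic (b := 2 * inner ℝ y v) (c := ‖y‖ ^ 2 - 1) hv'
    rw [← hp, h] at this
    simpa using this.symm)
  refine Set.Finite.of_finite_image
    (Set.Finite.subset (p.roots.toFinset.finite_toSet.image fun t => y + t • v) ?_)
    Subtype.val_injective.injOn
  rintro _ ⟨ζ, ⟨t, ht⟩, rfl⟩
  refine ⟨t, ?_, ht.symm⟩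
  simp only [Finset.mem_coe, Multiset.mem_toFinset, Polynomial.mem_roots hp0, Polynomial.IsRoot]
  have h1 : ‖y + t • v‖ ^ 2 = 1 := by rw [← ht, norm_S2, one_pow]
  rw [norm_add_sq_real, inner_smul_right, norm_smul, mul_pow, Real.norm_eq_abs, sq_abs] at h1
  simp only [hp, Polynomial.eval_add, Polynomial.eval_mul, Polynomial.eval_C, Polynomial.eval_pow,
    Polynomial.eval_X]
  linarith

/-- The comparison of two points of the Klein ball as seen from a boundary point `ζ`. It is the
Cauchy-Schwarz inequality, with its remainder term; the remainder vanishes for at most two `ζ`. -/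
theorem klein_comparison (y₁ y₂ : R3) (ζ : S2) :
    2 * (1 - inner ℝ y₁ (ζ : R3)) * (1 - inner ℝ y₂ (ζ : R3)) * (1 - inner ℝ y₁ y₂)
      - (1 - inner ℝ y₂ (ζ : R3)) ^ 2 * (1 - ‖y₁‖ ^ 2)
      - (1 - inner ℝ y₁ (ζ : R3)) ^ 2 * (1 - ‖y₂‖ ^ 2)
      = ‖(1 - inner ℝ y₁ (ζ : R3)) • y₂ - (1 - inner ℝ y₂ (ζ : R3)) • y₁
        - (inner ℝ y₂ (ζ : R3) - inner ℝ y₁ (ζ : R3)) • (ζ : R3)‖ ^ 2 := by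
  rw [norm_sub_sq_real, norm_sub_sq_real]
  simp only [norm_smul, mul_pow, Real.norm_eq_abs, sq_abs, norm_S2, inner_smul_right,
    real_inner_smul_left, inner_sub_left, real_inner_comm y₁ y₂]
  ring

theorem klein_comparison_pos {y₁ y₂ : R3} (hy₁ : ‖y₁‖ < 1) (h12 : y₁ ≠ y₂) {ζ : S2}
    (hζ : ¬ ∃ t : ℝ, (ζ : R3) = y₁ + t • (y₂ - y₁)) :
    0 < 2 * (1 - inner ℝ y₁ (ζ : R3)) * (1 - inner ℝ y₂ (ζ : R3)) * (1 - inner ℝ y₁ y₂)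
      - (1 - inner ℝ y₂ (ζ : R3)) ^ 2 * (1 - ‖y₁‖ ^ 2)
      - (1 - inner ℝ y₁ (ζ : R3)) ^ 2 * (1 - ‖y₂‖ ^ 2) := by
  rw [klein_comparison]
  refine pow_pos (norm_pos_iff.2 fun h => hζ ?_) 2
  have hu := one_sub_inner_pos hy₁ ζ
  set u := 1 - inner ℝ y₁ (ζ : R3) with hu'
  set c := inner ℝ y₂ (ζ : R3) - inner ℝ y₁ (ζ : R3) with hc
  have hv : 1 - inner ℝ y₂ (ζ : R3) = u - c := by rw [hu', hc]; ring
  rw [hv] at h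
  have h1 : u • (y₂ - y₁) = c • ((ζ : R3) - y₁) := by
    refine sub_eq_zero.1 (Eq.trans ?_ h)
    module
  have hc0 : c ≠ 0 := by
    intro h0
    rw [h0, zero_smul ℝ ((ζ : R3) - y₁)] at h1
    exact h12 (sub_eq_zero.1 ((smul_eq_zero.1 h1).resolve_left hu.ne')).symm
  refine ⟨c⁻¹ * u, ?_⟩
  rw [mul_smul, h1, smul_smul, inv_mul_cancel₀ hc0]
  module

theorem KleinCritical.integral_ratio {μ : Measure S2} [IsProbabilityMeasure μ] {y : R3}
    (hy : ‖y‖ < 1) (h : KleinCritical μ y) (y' : R3) :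
    ∫ ζ : S2, (1 - inner ℝ y' (ζ : R3)) / (1 - inner ℝ y (ζ : R3)) ∂μ
      = (1 - inner ℝ y' y) / (1 - ‖y‖ ^ 2) := by
  have h1 := integral_one_sub_inner_inv (μ := μ) hy
  have h2 := h.integral_inner_div hy y'
  have hs := one_sub_norm_sq_pos hy
  have hc := continuous_one_sub_inner_inv hy
  rw [h, inner_smul_right, real_inner_self_eq_norm_sq] at h1
  have h3 : ∫ ζ : S2, (1 - inner ℝ y' (ζ : R3)) / (1 - inner ℝ y (ζ : R3)) ∂μ
      = ∫ ζ : S2, (1 - inner ℝ y (ζ : R3))⁻¹ ∂μ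
        - ∫ ζ : S2, inner ℝ y' (ζ : R3) / (1 - inner ℝ y (ζ : R3)) ∂μ := by
    rw [← integral_sub (integrable_of_continuous hc) (integrable_of_continuous ?_)]
    · refine integral_congr_ae (Eventually.of_forall fun ζ => ?_)
      simp only
      ring
    · simp only [div_eq_mul_inv]
      exact Continuous.mul (by fun_prop) hc
  rw [h3, h1, h2]
  field_simp
  ring

theorem integral_pos_of_ae_pos {μ : Measure S2} [NeZero μ] {k : S2 → ℝ} (hk : Integrable k μ)
    (hpos : ∀ᵐ ζ ∂μ, 0 < k ζ) : 0 < ∫ ζ, k ζ ∂μ := by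
  rw [integral_pos_iff_support_of_nonneg_ae (hpos.mono fun _ h => h.le) hk]
  have h1 : ∀ᵐ ζ ∂μ, ζ ∈ Function.support k := hpos.mono fun _ h => h.ne'
  rw [show μ (Function.support k) = μ univ from measure_congr (eventuallyEq_univ.2 h1)]
  exact Measure.measure_univ_pos.2 (NeZero.ne μ)

theorem integral_pos_of_finite_compl {μ : Measure S2} [NullSingletonClass μ] [NeZero μ]
    {k : S2 → ℝ} (hk : Integrable k μ) {N : Set S2} (hN : N.Finite)
    (hpos : ∀ ζ ∉ N, 0 < k ζ) : 0 < ∫ ζ, k ζ ∂μ :=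
  integral_pos_of_ae_pos hk
    (mem_of_superset (compl_mem_ae_iff.2 (hN.measure_zero μ)) fun ζ hζ => hpos ζ hζ)

theorem continuous_inner_div {y : R3} (hy : ‖y‖ < 1) (v : R3) :
    Continuous fun ζ : S2 => inner ℝ v (ζ : R3) / (1 - inner ℝ y (ζ : R3)) :=
  Continuous.div (by fun_prop) (by fun_prop) fun ζ => (one_sub_inner_pos hy ζ).ne'

theorem continuous_ratio {y : R3} (hy : ‖y‖ < 1) (y' : R3) :
    Continuous fun ζ : S2 => (1 - inner ℝ y' (ζ : R3)) / (1 - inner ℝ y (ζ : R3)) :=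
  Continuous.div (by fun_prop) (by fun_prop) fun ζ => (one_sub_inner_pos hy ζ).ne'

/-- The integrated form of `klein_comparison_pos`. -/
theorem integral_ratio_add_lt {μ : Measure S2} [IsProbabilityMeasure μ] [NullSingletonClass μ]
    {y₁ y₂ : R3} (hy₁ : ‖y₁‖ < 1) (hy₂ : ‖y₂‖ < 1) (h12 : y₁ ≠ y₂) :
    (1 - ‖y₁‖ ^ 2) * ∫ ζ : S2, (1 - inner ℝ y₂ (ζ : R3)) / (1 - inner ℝ y₁ (ζ : R3)) ∂μ +
      (1 - ‖y₂‖ ^ 2) * ∫ ζ : S2, (1 - inner ℝ y₁ (ζ : R3)) / (1 - inner ℝ y₂ (ζ : R3)) ∂μ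
      < 2 * (1 - inner ℝ y₁ y₂) := by
  have c1 := continuous_ratio hy₁ y₂
  have c2 := continuous_ratio hy₂ y₁
  have i1 := (integrable_of_continuous (μ := μ) c1).const_mul (1 - ‖y₁‖ ^ 2)
  have i2 := (integrable_of_continuous (μ := μ) c2).const_mul (1 - ‖y₂‖ ^ 2)
  have i3 : Integrable (fun _ : S2 => 2 * (1 - inner ℝ y₁ y₂)) μ := integrable_const _
  have hpt : ∀ ζ : S2, 2 * (1 - inner ℝ y₁ y₂) -
      ((1 - ‖y₁‖ ^ 2) * ((1 - inner ℝ y₂ (ζ : R3)) / (1 - inner ℝ y₁ (ζ : R3))) +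
      (1 - ‖y₂‖ ^ 2) * ((1 - inner ℝ y₁ (ζ : R3)) / (1 - inner ℝ y₂ (ζ : R3))))
      = (2 * (1 - inner ℝ y₁ (ζ : R3)) * (1 - inner ℝ y₂ (ζ : R3)) * (1 - inner ℝ y₁ y₂)
      - (1 - inner ℝ y₂ (ζ : R3)) ^ 2 * (1 - ‖y₁‖ ^ 2)
      - (1 - inner ℝ y₁ (ζ : R3)) ^ 2 * (1 - ‖y₂‖ ^ 2)) /
        ((1 - inner ℝ y₁ (ζ : R3)) * (1 - inner ℝ y₂ (ζ : R3))) := by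
    intro ζ
    have h1 := (one_sub_inner_pos hy₁ ζ).ne'
    have h2 := (one_sub_inner_pos hy₂ ζ).ne'
    field_simp
    ring
  have hpos := integral_pos_of_finite_compl (i3.sub (i1.add i2)) (μ := μ)
    (finite_setOf_mem_line y₁ (sub_ne_zero.2 h12.symm)) (fun ζ hζ => ?_)
  · rw [integral_sub' i3 (i1.add i2), integral_add' i1 i2] at hpos
    simp only [integral_const_mul, integral_const, probReal_univ, one_smul] at hpos
    linarith
  · simp only [Pi.sub_apply, Pi.add_apply]
    rw [hpt]
    exact div_pos (klein_comparison_pos hy₁ h12 hζ)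
      (mul_pos (one_sub_inner_pos hy₁ ζ) (one_sub_inner_pos hy₂ ζ))

/-- Uniqueness: at two critical points the integrated comparison inequality would be an
equality. -/
theorem KleinCritical.eq {μ : Measure S2} [IsProbabilityMeasure μ] [NullSingletonClass μ]
    {y₁ y₂ : R3} (hy₁ : ‖y₁‖ < 1) (hy₂ : ‖y₂‖ < 1) (h₁ : KleinCritical μ y₁)
    (h₂ : KleinCritical μ y₂) : y₁ = y₂ := by
  by_contra h12
  have h := integral_ratio_add_lt (μ := μ) hy₁ hy₂ h12
  have := one_sub_norm_sq_pos hy₁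
  have := one_sub_norm_sq_pos hy₂
  rw [h₁.integral_ratio hy₁, h₂.integral_ratio hy₂, mul_div_cancel₀ _ (by positivity),
    mul_div_cancel₀ _ (by positivity), real_inner_comm y₁ y₂] at h
  linarith

/-- The infinitesimal form of `klein_comparison`. -/
theorem klein_hessian_identity (y v : R3) (ζ : S2) :
    (1 - inner ℝ y (ζ : R3)) ^ 2 * ‖v‖ ^ 2
      + 2 * (1 - inner ℝ y (ζ : R3)) * inner ℝ v (ζ : R3) * inner ℝ v y
      - (1 - ‖y‖ ^ 2) * inner ℝ v (ζ : R3) ^ 2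
      = ‖(1 - inner ℝ y (ζ : R3)) • v + inner ℝ v (ζ : R3) • (y - (ζ : R3))‖ ^ 2 := by
  rw [norm_add_sq_real, norm_smul, norm_smul, mul_pow, mul_pow, norm_sub_sq_real y]
  simp only [Real.norm_eq_abs, sq_abs, norm_S2, inner_smul_right, real_inner_smul_left,
    inner_sub_right]
  ring

/-- The Hessian of the energy at a critical point is positive definite. -/
theorem KleinCritical.integral_sq_lt {μ : Measure S2} [IsProbabilityMeasure μ]
    [NullSingletonClass μ] {y : R3} (hy : ‖y‖ < 1) (h : KleinCritical μ y) {v : R3} (hv : v ≠ 0) :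
    ∫ ζ : S2, (inner ℝ v (ζ : R3) / (1 - inner ℝ y (ζ : R3))) ^ 2 ∂μ
      < ‖v‖ ^ 2 / (1 - ‖y‖ ^ 2) + 2 * (inner ℝ v y / (1 - ‖y‖ ^ 2)) ^ 2 := by
  have hs := one_sub_norm_sq_pos hy
  have c1 := continuous_inner_div hy v
  have i1 := (integrable_of_continuous (μ := μ) c1).const_mul (2 * inner ℝ v y)
  have i2 := (integrable_of_continuous (μ := μ) (c1.pow 2)).const_mul (1 - ‖y‖ ^ 2)
  have i3 : Integrable (fun _ : S2 => ‖v‖ ^ 2) μ := integrable_const _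
  have hpt : ∀ ζ : S2, ‖v‖ ^ 2 +
      2 * inner ℝ v y * (inner ℝ v (ζ : R3) / (1 - inner ℝ y (ζ : R3))) -
      (1 - ‖y‖ ^ 2) * (inner ℝ v (ζ : R3) / (1 - inner ℝ y (ζ : R3))) ^ 2
      = ‖(1 - inner ℝ y (ζ : R3)) • v + inner ℝ v (ζ : R3) • (y - (ζ : R3))‖ ^ 2 /
        (1 - inner ℝ y (ζ : R3)) ^ 2 := by
    intro ζ
    have h1 := (one_sub_inner_pos hy ζ).ne'
    rw [← klein_hessian_identity]
    field_simp
  have hpos := integral_pos_of_finite_compl ((i3.add i1).sub i2) (μ := μ)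
    (finite_setOf_mem_line y hv) (fun ζ hζ => ?_)
  · rw [integral_sub' (i3.add i1) i2, integral_add' i3 i1, integral_const_mul, integral_const_mul,
      h.integral_inner_div hy v] at hpos
    simp only [integral_const, probReal_univ, one_smul, sub_pos, Pi.pow_apply] at hpos
    rw [← mul_lt_mul_iff_right₀ hs]
    refine hpos.trans_eq ?_
    field_simp
  · simp only [Pi.sub_apply, Pi.add_apply, Pi.pow_apply]
    rw [hpt]
    have hu := one_sub_inner_pos hy ζ
    refine div_pos (pow_pos (norm_pos_iff.2 fun h0 => hζ ?_) 2) (pow_pos hu 2)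
    set u := 1 - inner ℝ y (ζ : R3)
    set c := inner ℝ v (ζ : R3)
    have h1 : u • v = c • ((ζ : R3) - y) := by
      refine sub_eq_zero.1 (Eq.trans ?_ h0)
      module
    have hc0 : c ≠ 0 := by
      intro hc
      rw [hc, zero_smul ℝ ((ζ : R3) - y)] at h1
      exact hv ((smul_eq_zero.1 h1).resolve_left hu.ne')
    refine ⟨c⁻¹ * u, ?_⟩
    rw [mul_smul, h1, smul_smul, inv_mul_cancel₀ hc0]
    module

/-! ### Existence of the barycenter -/

/-- The average of the Busemann functions of hyperbolic space, in the Klein model. -/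
def kleinEnergy (μ : Measure S2) (y : R3) : ℝ :=
  ∫ ζ : S2, Real.log (1 - inner ℝ y (ζ : R3)) ∂μ - Real.log (1 - ‖y‖ ^ 2) / 2

theorem continuous_log_one_sub_inner {y : R3} (hy : ‖y‖ < 1) :
    Continuous fun ζ : S2 => Real.log (1 - inner ℝ y (ζ : R3)) :=
  Continuous.log (by fun_prop) fun ζ => (one_sub_inner_pos hy ζ).ne'

theorem hasFDerivAt_kleinEnergy {μ : Measure S2} [IsProbabilityMeasure μ] {y : R3}
    (hy : ‖y‖ < 1) :
    HasFDerivAt (kleinEnergy μ)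
      (innerSL ℝ ((1 - ‖y‖ ^ 2)⁻¹ • y - ∫ ζ : S2, (1 - inner ℝ y (ζ : R3))⁻¹ • (ζ : R3) ∂μ)) y := by
  obtain ⟨r, hr1, hr2⟩ := exists_between hy
  have h1 : HasFDerivAt (fun y : R3 => ∫ ζ : S2, Real.log (1 - inner ℝ y (ζ : R3)) ∂μ)
      (∫ ζ : S2, -innerSL ℝ ((1 - inner ℝ y (ζ : R3))⁻¹ • (ζ : R3)) ∂μ) y := by
    refine hasFDerivAt_integral_of_dominated_of_fderiv_le
      (F := fun (y : R3) (ζ : S2) => Real.log (1 - inner ℝ y (ζ : R3)))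
      (F' := fun (y : R3) (ζ : S2) => -innerSL ℝ ((1 - inner ℝ y (ζ : R3))⁻¹ • (ζ : R3)))
      (bound := fun _ => (1 - r)⁻¹)
      (s := ball 0 r) (isOpen_ball.mem_nhds (mem_ball_zero_iff.2 hr1)) ?_ ?_ ?_ ?_ ?_ ?_
    · filter_upwards [isOpen_ball.mem_nhds (mem_ball_zero_iff.2 hy)] with z hz
      exact (continuous_log_one_sub_inner (mem_ball_zero_iff.1 hz)).aestronglyMeasurable
    · exact integrable_of_continuous (continuous_log_one_sub_inner hy)
    · refine Continuous.aestronglyMeasurable ?_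
      exact ((innerSL ℝ).continuous.comp
        ((continuous_one_sub_inner_inv hy).smul continuous_subtype_val)).neg
    · refine Eventually.of_forall fun ζ z hz => ?_
      have hz' := mem_ball_zero_iff.1 hz
      have hp := one_sub_inner_pos (hz'.trans hr2) ζ
      rw [norm_neg, innerSL_apply_norm, norm_smul, norm_S2, mul_one, Real.norm_eq_abs, abs_of_pos
        (inv_pos.2 hp)]
      refine inv_anti₀ (by linarith) ?_
      linarith [inner_S2_le z ζ]
    · exact integrable_const _
    · refine Eventually.of_forall fun ζ z hz => ?_
      have hz' := mem_ball_zero_iff.1 hz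
      have hp := one_sub_inner_pos (hz'.trans hr2) ζ
      have hd : HasFDerivAt (fun y : R3 => 1 - inner ℝ y (ζ : R3)) (-innerSL ℝ (ζ : R3)) z := by
        have := ((innerSL ℝ (ζ : R3)).hasFDerivAt (x := z)).const_sub 1
        simpa [real_inner_comm] using this
      convert! hd.log hp.ne' using 1
      simp
  have h2 : HasFDerivAt (fun y : R3 => Real.log (1 - ‖y‖ ^ 2) / 2)
      (-innerSL ℝ ((1 - ‖y‖ ^ 2)⁻¹ • y)) y := by
    have hd := ((hasStrictFDerivAt_norm_sq y).hasFDerivAt.const_sub 1).log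
      (one_sub_norm_sq_pos hy).ne'
    convert! hd.mul_const (2⁻¹ : ℝ) using 1
    ext v
    simp
    ring
  convert! h1.sub h2 using 1
  rw [integral_neg, map_sub, (innerSL ℝ).integral_comp_comm, sub_neg_eq_add, neg_add_eq_sub]
  exact integrable_of_continuous ((continuous_one_sub_inner_inv hy).smul continuous_subtype_val)

/-- The energy of a measure without atoms is positive near the boundary of the ball. -/
theorem eventually_kleinEnergy_pos {μ : Measure S2} [IsProbabilityMeasure μ]
    [NullSingletonClass μ] (ξ : S2) :
    ∀ᶠ y in 𝓝 (ξ : R3), ‖y‖ < 1 → 0 < kleinEnergy μ y := by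
  -- On a neighbourhood `U` of `ξ` of mass at most `1 / 4` the integrand is at least
  -- `log (s / 2)`, where `s = 1 - ‖y‖ ^ 2`, and off `U` it is at least the constant `log c`; the
  -- term `- log s / 2` of the energy wins.
  obtain ⟨U, hξU, hU, hμU⟩ := Set.exists_isOpen_lt_of_lt ({ξ} : Set S2) (μ := μ)
    (ENNReal.ofReal (1 / 4)) (by rw [measure_singleton]; positivity)
  obtain ⟨δ, hδ, hball⟩ := Metric.isOpen_iff.1 hU ξ (hξU rfl)
  set c : ℝ := min (δ ^ 2 / 4) 1 with hc
  have hc0 : 0 < c := by positivity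
  have hlc : Real.log c ≤ 0 := Real.log_nonpos hc0.le (min_le_right _ _)
  have hm : μ.real U ≤ 1 / 4 := by
    rw [measureReal_def]
    exact ENNReal.toReal_le_of_le_ofReal (by norm_num) hμU.le
  have hnear : ∀ᶠ y in 𝓝 (ξ : R3), ‖y - (ξ : R3)‖ < δ ^ 2 / 4 := by
    have : ContinuousAt (fun y : R3 => ‖y - (ξ : R3)‖) ξ := by fun_prop
    exact this.eventually_lt continuousAt_const (by simpa using by positivity)
  have hsmall : ∀ᶠ y in 𝓝 (ξ : R3), 1 - ‖y‖ ^ 2 < c ^ 4 / 2 := by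
    have : ContinuousAt (fun y : R3 => 1 - ‖y‖ ^ 2) ξ := by fun_prop
    exact this.eventually_lt continuousAt_const (by rw [norm_S2]; simpa using by positivity)
  filter_upwards [hnear, hsmall] with y hy1 hy2 hy
  have hs := one_sub_norm_sq_pos hy
  set s := 1 - ‖y‖ ^ 2 with hsdef
  have hls : Real.log (s / 2) ≤ 0 :=
    Real.log_nonpos (by positivity) (by nlinarith [norm_nonneg y])
  have hlow : ∀ ζ : S2, U.indicator (fun _ => Real.log (s / 2)) ζ + Real.log c
      ≤ Real.log (1 - inner ℝ y (ζ : R3)) := by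
    intro ζ
    have hu := one_sub_inner_pos hy ζ
    by_cases hζ : ζ ∈ U
    · rw [indicator_of_mem hζ]
      have : Real.log (s / 2) ≤ Real.log (1 - inner ℝ y (ζ : R3)) := by
        refine Real.log_le_log (by positivity) ?_
        nlinarith [inner_S2_le y ζ, norm_nonneg y]
      linarith
    · rw [indicator_of_notMem hζ, zero_add]
      refine Real.log_le_log hc0 ((min_le_left _ _).trans ?_)
      have h1 : δ ≤ ‖(ζ : R3) - ξ‖ := by
        by_contra hlt
        exact hζ (hball (by rw [mem_ball, Subtype.dist_eq, dist_eq_norm]; exact not_le.1 hlt))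
      have h2 : ‖(ζ : R3) - ξ‖ ^ 2 = 2 - 2 * inner ℝ (ξ : R3) (ζ : R3) := by
        rw [norm_sub_sq_real, norm_S2, norm_S2, real_inner_comm]; ring
      have h3 : inner ℝ (y - (ξ : R3)) (ζ : R3) ≤ ‖y - (ξ : R3)‖ := inner_S2_le _ _
      rw [inner_sub_left] at h3
      nlinarith
  have hint : μ.real U * Real.log (s / 2) + Real.log c
      ≤ ∫ ζ : S2, Real.log (1 - inner ℝ y (ζ : R3)) ∂μ := by
    have i1 : Integrable (U.indicator (fun _ : S2 => Real.log (s / 2))) μ :=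
      (integrable_const _).indicator hU.measurableSet
    have h := integral_mono (i1.add (integrable_const (Real.log c)))
      (integrable_of_continuous (μ := μ) (continuous_log_one_sub_inner hy)) hlow
    simp only [Pi.add_apply] at h
    rw [integral_add i1 (integrable_const _), integral_indicator hU.measurableSet] at h
    simpa using h
  have hlog : Real.log s < 4 * Real.log c - Real.log 2 := by
    have := Real.log_lt_log hs hy2
    rwa [Real.log_div (by positivity) two_ne_zero, Real.log_pow] at this
  rw [Real.log_div hs.ne' two_ne_zero] at hint hls
  unfold kleinEnergy
  nlinarith

/-- The energy vanishes at the center and is positive near the sphere, so it has a minimum in the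
open ball. -/
theorem exists_kleinCritical (μ : Measure S2) [IsProbabilityMeasure μ] [NullSingletonClass μ] :
    ∃ y : R3, ‖y‖ < 1 ∧ KleinCritical μ y := by
  set W : Set R3 := interior {y | ‖y‖ < 1 → 0 < kleinEnergy μ y} with hW
  have hsph : sphere (0 : R3) 1 ⊆ W := fun ξ hξ =>
    mem_interior_iff_mem_nhds.2 (eventually_kleinEnergy_pos (μ := μ) ⟨ξ, hξ⟩)
  have hK : IsCompact (closedBall (0 : R3) 1 \ W) :=
    (isCompact_closedBall 0 1).diff isOpen_interior
  have hKlt : ∀ y ∈ closedBall (0 : R3) 1 \ W, ‖y‖ < 1 := fun y hy =>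
    lt_of_le_of_ne (mem_closedBall_zero_iff.1 hy.1)
      fun h => hy.2 (hsph (mem_sphere_zero_iff_norm.2 h))
  have hE0 : kleinEnergy μ 0 = 0 := by simp [kleinEnergy]
  have h0 : (0 : R3) ∈ closedBall (0 : R3) 1 \ W := by
    refine ⟨by simp, fun h => ?_⟩
    have := interior_subset h
    simp [hE0] at this
  obtain ⟨y, hy, hmin⟩ := hK.exists_isMinOn ⟨0, h0⟩ fun y hy =>
    (hasFDerivAt_kleinEnergy (μ := μ) (hKlt y hy)).continuousAt.continuousWithinAt
  have hy1 := hKlt y hy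
  refine ⟨y, hy1, ?_⟩
  have hloc : IsLocalMin (kleinEnergy μ) y := by
    filter_upwards [isOpen_ball.mem_nhds (mem_ball_zero_iff.2 hy1)] with z hz
    by_cases hzW : z ∈ W
    · have h1 := interior_subset hzW (mem_ball_zero_iff.1 hz)
      have h2 : kleinEnergy μ y ≤ kleinEnergy μ 0 := hmin h0
      linarith
    · exact hmin ⟨ball_subset_closedBall hz, hzW⟩
  have h := hloc.hasFDerivAt_eq_zero (hasFDerivAt_kleinEnergy hy1)
  have h' := congrArg norm h
  rw [innerSL_apply_norm, norm_zero, norm_eq_zero, sub_eq_zero] at h'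
  exact h'.symm

theorem isConformalBarycenter_ofKlein {μ : Measure S2} [IsProbabilityMeasure μ]
    [NullSingletonClass μ] {y : R3} (hy : ‖y‖ < 1) (h : KleinCritical μ y) :
    IsConformalBarycenter μ (ofKlein y) := by
  have hw := norm_ofKlein_lt_one hy
  refine ⟨⟨mem_ball_zero_iff.2 hw, ?_⟩, fun w hw' hw0 => ?_⟩
  · rwa [baryField_eq_zero_iff hw, toKlein_ofKlein hy.le]
  · have hw1 := mem_ball_zero_iff.1 hw'
    have h2 := (baryField_eq_zero_iff hw1).1 hw0
    rw [← ofKlein_toKlein hw1, KleinCritical.eq (norm_toKlein_lt_one hw1) hy h2 h]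

theorem IsConformalBarycenter.conformalBarycenter_eq {μ : Measure S2} {w : R3}
    (h : IsConformalBarycenter μ w) : conformalBarycenter μ = w := by
  have hex : ∃ w, IsConformalBarycenter μ w := ⟨w, h⟩
  rw [conformalBarycenter, dif_pos hex]
  exact h.2 _ hex.choose_spec.1.1 hex.choose_spec.1.2

/-! ### Isometries adapted to the equatorial plane -/

/-- The isometry of three-space that acts by `A` on the equatorial plane and by `B` on the
third axis. -/
def cylinderIsometry (A : ℂ ≃ₗᵢ[ℝ] ℂ) (B : ℝ ≃ₗᵢ[ℝ] ℝ) : R3 ≃ₗᵢ[ℝ] R3 where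
  toFun x := !₂[(A ⟨x 0, x 1⟩).re, (A ⟨x 0, x 1⟩).im, B (x 2)]
  invFun x := !₂[(A.symm ⟨x 0, x 1⟩).re, (A.symm ⟨x 0, x 1⟩).im, B.symm (x 2)]
  map_add' x y := by
    have h : (⟨(x + y) 0, (x + y) 1⟩ : ℂ) = ⟨x 0, x 1⟩ + ⟨y 0, y 1⟩ := by
      apply Complex.ext <;> simp
    rw [h]
    ext i
    fin_cases i <;> simp
  map_smul' r x := by
    have h : (⟨(r • x) 0, (r • x) 1⟩ : ℂ) = r • ⟨x 0, x 1⟩ := by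
      apply Complex.ext <;> simp
    have hB : B ((r • x) 2) = r • B (x 2) := map_smul B r (x 2)
    rw [h, hB, map_smul]
    ext i
    fin_cases i <;> simp
  left_inv x := by
    ext i
    fin_cases i <;> simp
  right_inv x := by
    ext i
    fin_cases i <;> simp
  norm_map' x := by
    have h1 : ‖A ⟨x 0, x 1⟩‖ ^ 2 = x 0 ^ 2 + x 1 ^ 2 := by
      rw [A.norm_map, Complex.sq_norm, Complex.normSq_apply]; ring
    have h2 : (B (x 2)) ^ 2 = x 2 ^ 2 := by
      rw [← sq_abs, ← Real.norm_eq_abs, B.norm_map, Real.norm_eq_abs, sq_abs]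
    rw [Complex.sq_norm, Complex.normSq_apply] at h1
    rw [EuclideanSpace.norm_eq, EuclideanSpace.norm_eq]
    congr 1
    simp only [Fin.sum_univ_three, Real.norm_eq_abs, sq_abs]
    simp
    linarith

theorem cylinderIsometry_apply (A : ℂ ≃ₗᵢ[ℝ] ℂ) (B : ℝ ≃ₗᵢ[ℝ] ℝ) (x : R3) :
    cylinderIsometry A B x = !₂[(A ⟨x 0, x 1⟩).re, (A ⟨x 0, x 1⟩).im, B (x 2)] := rfl

/-- The reflection in the equatorial plane. -/
def equatorReflection : R3 ≃ₗᵢ[ℝ] R3 :=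
  cylinderIsometry (LinearIsometryEquiv.refl ℝ ℂ) (LinearIsometryEquiv.neg ℝ)

theorem equatorReflection_apply (x : R3) : equatorReflection x = !₂[x 0, x 1, -x 2] := rfl

@[simp]
theorem equatorReflection_apply_two (x : R3) : equatorReflection x 2 = -x 2 := rfl

@[simp]
theorem equatorReflection_equatorReflection (x : R3) :
    equatorReflection (equatorReflection x) = x := by
  ext i
  fin_cases i <;> simp [equatorReflection_apply]

theorem eq_planePt_of_coord_two_eq_zero {x : R3} (hx : x 2 = 0) : x = planePt ⟨x 0, x 1⟩ := by
  ext i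
  fin_cases i <;> simp [planePt, hx]

theorem norm_planePt (z : ℂ) : ‖planePt z‖ = ‖z‖ := by
  rw [← sq_eq_sq₀ (norm_nonneg _) (norm_nonneg _), Complex.sq_norm, Complex.normSq_apply,
    EuclideanSpace.norm_sq_eq]
  simp [Fin.sum_univ_three, planePt]
  ring

theorem cylinderIsometry_planePt (A : ℂ ≃ₗᵢ[ℝ] ℂ) (B : ℝ ≃ₗᵢ[ℝ] ℝ) (z : ℂ) :
    cylinderIsometry A B (planePt z) = planePt (A z) := by
  rw [cylinderIsometry_apply]
  simp [planePt]

theorem mem_equatorialDisc_iff {x : R3} : x ∈ equatorialDisc ↔ ‖x‖ < 1 ∧ x 2 = 0 := by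
  constructor
  · rintro ⟨z, hz, rfl⟩
    exact ⟨by rw [norm_planePt]; exact mem_ball_zero_iff.1 hz, rfl⟩
  · rintro ⟨h1, h2⟩
    refine ⟨⟨x 0, x 1⟩, mem_ball_zero_iff.2 ?_, (eq_planePt_of_coord_two_eq_zero h2).symm⟩
    rwa [← norm_planePt, ← eq_planePt_of_coord_two_eq_zero h2]

/-! ### Stereographic coordinates -/

theorem coe_stereo_coe (z : ℂ) : ((stereo (z : OnePoint ℂ) : S2) : R3)
    = !₂[2 * z.re / (1 + ‖z‖ ^ 2), 2 * z.im / (1 + ‖z‖ ^ 2), (1 - ‖z‖ ^ 2) / (1 + ‖z‖ ^ 2)] := rfl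

theorem coe_stereo_infty : ((stereo OnePoint.infty : S2) : R3) = -EuclideanSpace.single 2 1 := rfl

theorem continuous_stereo_coe : Continuous fun z : ℂ => stereo (z : OnePoint ℂ) := by
  refine Continuous.subtype_mk ((PiLp.continuous_toLp 2 _).comp (continuous_pi fun i => ?_)) _
  have h : ∀ z : ℂ, 1 + ‖z‖ ^ 2 ≠ 0 := fun z => by positivity
  fin_cases i
  · exact Continuous.div (by fun_prop) (by fun_prop) h
  · exact Continuous.div (by fun_prop) (by fun_prop) h
  · exact Continuous.div (by fun_prop) (by fun_prop) h

theorem stereo_coe_two_pos_iff (z : ℂ) :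
    0 < ((stereo (z : OnePoint ℂ) : S2) : R3) 2 ↔ ‖z‖ < 1 := by
  have h : ((stereo (z : OnePoint ℂ) : S2) : R3) 2 = (1 - ‖z‖ ^ 2) / (1 + ‖z‖ ^ 2) := rfl
  rw [h, div_pos_iff_of_pos_right (by positivity), sub_pos, sq_lt_one_iff₀ (norm_nonneg z)]

theorem stereo_coe_two_nonneg_iff (z : ℂ) :
    0 ≤ ((stereo (z : OnePoint ℂ) : S2) : R3) 2 ↔ ‖z‖ ≤ 1 := by
  have h : ((stereo (z : OnePoint ℂ) : S2) : R3) 2 = (1 - ‖z‖ ^ 2) / (1 + ‖z‖ ^ 2) := rfl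
  rw [h, le_div_iff₀ (by positivity), zero_mul, sub_nonneg, sq_le_one_iff₀ (norm_nonneg z)]

theorem coe_stereo_of_norm_eq_one {z : ℂ} (hz : ‖z‖ = 1) :
    ((stereo (z : OnePoint ℂ) : S2) : R3) = planePt z := by
  rw [coe_stereo_coe, hz, planePt]
  ext i
  fin_cases i <;> simp <;> ring

theorem exists_eq_stereo_coe {ζ : S2} (hζ : (ζ : R3) 2 ≠ -1) :
    ζ = stereo ((⟨(ζ : R3) 0 / (1 + (ζ : R3) 2), (ζ : R3) 1 / (1 + (ζ : R3) 2)⟩ : ℂ) :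
      OnePoint ℂ) := by
  conv_lhs => rw [← stereo_stereoInv ζ]
  rw [stereoInv, if_neg hζ]

theorem exists_norm_le_one_stereo {ζ : S2} (hζ : 0 ≤ (ζ : R3) 2) :
    ∃ z : ℂ, ‖z‖ ≤ 1 ∧ ζ = stereo (z : OnePoint ℂ) := by
  have h := exists_eq_stereo_coe (ζ := ζ) (by linarith)
  refine ⟨_, ?_, h⟩
  rw [h] at hζ
  exact (stereo_coe_two_nonneg_iff _).1 hζ

theorem cylinderIsometry_stereo_coe (A : ℂ ≃ₗᵢ[ℝ] ℂ) (z : ℂ) :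
    sphereIsometry (cylinderIsometry A (LinearIsometryEquiv.refl ℝ ℝ)) (stereo (z : OnePoint ℂ))
      = stereo ((A z : ℂ) : OnePoint ℂ) := by
  apply Subtype.ext
  rw [coe_sphereIsometry, cylinderIsometry_apply, coe_stereo_coe, coe_stereo_coe, A.norm_map]
  have h : (⟨2 * z.re / (1 + ‖z‖ ^ 2), 2 * z.im / (1 + ‖z‖ ^ 2)⟩ : ℂ)
      = (2 / (1 + ‖z‖ ^ 2) : ℝ) • z := by
    apply Complex.ext <;> simp only [Complex.smul_re, Complex.smul_im, smul_eq_mul] <;> ring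
  change (!₂[(A ⟨2 * z.re / (1 + ‖z‖ ^ 2), 2 * z.im / (1 + ‖z‖ ^ 2)⟩).re,
    (A ⟨2 * z.re / (1 + ‖z‖ ^ 2), 2 * z.im / (1 + ‖z‖ ^ 2)⟩).im, _] : R3) = _
  rw [h, map_smul, Complex.smul_re, Complex.smul_im, smul_eq_mul, smul_eq_mul]
  ext i
  fin_cases i
  · simp only [Fin.zero_eta, Matrix.cons_val_zero]; ring
  · simp only [Fin.mk_one, Matrix.cons_val_one, Matrix.cons_val_zero]; ring
  · rfl

theorem cylinderIsometry_stereo_infty (A : ℂ ≃ₗᵢ[ℝ] ℂ) :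
    sphereIsometry (cylinderIsometry A (LinearIsometryEquiv.refl ℝ ℝ)) (stereo OnePoint.infty)
      = stereo OnePoint.infty := by
  apply Subtype.ext
  rw [coe_sphereIsometry, cylinderIsometry_apply, coe_stereo_infty]
  have h : A ⟨0, 0⟩ = 0 := A.map_zero
  ext i
  fin_cases i <;> simp [h]

theorem equatorReflection_stereo_coe {z : ℂ} (hz : z ≠ 0) :
    sphereIsometry equatorReflection (stereo (z : OnePoint ℂ))
      = stereo (((conj z)⁻¹ : ℂ) : OnePoint ℂ) := by
  apply Subtype.ext
  rw [coe_sphereIsometry, equatorReflection_apply, coe_stereo_coe, coe_stereo_coe]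
  have h1 : Complex.normSq z = ‖z‖ ^ 2 := (Complex.sq_norm z).symm
  have h2 : ‖z‖ ≠ 0 := norm_ne_zero_iff.2 hz
  ext i
  fin_cases i <;> simp [h1] <;> field_simp <;> ring

theorem equatorReflection_stereo_zero :
    sphereIsometry equatorReflection (stereo ((0 : ℂ) : OnePoint ℂ)) = stereo OnePoint.infty := by
  apply Subtype.ext
  rw [coe_sphereIsometry, equatorReflection_apply, coe_stereo_coe, coe_stereo_infty]
  ext i
  fin_cases i <;> simp

@[simp]
theorem sphereIsometry_equatorReflection_twice (ζ : S2) :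
    sphereIsometry equatorReflection (sphereIsometry equatorReflection ζ) = ζ :=
  Subtype.ext (by simp)

/-! ### Finite Blaschke products on the sphere -/

/-- The finite Blaschke product as a function on the plane (with the value `0` at its poles). -/
def blaschkeFun {d : ℕ} (σ : ℂ) (a : Fin d → ℂ) (z : ℂ) : ℂ :=
  σ * ∏ j, (z + a j) / (1 + conj (a j) * z)

section Blaschke

variable {d : ℕ} {σ : ℂ} {a : Fin d → ℂ}

theorem one_add_conj_mul_ne_zero {b z : ℂ} (hb : ‖b‖ < 1) (hz : ‖z‖ ≤ 1) :
    1 + conj b * z ≠ 0 := by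
  intro h
  have h1 : ‖conj b * z‖ = 1 := by
    rw [eq_neg_of_add_eq_zero_right h, norm_neg, norm_one]
  rw [norm_mul, Complex.norm_conj] at h1
  nlinarith [norm_nonneg b, norm_nonneg z]

theorem normSq_one_add_sub (b z : ℂ) :
    ‖1 + conj b * z‖ ^ 2 - ‖z + b‖ ^ 2 = (1 - ‖b‖ ^ 2) * (1 - ‖z‖ ^ 2) := by
  simp only [Complex.sq_norm, Complex.normSq_apply]
  simp
  ring

theorem norm_factor_le_one {b z : ℂ} (hb : ‖b‖ < 1) (hz : ‖z‖ ≤ 1) :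
    ‖(z + b) / (1 + conj b * z)‖ ≤ 1 := by
  rw [norm_div, div_le_one (norm_pos_iff.2 (one_add_conj_mul_ne_zero hb hz)),
    ← sq_le_sq₀ (norm_nonneg _) (norm_nonneg _)]
  have h1 : 0 ≤ 1 - ‖b‖ ^ 2 := by nlinarith [norm_nonneg b]
  have h2 : 0 ≤ 1 - ‖z‖ ^ 2 := by nlinarith [norm_nonneg z]
  linarith [normSq_one_add_sub b z, mul_nonneg h1 h2]

theorem norm_factor_lt_one {b z : ℂ} (hb : ‖b‖ < 1) (hz : ‖z‖ < 1) :
    ‖(z + b) / (1 + conj b * z)‖ < 1 := by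
  rw [norm_div, div_lt_one (norm_pos_iff.2 (one_add_conj_mul_ne_zero hb hz.le)),
    ← sq_lt_sq₀ (norm_nonneg _) (norm_nonneg _)]
  have h1 : 0 < 1 - ‖b‖ ^ 2 := by nlinarith [norm_nonneg b]
  have h2 : 0 < 1 - ‖z‖ ^ 2 := by nlinarith [norm_nonneg z]
  linarith [normSq_one_add_sub b z, mul_pos h1 h2]

theorem norm_factor_eq_one {b z : ℂ} (hb : ‖b‖ < 1) (hz : ‖z‖ = 1) :
    ‖(z + b) / (1 + conj b * z)‖ = 1 := by
  have h0 := norm_pos_iff.2 (one_add_conj_mul_ne_zero hb hz.le)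
  rw [norm_div, div_eq_one_iff_eq h0.ne', ← sq_eq_sq₀ (norm_nonneg _) (norm_nonneg _)]
  have := normSq_one_add_sub b z
  rw [hz] at this
  linarith

theorem norm_blaschkeFun_eq_one (hσ : ‖σ‖ = 1) (ha : ∀ j, ‖a j‖ < 1) {z : ℂ} (hz : ‖z‖ = 1) :
    ‖blaschkeFun σ a z‖ = 1 := by
  rw [blaschkeFun, norm_mul, hσ, one_mul, norm_prod]
  exact Finset.prod_eq_one fun j _ => norm_factor_eq_one (ha j) hz

theorem norm_blaschkeFun_lt_one (hd : 1 ≤ d) (hσ : ‖σ‖ = 1) (ha : ∀ j, ‖a j‖ < 1) {z : ℂ}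
    (hz : ‖z‖ < 1) : ‖blaschkeFun σ a z‖ < 1 := by
  rw [blaschkeFun, norm_mul, hσ, one_mul, norm_prod]
  set i : Fin d := ⟨0, hd⟩
  rw [← Finset.mul_prod_erase _ _ (Finset.mem_univ i)]
  refine (mul_le_of_le_one_right (norm_nonneg _) ?_).trans_lt (norm_factor_lt_one (ha i) hz)
  exact Finset.prod_le_one (fun _ _ => norm_nonneg _) fun j _ => norm_factor_le_one (ha j) hz.le

theorem blaschke_coe_of_forall_ne {z : ℂ} (hz : ∀ j, 1 + conj (a j) * z ≠ 0) :
    blaschke σ a (z : OnePoint ℂ) = (blaschkeFun σ a z : OnePoint ℂ) := by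
  have h : ¬ ∃ j, 1 + conj (a j) * z = 0 := fun ⟨j, hj⟩ => hz j hj
  simp only [blaschke, OnePoint.elim_some]
  rw [if_neg h, blaschkeFun]

theorem sphereConj_stereo (f : OnePoint ℂ → OnePoint ℂ) (p : OnePoint ℂ) :
    sphereConj f (stereo p) = stereo (f p) := by
  change stereo (f (stereoInv (stereo p))) = _
  rw [stereoInv_stereo]

theorem sphereConj_blaschke_stereo (ha : ∀ j, ‖a j‖ < 1) {z : ℂ} (hz : ‖z‖ ≤ 1) :
    sphereConj (blaschke σ a) (stereo (z : OnePoint ℂ))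
      = stereo ((blaschkeFun σ a z : ℂ) : OnePoint ℂ) := by
  rw [sphereConj_stereo,
    blaschke_coe_of_forall_ne fun j => one_add_conj_mul_ne_zero (ha j) hz]

theorem inv_conj_eq_self_of_norm_eq_one (hσ : ‖σ‖ = 1) : (conj σ)⁻¹ = σ := by
  have h : σ * conj σ = 1 := by rw [Complex.mul_conj, Complex.normSq_eq_norm_sq, hσ]; simp
  exact inv_eq_of_mul_eq_one_left h

/-- A finite Blaschke product commutes with the reflection in the unit circle; on the sphere this
is the reflection in the equatorial plane. -/
theorem sphereConj_blaschke_equatorReflection (hσ : ‖σ‖ = 1) (ha : ∀ j, ‖a j‖ < 1) (ζ : S2) :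
    sphereConj (blaschke σ a) (sphereIsometry equatorReflection ζ)
      = sphereIsometry equatorReflection (sphereConj (blaschke σ a) ζ) := by
  have key : ∀ z : ℂ, ‖z‖ ≤ 1 →
      sphereConj (blaschke σ a) (sphereIsometry equatorReflection (stereo (z : OnePoint ℂ)))
        = sphereIsometry equatorReflection
          (sphereConj (blaschke σ a) (stereo (z : OnePoint ℂ))) := by
    intro z hz
    have hσ0 : σ ≠ 0 := norm_ne_zero_iff.1 (by rw [hσ]; exact one_ne_zero)
    have hne : ∀ j, 1 + conj (a j) * z ≠ 0 := fun j => one_add_conj_mul_ne_zero (ha j) hz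
    rw [sphereConj_blaschke_stereo ha hz]
    rcases eq_or_ne z 0 with rfl | hz0
    · rw [equatorReflection_stereo_zero, sphereConj_stereo]
      simp only [blaschke, OnePoint.elim_infty]
      by_cases h : ∃ j, a j = 0
      · obtain ⟨j, hj⟩ := h
        have h0 : blaschkeFun σ a 0 = 0 := by
          rw [blaschkeFun, Finset.prod_eq_zero (Finset.mem_univ j) (by simp [hj]), mul_zero]
        rw [if_pos ⟨j, hj⟩, h0, equatorReflection_stereo_zero]
      · have h0 : blaschkeFun σ a 0 ≠ 0 := by
          refine mul_ne_zero hσ0 (Finset.prod_ne_zero_iff.2 fun j _ => ?_)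
          simpa using fun hj => h ⟨j, hj⟩
        rw [if_neg h, equatorReflection_stereo_coe h0]
        congr 2
        simp [blaschkeFun, inv_conj_eq_self_of_norm_eq_one hσ, Finset.prod_inv_distrib, mul_comm]
    · have hzc : conj z ≠ 0 := by simpa using hz0
      rw [equatorReflection_stereo_coe hz0, sphereConj_stereo]
      have hpole : ∀ j, 1 + conj (a j) * (conj z)⁻¹ = 0 ↔ z + a j = 0 := by
        intro j
        rw [← map_eq_zero (starRingEnd ℂ) (a := z + a j), map_add, ← mul_eq_zero_iff_left hzc,
          mul_add, mul_left_comm, mul_inv_cancel₀ hzc, mul_one, mul_one]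
      by_cases h : ∃ j, z + a j = 0
      · obtain ⟨j, hj⟩ := h
        have h0 : blaschkeFun σ a z = 0 := by
          rw [blaschkeFun, Finset.prod_eq_zero (Finset.mem_univ j) (by simp [hj]), mul_zero]
        rw [h0, equatorReflection_stereo_zero]
        simp only [blaschke, OnePoint.elim_some]
        rw [if_pos ⟨j, (hpole j).2 hj⟩]
      · have h1 : ∀ j, z + a j ≠ 0 := fun j hj => h ⟨j, hj⟩
        have h0 : blaschkeFun σ a z ≠ 0 :=
          mul_ne_zero hσ0 (Finset.prod_ne_zero_iff.2 fun j _ => div_ne_zero (h1 j) (hne j))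
        rw [equatorReflection_stereo_coe h0,
          blaschke_coe_of_forall_ne fun j hj => h1 j ((hpole j).1 hj)]
        congr 2
        rw [blaschkeFun, blaschkeFun, map_mul, mul_inv, inv_conj_eq_self_of_norm_eq_one hσ,
          map_prod, ← Finset.prod_inv_distrib]
        congr 1
        refine Finset.prod_congr rfl fun j _ => ?_
        have h2 : conj z + conj (a j) ≠ 0 := by
          rw [← map_add]; exact (map_ne_zero _).2 (h1 j)
        rw [map_div₀, map_add, map_add, map_mul, inv_div, Complex.conj_conj, map_one,
          ← mul_div_mul_left _ _ hzc]
        congr 1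
        · field_simp
        · field_simp
  rcases le_total 0 ((ζ : R3) 2) with h | h
  · obtain ⟨z, hz, rfl⟩ := exists_norm_le_one_stereo h
    exact key z hz
  · obtain ⟨z, hz, h'⟩ := exists_norm_le_one_stereo (ζ := sphereIsometry equatorReflection ζ)
      (by simpa using h)
    have := key z hz
    rw [← h', sphereIsometry_equatorReflection_twice] at this
    rw [this, sphereIsometry_equatorReflection_twice]

theorem sphereConj_blaschke_two_pos (hd : 1 ≤ d) (hσ : ‖σ‖ = 1) (ha : ∀ j, ‖a j‖ < 1) {ζ : S2}
    (hζ : 0 < (ζ : R3) 2) : 0 < (sphereConj (blaschke σ a) ζ : R3) 2 := by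
  obtain ⟨z, hz, rfl⟩ := exists_norm_le_one_stereo hζ.le
  rw [sphereConj_blaschke_stereo ha hz, stereo_coe_two_pos_iff]
  exact norm_blaschkeFun_lt_one hd hσ ha ((stereo_coe_two_pos_iff z).1 hζ)

theorem sphereConj_blaschke_two_neg (hd : 1 ≤ d) (hσ : ‖σ‖ = 1) (ha : ∀ j, ‖a j‖ < 1) {ζ : S2}
    (hζ : (ζ : R3) 2 < 0) : (sphereConj (blaschke σ a) ζ : R3) 2 < 0 := by
  have h := sphereConj_blaschke_two_pos hd hσ ha (ζ := sphereIsometry equatorReflection ζ)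
    (by simpa using hζ)
  rw [sphereConj_blaschke_equatorReflection hσ ha] at h
  simpa using h

theorem sphereConj_blaschke_planePt (hσ : ‖σ‖ = 1) (ha : ∀ j, ‖a j‖ < 1) {z : ℂ} (hz : ‖z‖ = 1)
    {ζ : S2} (hζ : (ζ : R3) = planePt z) :
    (sphereConj (blaschke σ a) ζ : R3) = planePt (blaschkeFun σ a z) := by
  have h : ζ = stereo (z : OnePoint ℂ) :=
    Subtype.ext (hζ.trans (coe_stereo_of_norm_eq_one hz).symm)
  rw [h, sphereConj_blaschke_stereo ha hz.le,
    coe_stereo_of_norm_eq_one (norm_blaschkeFun_eq_one hσ ha hz)]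

theorem continuousAt_blaschkeFun {z : ℂ} (hz : ∀ j, 1 + conj (a j) * z ≠ 0) :
    ContinuousAt (blaschkeFun σ a) z := by
  unfold blaschkeFun
  refine continuousAt_const.mul (tendsto_finsetProd _ fun j _ => ?_)
  exact ContinuousAt.div (by fun_prop) (by fun_prop) (hz j)

theorem continuous_sphereConj_blaschke (hσ : ‖σ‖ = 1) (ha : ∀ j, ‖a j‖ < 1) :
    Continuous (sphereConj (blaschke σ a)) := by
  -- The poles lie in the lower hemisphere, which is treated by reflection.
  have key : ∀ ζ : S2, 0 ≤ (ζ : R3) 2 → ContinuousAt (sphereConj (blaschke σ a)) ζ := by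
    intro ζ hζ
    set W : S2 → ℂ := fun ζ =>
      ⟨(ζ : R3) 0 / (1 + (ζ : R3) 2), (ζ : R3) 1 / (1 + (ζ : R3) 2)⟩ with hW
    have hcoord : ∀ i : Fin 3, Continuous fun ζ : S2 => (ζ : R3) i := fun i => by fun_prop
    have h2 : (ζ : R3) 2 ≠ -1 := by linarith
    have hWc : ContinuousAt W ζ := by
      have h3 : 1 + (ζ : R3) 2 ≠ 0 := by linarith
      have h4 : ∀ i : Fin 3, ContinuousAt (fun ζ : S2 => (ζ : R3) i / (1 + (ζ : R3) 2)) ζ :=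
        fun i => (hcoord i).continuousAt.div (continuous_const.add (hcoord 2)).continuousAt h3
      exact Complex.equivRealProdCLM.symm.continuous.continuousAt.comp ((h4 0).prodMk (h4 1))
    have hWζ : ‖W ζ‖ ≤ 1 := by
      have h := exists_eq_stereo_coe h2
      rw [h] at hζ
      exact (stereo_coe_two_nonneg_iff _).1 hζ
    have hne : ∀ᶠ ζ' in 𝓝 ζ, ∀ j, 1 + conj (a j) * W ζ' ≠ 0 := by
      rw [eventually_all]
      intro j
      have : ContinuousAt (fun ζ' => 1 + conj (a j) * W ζ') ζ :=
        continuousAt_const.add (continuousAt_const.mul hWc)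
      exact this.eventually_ne (one_add_conj_mul_ne_zero (ha j) hWζ)
    have heq : sphereConj (blaschke σ a)
        =ᶠ[𝓝 ζ] fun ζ' => stereo ((blaschkeFun σ a (W ζ') : ℂ) : OnePoint ℂ) := by
      filter_upwards [hne, (hcoord 2).continuousAt.eventually_ne h2] with ζ' h5 h6
      conv_lhs => rw [exists_eq_stereo_coe h6]
      rw [sphereConj_stereo, blaschke_coe_of_forall_ne h5]
    refine ContinuousAt.congr ?_ heq.symm
    refine continuous_stereo_coe.continuousAt.comp
      (ContinuousAt.comp (g := blaschkeFun σ a) ?_ hWc)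
    exact continuousAt_blaschkeFun fun j => one_add_conj_mul_ne_zero (ha j) hWζ
  rw [continuous_iff_continuousAt]
  intro ζ
  rcases le_total 0 ((ζ : R3) 2) with h | h
  · exact key ζ h
  · have hR := continuous_sphereIsometry equatorReflection
    have h1 := key (sphereIsometry equatorReflection ζ) (by simpa using h)
    have h2 : sphereConj (blaschke σ a) = sphereIsometry equatorReflection ∘
        sphereConj (blaschke σ a) ∘ sphereIsometry equatorReflection := by
      ext1 ζ'
      simp only [Function.comp_apply]
      rw [sphereConj_blaschke_equatorReflection hσ ha, sphereIsometry_equatorReflection_twice]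
    rw [h2]
    exact hR.continuousAt.comp (ContinuousAt.comp h1 hR.continuousAt)

theorem finite_blaschkeFun_eq (hd : 1 ≤ d) (hσ : ‖σ‖ = 1) (ha : ∀ j, ‖a j‖ < 1) (c : ℂ) :
    {z : ℂ | ‖z‖ ≤ 1 ∧ blaschkeFun σ a z = c}.Finite := by
  have hσ0 : σ ≠ 0 := norm_ne_zero_iff.1 (by rw [hσ]; exact one_ne_zero)
  obtain ⟨P, hP⟩ : ∃ P, P = Polynomial.C σ * ∏ j, (Polynomial.X + Polynomial.C (a j)) := ⟨_, rfl⟩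
  obtain ⟨Q, hQ⟩ : ∃ Q, Q = ∏ j, (1 + Polynomial.C (conj (a j)) * Polynomial.X) := ⟨_, rfl⟩
  have hPe : ∀ z, P.eval z = σ * ∏ j, (z + a j) := fun z => by
    simp [hP, Polynomial.eval_prod]
  have hQe : ∀ z, Q.eval z = ∏ j, (1 + conj (a j) * z) := fun z => by
    simp [hQ, Polynomial.eval_prod]
  have hQne : ∀ z, ‖z‖ ≤ 1 → Q.eval z ≠ 0 := fun z hz => by
    rw [hQe]
    exact Finset.prod_ne_zero_iff.2 fun j _ => one_add_conj_mul_ne_zero (ha j) hz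
  have hne : P - Polynomial.C c * Q ≠ 0 := by
    intro h
    rcases eq_or_ne c 0 with rfl | hc
    · rw [Polynomial.C_0, zero_mul, sub_zero] at h
      refine mul_ne_zero (Polynomial.C_ne_zero.2 hσ0) ?_ (hP.symm.trans h)
      exact Finset.prod_ne_zero_iff.2 fun j _ => Polynomial.X_add_C_ne_zero _
    · -- at a zero of the Blaschke product the numerator vanishes and the denominator does not
      have h1 := congrArg (Polynomial.eval (-a ⟨0, hd⟩)) h
      rw [Polynomial.eval_sub, Polynomial.eval_mul, Polynomial.eval_C, hPe, Polynomial.eval_zero,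
        Finset.prod_eq_zero (Finset.mem_univ ⟨0, hd⟩) (by simp), mul_zero, zero_sub,
        neg_eq_zero] at h1
      refine mul_ne_zero hc (hQne _ ?_) h1
      rw [norm_neg]
      exact (ha _).le
  refine (P - Polynomial.C c * Q).roots.toFinset.finite_toSet.subset ?_
  rintro z ⟨hz, hzc⟩
  simp only [Finset.mem_coe, Multiset.mem_toFinset, Polynomial.mem_roots hne, Polynomial.IsRoot,
    Polynomial.eval_sub, Polynomial.eval_mul, Polynomial.eval_C]
  rw [← hzc, blaschkeFun, Finset.prod_div_distrib, ← hQe, mul_div_assoc', ← hPe,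
    div_mul_cancel₀ _ (hQne z hz), sub_self]

theorem finite_preimage_sphereConj_blaschke (hd : 1 ≤ d) (hσ : ‖σ‖ = 1) (ha : ∀ j, ‖a j‖ < 1)
    (ξ : S2) : (sphereConj (blaschke σ a) ⁻¹' {ξ}).Finite := by
  have key : ∀ ξ : S2, {ζ : S2 | 0 ≤ (ζ : R3) 2 ∧ sphereConj (blaschke σ a) ζ = ξ}.Finite := by
    intro ξ
    by_cases hξ : ∃ c : ℂ, stereo (c : OnePoint ℂ) = ξ
    · obtain ⟨c, rfl⟩ := hξ
      refine ((finite_blaschkeFun_eq hd hσ ha c).image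
        fun z : ℂ => stereo (z : OnePoint ℂ)).subset ?_
      rintro ζ ⟨h1, h2⟩
      obtain ⟨z, hz, rfl⟩ := exists_norm_le_one_stereo h1
      rw [sphereConj_blaschke_stereo ha hz] at h2
      exact ⟨z, ⟨hz, OnePoint.coe_injective (stereoEquiv.injective h2)⟩, rfl⟩
    · convert! Set.finite_empty
      refine eq_empty_of_forall_notMem ?_
      rintro ζ ⟨h1, h2⟩
      obtain ⟨z, hz, rfl⟩ := exists_norm_le_one_stereo h1
      rw [sphereConj_blaschke_stereo ha hz] at h2
      exact hξ ⟨_, h2⟩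
  refine ((key ξ).union ((key (sphereIsometry equatorReflection ξ)).image
    (sphereIsometry equatorReflection))).subset ?_
  intro ζ hζ
  rcases le_total 0 ((ζ : R3) 2) with h | h
  · exact Or.inl ⟨h, hζ⟩
  · refine Or.inr ⟨sphereIsometry equatorReflection ζ, ⟨by simpa using h, ?_⟩, by simp⟩
    rw [sphereConj_blaschke_equatorReflection hσ ha, show sphereConj (blaschke σ a) ζ = ξ from hζ]

end Blaschke

/-! ### The extension of a continuous map with finite fibres -/

section Extension

variable {φ : C(S2, S2)}

theorem harmonicMeasure_absolutelyContinuous (x : ball (0 : R3) 1) :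
    harmonicMeasure x ≪ uniformS2 := by
  rw [harmonicMeasure_eq_withDensity]
  exact withDensity_absolutelyContinuous _ _

theorem nullSingletonClass_map (hφ : ∀ ξ : S2, (φ ⁻¹' {ξ}).Finite) (x : ball (0 : R3) 1) :
    NullSingletonClass ((harmonicMeasure x).map φ) := by
  constructor
  intro ξ
  rw [Measure.map_apply φ.continuous.measurable (measurableSet_singleton ξ)]
  exact harmonicMeasure_absolutelyContinuous x ((hφ ξ).measure_zero uniformS2)

theorem isProbabilityMeasure_map (x : ball (0 : R3) 1) :
    IsProbabilityMeasure ((harmonicMeasure x).map φ) :=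
  Measure.isProbabilityMeasure_map φ.continuous.aemeasurable

theorem isExtendable_of_finite_fibres (hφ : ∀ ξ : S2, (φ ⁻¹' {ξ}).Finite) : IsExtendable φ := by
  refine ⟨φ.continuous.measurable, fun ξ => ?_⟩
  rw [Measure.map_apply φ.continuous.measurable (measurableSet_singleton ξ)]
  exact (hφ ξ).measure_zero uniformS2

theorem douadyEarle_coe_sphere (f : S2 → S2) (ξ : S2) : douadyEarle f (ξ : R3) = f ξ := by
  rw [douadyEarle, dif_pos ξ.2]

theorem douadyEarle_coe_ball (f : S2 → S2) (x : ball (0 : R3) 1) :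
    douadyEarle f (x : R3) = conformalBarycenter ((harmonicMeasure x).map f) := by
  have h : (x : R3) ∉ sphere (0 : R3) 1 := fun h =>
    (mem_ball_zero_iff.1 x.2).ne (mem_sphere_zero_iff_norm.1 h)
  rw [douadyEarle, dif_neg h, dif_pos x.2]

theorem exists_kleinCritical_map (hφ : ∀ ξ : S2, (φ ⁻¹' {ξ}).Finite) (x : ball (0 : R3) 1) :
    ∃ y : R3, ‖y‖ < 1 ∧ KleinCritical ((harmonicMeasure x).map φ) y ∧
      douadyEarle φ x = ofKlein y ∧
      IsConformalBarycenter ((harmonicMeasure x).map φ) (ofKlein y) := by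
  have := nullSingletonClass_map hφ x
  have := isProbabilityMeasure_map (φ := φ) x
  obtain ⟨y, hy, hc⟩ := exists_kleinCritical ((harmonicMeasure x).map φ)
  have hb := isConformalBarycenter_ofKlein hy hc
  exact ⟨y, hy, hc, by rw [douadyEarle_coe_ball, hb.conformalBarycenter_eq], hb⟩

theorem isConformalBarycenter_douadyEarle (hφ : ∀ ξ : S2, (φ ⁻¹' {ξ}).Finite)
    (x : ball (0 : R3) 1) :
    IsConformalBarycenter ((harmonicMeasure x).map φ) (douadyEarle φ x) := by
  obtain ⟨y, -, -, h, hb⟩ := exists_kleinCritical_map hφ x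
  rwa [h]

variable (φ) in
/-- The extension of `φ`, with its values in the Klein model. -/
def kleinExtension (x : R3) : R3 := toKlein (douadyEarle φ x)

theorem norm_douadyEarle_lt_one (hφ : ∀ ξ : S2, (φ ⁻¹' {ξ}).Finite) {x : R3} (hx : ‖x‖ < 1) :
    ‖douadyEarle φ x‖ < 1 :=
  mem_ball_zero_iff.1 (isConformalBarycenter_douadyEarle hφ ⟨x, mem_ball_zero_iff.2 hx⟩).1.1

theorem norm_kleinExtension_lt_one (hφ : ∀ ξ : S2, (φ ⁻¹' {ξ}).Finite) {x : R3} (hx : ‖x‖ < 1) :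
    ‖kleinExtension φ x‖ < 1 :=
  norm_toKlein_lt_one (norm_douadyEarle_lt_one hφ hx)

theorem kleinCritical_kleinExtension (hφ : ∀ ξ : S2, (φ ⁻¹' {ξ}).Finite) (x : ball (0 : R3) 1) :
    KleinCritical ((harmonicMeasure x).map φ) (kleinExtension φ x) := by
  obtain ⟨y, hy, hc, h, -⟩ := exists_kleinCritical_map hφ x
  rwa [kleinExtension, h, toKlein_ofKlein hy.le]

theorem ofKlein_kleinExtension (hφ : ∀ ξ : S2, (φ ⁻¹' {ξ}).Finite) {x : R3} (hx : ‖x‖ < 1) :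
    ofKlein (kleinExtension φ x) = douadyEarle φ x :=
  ofKlein_toKlein (norm_douadyEarle_lt_one hφ hx)

theorem baryField_map_sphereIsometry (U : R3 ≃ₗᵢ[ℝ] R3) (μ : Measure S2) (w : R3) :
    baryField (μ.map (sphereIsometry U)) (U w) = U (baryField μ w) := by
  rw [baryField, baryField, map_smul, U.norm_map]
  congr 1
  have hm : AEStronglyMeasurable (fun ζ : S2 => moebius (-U w) (ζ : R3))
      (μ.map (sphereIsometry U)) := by
    refine Measurable.aestronglyMeasurable ?_
    unfold moebius
    fun_prop
  rw [integral_map (continuous_sphereIsometry U).aemeasurable hm]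
  refine Eq.trans ?_ (U.toContinuousLinearEquiv.integral_comp_comm
    (fun ζ : S2 => moebius (-w) (ζ : R3)))
  refine integral_congr_ae (Eventually.of_forall fun ζ => ?_)
  change moebius (-U w) (U ζ) = U (moebius (-w) ζ)
  rw [← map_neg, moebius_map]

/-- Symmetries of `φ` are symmetries of its extension. -/
theorem douadyEarle_isometry (hφ : ∀ ξ : S2, (φ ⁻¹' {ξ}).Finite) (U U' : R3 ≃ₗᵢ[ℝ] R3)
    (h : ∀ ζ, φ (sphereIsometry U ζ) = sphereIsometry U' (φ ζ)) {x : R3} (hx : ‖x‖ < 1) :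
    douadyEarle φ (U x) = U' (douadyEarle φ x) := by
  set x' : ball (0 : R3) 1 := ⟨x, mem_ball_zero_iff.2 hx⟩
  have h1 := (isConformalBarycenter_douadyEarle hφ x').1
  have h2 := (isConformalBarycenter_douadyEarle hφ (ballIsometry U x')).2
  refine (h2 (U' (douadyEarle φ x)) ?_ ?_).symm
  · rw [mem_ball_zero_iff, U'.norm_map]
    exact mem_ball_zero_iff.1 h1.1
  · have h3 : (harmonicMeasure (ballIsometry U x')).map φ
        = ((harmonicMeasure x').map φ).map (sphereIsometry U') := by
      rw [harmonicMeasure_ballIsometry,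
        Measure.map_map φ.continuous.measurable (continuous_sphereIsometry U).measurable,
        Measure.map_map (continuous_sphereIsometry U').measurable φ.continuous.measurable]
      congr 1
      ext1 ζ
      exact h ζ
    rw [h3, baryField_map_sphereIsometry, h1.2, map_zero]

theorem integral_map_harmonicMeasure (x : ball (0 : R3) 1) {E : Type*} [NormedAddCommGroup E]
    [NormedSpace ℝ E] {k : S2 → E} (hk : Continuous k) :
    ∫ ζ, k ζ ∂((harmonicMeasure x).map φ)
      = ∫ ζ, harmonicDensity x ζ • k (φ ζ) ∂uniformS2 := by
  rw [integral_map φ.continuous.aemeasurable hk.aestronglyMeasurable, integral_harmonicMeasure]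

/-! ### Analyticity of the extension -/

variable (φ) in
/-- The linear map that takes `y` to the continuous function `ζ ↦ ⟪y, φ ζ⟫`. -/
def innerFun : R3 →L[ℝ] C(S2, ℝ) :=
  LinearMap.mkContinuous
    { toFun := fun y => ⟨fun ζ => inner ℝ y (φ ζ : R3), by fun_prop⟩
      map_add' := fun y z => by ext ζ; simp [inner_add_left]
      map_smul' := fun r y => by ext ζ; simp [real_inner_smul_left] } 1 fun y => by
    rw [one_mul, ContinuousMap.norm_le _ (norm_nonneg y)]
    exact fun ζ => abs_inner_S2_le y (φ ζ)

@[simp]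
theorem innerFun_apply (y : R3) (ζ : S2) : innerFun φ y ζ = inner ℝ y (φ ζ : R3) := rfl

variable (φ) in
/-- Integration of continuous functions against `φ`. -/
def integralAgainst : C(S2, ℝ) →L[ℝ] R3 :=
  LinearMap.mkContinuous
    { toFun := fun k => ∫ ζ, k ζ • (φ ζ : R3) ∂uniformS2
      map_add' := fun k l => by
        rw [← integral_add (integrable_of_continuous (by fun_prop))
          (integrable_of_continuous (by fun_prop))]
        simp [add_smul]
      map_smul' := fun r k => by
        rw [RingHom.id_apply, ← integral_smul]
        simp [mul_smul] } 1 fun k => by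
    rw [one_mul]
    have h := norm_integral_le_of_norm_le_const (μ := uniformS2)
      (f := fun ζ => k ζ • (φ ζ : R3)) (C := ‖k‖) (Eventually.of_forall fun ζ => by
        rw [norm_smul, norm_S2, mul_one]; exact k.norm_coe_le_norm ζ)
    simpa using h

theorem integralAgainst_apply (k : C(S2, ℝ)) :
    integralAgainst φ k = ∫ ζ, k ζ • (φ ζ : R3) ∂uniformS2 := rfl

theorem inner_integralAgainst (v : R3) (k : C(S2, ℝ)) :
    inner ℝ v (integralAgainst φ k) = ∫ ζ, k ζ * inner ℝ v (φ ζ : R3) ∂uniformS2 := by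
  rw [integralAgainst_apply, ← integral_inner (integrable_of_continuous (by fun_prop))]
  simp only [inner_smul_right]

theorem ringInverse_apply {u : C(S2, ℝ)} (hu : ∀ ζ, u ζ ≠ 0) (ζ : S2) :
    Ring.inverse u ζ = (u ζ)⁻¹ := by
  have h := Ring.inverse_mul_cancel u ((ContinuousMap.isUnit_iff_forall_ne_zero u).2 hu)
  have h1 : Ring.inverse u ζ * u ζ = 1 := by
    rw [← ContinuousMap.mul_apply, h, ContinuousMap.one_apply]
  exact eq_inv_of_mul_eq_one_left h1

theorem contDiffAt_ringInverse_of_ne_zero {u : C(S2, ℝ)} (hu : ∀ ζ, u ζ ≠ 0) :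
    ContDiffAt ℝ ω Ring.inverse u := by
  obtain ⟨u', rfl⟩ := (ContinuousMap.isUnit_iff_forall_ne_zero u).2 hu
  exact contDiffAt_ringInverse ℝ u'

theorem HasDerivAt.ringInverse {u : ℝ → C(S2, ℝ)} {u' : C(S2, ℝ)} {t : ℝ}
    (h : HasDerivAt u u' t) (hu : ∀ ζ, u t ζ ≠ 0) :
    HasDerivAt (fun t => Ring.inverse (u t)) (-(Ring.inverse (u t) * u' * Ring.inverse (u t)))
      t := by
  obtain ⟨w, hw⟩ := (ContinuousMap.isUnit_iff_forall_ne_zero (u t)).2 hu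
  have h1 := hasFDerivAt_ringInverse (𝕜 := ℝ) w
  rw [hw] at h1
  have h2 := h1.comp_hasDerivAt t h
  refine h2.congr_deriv ?_
  rw [← hw, Ring.inverse_unit]
  simp

/-- The denominator of the harmonic density, as a continuous function on the sphere. -/
def densityDenom (x : R3) : C(S2, ℝ) :=
  (1 + ‖x‖ ^ 2) • (1 : C(S2, ℝ)) - (2 : ℝ) • innerFun (ContinuousMap.id S2) x

theorem densityDenom_apply (x : R3) (ζ : S2) :
    densityDenom x ζ = 1 + ‖x‖ ^ 2 - 2 * inner ℝ x (ζ : R3) := by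
  simp [densityDenom]

theorem densityDenom_ne_zero {x : R3} (hx : ‖x‖ < 1) (ζ : S2) : densityDenom x ζ ≠ 0 := by
  rw [densityDenom_apply]; exact (harmonicDensity_denom_pos hx ζ).ne'

/-- The harmonic density as a continuous function on the sphere. -/
def densityFun (x : R3) : C(S2, ℝ) :=
  ((1 - ‖x‖ ^ 2) • Ring.inverse (densityDenom x)) ^ 2

theorem densityFun_apply {x : R3} (hx : ‖x‖ < 1) (ζ : S2) :
    densityFun x ζ = harmonicDensity x ζ := by
  rw [densityFun, ContinuousMap.pow_apply, ContinuousMap.smul_apply,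
    ringInverse_apply (densityDenom_ne_zero hx), densityDenom_apply, harmonicDensity, smul_eq_mul,
    div_eq_mul_inv]

theorem one_sub_innerFun_ne_zero {y : R3} (hy : ‖y‖ < 1) (ζ : S2) :
    (1 - innerFun φ y) ζ ≠ 0 :=
  (one_sub_inner_pos hy (φ ζ)).ne'

theorem ringInverse_one_sub_innerFun {y : R3} (hy : ‖y‖ < 1) (ζ : S2) :
    Ring.inverse (1 - innerFun φ y) ζ = (1 - inner ℝ y (φ ζ : R3))⁻¹ := by
  rw [ringInverse_apply (one_sub_innerFun_ne_zero hy)]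
  rfl

variable (φ) in
/-- The map whose zero set over the ball is the graph of the extension, in the Klein model. -/
def kleinEquation (p : R3 × R3) : R3 :=
  integralAgainst φ (densityFun p.1 * Ring.inverse (1 - innerFun φ p.2))
    - (1 - ‖p.2‖ ^ 2)⁻¹ • p.2

theorem kleinEquation_eq_zero_iff (x : ball (0 : R3) 1) {y : R3} (hy : ‖y‖ < 1) :
    kleinEquation φ (x, y) = 0 ↔ KleinCritical ((harmonicMeasure x).map φ) y := by
  rw [kleinEquation, sub_eq_zero, KleinCritical, integral_map_harmonicMeasure x
    (k := fun ζ => (1 - inner ℝ y (ζ : R3))⁻¹ • (ζ : R3))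
    ((continuous_one_sub_inner_inv hy).smul continuous_subtype_val), integralAgainst_apply]
  simp only [ContinuousMap.mul_apply, densityFun_apply (mem_ball_zero_iff.1 x.2),
    ringInverse_one_sub_innerFun hy, mul_smul]

theorem contDiff_densityDenom : ContDiff ℝ ω densityDenom := by
  unfold densityDenom
  have h : ContDiff ℝ ω fun x : R3 => ‖x‖ ^ 2 := contDiff_norm_sq ℝ
  exact ((contDiff_const.add h).smul contDiff_const).sub
    ((innerFun (ContinuousMap.id S2)).contDiff.const_smul (2 : ℝ))

theorem contDiffAt_densityFun {x : R3} (hx : ‖x‖ < 1) : ContDiffAt ℝ ω densityFun x := by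
  unfold densityFun
  have h : ContDiff ℝ ω fun x : R3 => ‖x‖ ^ 2 := contDiff_norm_sq ℝ
  refine ContDiffAt.pow ((contDiff_const.sub h).contDiffAt.smul ?_) 2
  exact ContDiffAt.comp x (contDiffAt_ringInverse_of_ne_zero (densityDenom_ne_zero hx))
    contDiff_densityDenom.contDiffAt

theorem contDiffAt_kleinEquation {x y : R3} (hx : ‖x‖ < 1) (hy : ‖y‖ < 1) :
    ContDiffAt ℝ ω (kleinEquation φ) (x, y) := by
  have h : ContDiff ℝ ω fun x : R3 => ‖x‖ ^ 2 := contDiff_norm_sq ℝ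
  have h1 : ContDiffAt ℝ ω (fun p : R3 × R3 => densityFun p.1) (x, y) :=
    ContDiffAt.fst' (contDiffAt_densityFun hx)
  have h2 : ContDiffAt ℝ ω (fun p : R3 × R3 => 1 - innerFun φ p.2) (x, y) :=
    contDiffAt_const.sub ((innerFun φ).contDiff.contDiffAt.comp (x, y) contDiffAt_snd)
  have h3 : ContDiffAt ℝ ω (fun p : R3 × R3 => Ring.inverse (1 - innerFun φ p.2)) (x, y) :=
    ContDiffAt.comp (x, y) (g := Ring.inverse)
      (contDiffAt_ringInverse_of_ne_zero (one_sub_innerFun_ne_zero (φ := φ) hy)) h2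
  have h4 : ContDiffAt ℝ ω (fun p : R3 × R3 => densityFun p.1 *
      Ring.inverse (1 - innerFun φ p.2)) (x, y) := h1.mul h3
  have h5 : ContDiffAt ℝ ω (fun p : R3 × R3 => integralAgainst φ (densityFun p.1 *
      Ring.inverse (1 - innerFun φ p.2))) (x, y) :=
    (integralAgainst φ).contDiff.contDiffAt.comp (x, y) h4
  have h6 : ContDiffAt ℝ ω (fun p : R3 × R3 => (1 - ‖p.2‖ ^ 2)⁻¹) (x, y) :=
    ContDiffAt.inv (contDiffAt_const.sub (h.contDiffAt.comp (x, y) contDiffAt_snd))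
      (one_sub_norm_sq_pos hy).ne'
  exact h5.sub (h6.smul contDiffAt_snd)

/-- The derivative of the Klein equation in its second argument is negative definite on the graph
of the extension. -/
theorem inner_fderiv_kleinEquation_inr_neg (hφ : ∀ ξ : S2, (φ ⁻¹' {ξ}).Finite)
    (x : ball (0 : R3) 1) {y : R3} (hy : ‖y‖ < 1)
    (hc : KleinCritical ((harmonicMeasure x).map φ) y) {v : R3} (hv : v ≠ 0) :
    inner ℝ v (fderiv ℝ (kleinEquation φ) ((x : R3), y) (0, v)) < 0 := by
  have hx := mem_ball_zero_iff.1 x.2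
  have := nullSingletonClass_map hφ x
  have := isProbabilityMeasure_map (φ := φ) x
  have hs := one_sub_norm_sq_pos hy
  have hline : HasDerivAt (fun t : ℝ => y + t • v) v 0 := by
    simpa using ((hasDerivAt_id (0 : ℝ)).smul_const v).const_add y
  have h1 : HasDerivAt (fun t : ℝ => kleinEquation φ ((x : R3), y + t • v))
      (fderiv ℝ (kleinEquation φ) ((x : R3), y) (0, v)) 0 := by
    have hd : HasFDerivAt (kleinEquation φ) (fderiv ℝ (kleinEquation φ) ((x : R3), y))
        ((fun t : ℝ => ((x : R3), y + t • v)) 0) := by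
      simpa using ((contDiffAt_kleinEquation (φ := φ) hx hy).differentiableAt
        (by simp)).hasFDerivAt
    exact hd.comp_hasDerivAt 0 ((hasDerivAt_const (0 : ℝ) (x : R3)).prodMk hline)
  set I := Ring.inverse (1 - innerFun φ y) with hI
  have h2 : HasDerivAt (fun t : ℝ => integralAgainst φ (densityFun (x : R3) *
      Ring.inverse (1 - innerFun φ (y + t • v))))
      (integralAgainst φ (densityFun (x : R3) * (I * innerFun φ v * I))) 0 := by
    have hu : HasDerivAt (fun t : ℝ => 1 - innerFun φ (y + t • v)) (-innerFun φ v) 0 :=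
      ((innerFun φ).hasFDerivAt.comp_hasDerivAt 0 hline).const_sub 1
    have hi := hu.ringInverse (by simpa using one_sub_innerFun_ne_zero (φ := φ) hy)
    simp only [zero_smul, add_zero, mul_neg, neg_mul, neg_neg] at hi
    exact (integralAgainst φ).hasFDerivAt.comp_hasDerivAt 0 (hi.const_mul (densityFun (x : R3)))
  have h3 : HasDerivAt (fun t : ℝ => (1 - ‖y + t • v‖ ^ 2)⁻¹ • (y + t • v))
      ((1 - ‖y‖ ^ 2)⁻¹ • v + (2 * inner ℝ y v / (1 - ‖y‖ ^ 2) ^ 2) • y) 0 := by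
    have hn : HasDerivAt (fun t : ℝ => 1 - ‖y + t • v‖ ^ 2) (-(2 * inner ℝ y v)) 0 := by
      have := hline.norm_sq.const_sub 1
      simpa using this
    have hi := (hn.inv (by simpa using hs.ne')).smul hline
    refine hi.congr_deriv ?_
    simp
  have h4 : fderiv ℝ (kleinEquation φ) ((x : R3), y) (0, v) =
      integralAgainst φ (densityFun (x : R3) * (I * innerFun φ v * I)) -
      ((1 - ‖y‖ ^ 2)⁻¹ • v + (2 * inner ℝ y v / (1 - ‖y‖ ^ 2) ^ 2) • y) :=
    h1.unique (h2.sub h3)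
  have h5 := hc.integral_sq_lt hy hv
  rw [integral_map_harmonicMeasure x
    (k := fun ζ => (inner ℝ v (ζ : R3) / (1 - inner ℝ y (ζ : R3))) ^ 2)
    ((continuous_inner_div hy v).pow 2)] at h5
  have h6 : inner ℝ v (integralAgainst φ (densityFun (x : R3) * (I * innerFun φ v * I)))
      = ∫ ζ, harmonicDensity x ζ •
        (inner ℝ v (φ ζ : R3) / (1 - inner ℝ y (φ ζ : R3))) ^ 2 ∂uniformS2 := by
    rw [inner_integralAgainst]
    refine integral_congr_ae (Eventually.of_forall fun ζ => ?_)
    simp only [ContinuousMap.mul_apply, hI, densityFun_apply hx, ringInverse_one_sub_innerFun hy,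
      innerFun_apply, smul_eq_mul]
    ring
  rw [h4, inner_sub_right, h6, inner_add_right, inner_smul_right, inner_smul_right,
    real_inner_self_eq_norm_sq, sub_neg]
  refine h5.trans_eq ?_
  rw [real_inner_comm v y]
  field_simp

/-- The extension coincides locally with the implicit function of the Klein equation, by the
uniqueness of critical points. -/
theorem contDiffAt_kleinExtension (hφ : ∀ ξ : S2, (φ ⁻¹' {ξ}).Finite) {x : R3} (hx : ‖x‖ < 1) :
    ContDiffAt ℝ ω (kleinExtension φ) x := by
  set x' : ball (0 : R3) 1 := ⟨x, mem_ball_zero_iff.2 hx⟩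
  have hy := norm_kleinExtension_lt_one hφ hx
  have hc := kleinCritical_kleinExtension hφ x'
  set u : R3 × R3 := (x, kleinExtension φ x) with hu
  have hcd : ContDiffAt ℝ ω (kleinEquation φ) u := contDiffAt_kleinEquation hx hy
  have hinj : Function.Injective
      (fderiv ℝ (kleinEquation φ) u ∘L ContinuousLinearMap.inr ℝ R3 R3) := by
    rw [injective_iff_map_eq_zero]
    intro v hv
    by_contra hv0
    have h := inner_fderiv_kleinEquation_inr_neg hφ x' hy hc hv0
    have h' : fderiv ℝ (kleinEquation φ) u (0, v) = 0 := hv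
    rw [h', inner_zero_right] at h
    exact lt_irrefl _ h
  have hinv : (fderiv ℝ (kleinEquation φ) u ∘L ContinuousLinearMap.inr ℝ R3 R3).IsInvertible :=
    ⟨(LinearEquiv.ofInjectiveEndo _ hinj).toContinuousLinearEquiv, by ext1 v; rfl⟩
  have hψ := hcd.contDiffAt_implicitFunction (by simp) hinv
  refine hψ.congr_of_eventuallyEq ?_
  have h0 : kleinEquation φ u = 0 := (kleinEquation_eq_zero_iff x' hy).2 hc
  have hψx : hcd.implicitFunction (by simp) hinv x = kleinExtension φ x :=
    hcd.implicitFunction_apply_self (by simp) hinv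
  have hlt : ∀ᶠ z in 𝓝 x, ‖hcd.implicitFunction (by simp) hinv z‖ < 1 := by
    refine hψ.continuousAt.norm.eventually_lt continuousAt_const ?_
    change ‖hcd.implicitFunction (by simp) hinv x‖ < 1
    rwa [hψx]
  filter_upwards [hlt, hcd.eventually_apply_implicitFunction (by simp) hinv,
    isOpen_ball.mem_nhds (mem_ball_zero_iff.2 hx)] with z h1 h2 h3
  have := nullSingletonClass_map hφ ⟨z, h3⟩
  have := isProbabilityMeasure_map (φ := φ) ⟨z, h3⟩
  rw [h0] at h2
  exact KleinCritical.eq (norm_kleinExtension_lt_one hφ (mem_ball_zero_iff.1 h3)) h1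
    (kleinCritical_kleinExtension hφ ⟨z, h3⟩) ((kleinEquation_eq_zero_iff ⟨z, h3⟩ h1).1 h2)

theorem contDiffAt_douadyEarle (hφ : ∀ ξ : S2, (φ ⁻¹' {ξ}).Finite) {x : R3} (hx : ‖x‖ < 1) :
    ContDiffAt ℝ ω (douadyEarle φ) x := by
  have h1 := contDiffAt_kleinExtension hφ hx
  have hs := one_sub_norm_sq_pos (norm_kleinExtension_lt_one hφ hx)
  have h2 : ContDiffAt ℝ ω (fun x => ofKlein (kleinExtension φ x)) x := by
    unfold ofKlein
    refine ContDiffAt.smul (ContDiffAt.inv (contDiffAt_const.add (ContDiffAt.sqrt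
      (contDiffAt_const.sub (h1.norm_sq ℝ)) hs.ne')) ?_) h1
    positivity
  refine h2.congr_of_eventuallyEq ?_
  filter_upwards [isOpen_ball.mem_nhds (mem_ball_zero_iff.2 hx)] with z hz
  exact (ofKlein_kleinExtension hφ (mem_ball_zero_iff.1 hz)).symm

end Extension

section Extension

variable {φ : C(S2, S2)}

/-! ### Boundary values of the extension -/

theorem tendsto_moebius {ι : Type*} {l : Filter ι} {W Z : ι → R3} {w z : R3}
    (hW : Tendsto W l (𝓝 w)) (hZ : Tendsto Z l (𝓝 z))
    (h : 1 + ‖w‖ ^ 2 * ‖z‖ ^ 2 + 2 * inner ℝ w z ≠ 0) :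
    Tendsto (fun n => moebius (W n) (Z n)) l (𝓝 (moebius w z)) := by
  have hi : Tendsto (fun n => (2 : ℝ) * inner ℝ (W n) (Z n)) l (𝓝 (2 * inner ℝ w z)) :=
    (hW.inner hZ).const_mul 2
  have hW2 := hW.norm.pow 2
  have hZ2 := hZ.norm.pow 2
  exact ((((tendsto_const_nhds (x := (1 : ℝ))).add (hW2.mul hZ2)).add hi).inv₀ h).smul
    ((((tendsto_const_nhds (x := (1 : ℝ))).sub hW2).smul hZ).add
      ((((tendsto_const_nhds (x := (1 : ℝ))).add hZ2).add hi).smul hW))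

theorem moebius_denom_ne_zero {w : R3} {ζ : S2} (hw : (ζ : R3) ≠ -w) :
    1 + ‖w‖ ^ 2 * ‖(ζ : R3)‖ ^ 2 + 2 * inner ℝ w (ζ : R3) ≠ 0 := by
  have h : 1 + ‖w‖ ^ 2 * ‖(ζ : R3)‖ ^ 2 + 2 * inner ℝ w (ζ : R3) = ‖(ζ : R3) + w‖ ^ 2 := by
    rw [norm_add_sq_real, norm_S2, real_inner_comm]; ring
  rw [h]
  exact pow_ne_zero _ (norm_ne_zero_iff.2 fun h0 => hw (eq_neg_of_add_eq_zero_left h0))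

/-- A Möbius map with its center on the sphere is constant off one point. -/
theorem moebius_of_norm_eq_one {w : R3} (hw : ‖w‖ = 1) {ζ : S2} (hζ : (ζ : R3) ≠ -w) :
    moebius w ζ = w := by
  have h := moebius_denom_ne_zero hζ
  rw [norm_S2, hw] at h
  rw [moebius, norm_S2, hw]
  simp only [one_pow, mul_one, sub_self, zero_smul, zero_add] at h ⊢
  rw [smul_smul, inv_mul_cancel₀ h, one_smul]

theorem norm_moebius_le_one {w : R3} (hw : ‖w‖ < 1) (ζ : S2) : ‖moebius w ζ‖ ≤ 1 :=
  (norm_moebius_of_mem_sphere hw (norm_S2 ζ)).le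

/-- The extension takes the boundary values `φ`: along a sequence for which this fails, the
normalized push-forwards concentrate at a unit vector, which contradicts their balance. -/
theorem tendsto_douadyEarle_nhdsWithin_ball (hφ : ∀ ξ : S2, (φ ⁻¹' {ξ}).Finite) (ξ : S2) :
    Tendsto (douadyEarle φ) (𝓝[ball (0 : R3) 1] (ξ : R3)) (𝓝 (φ ξ : R3)) := by
  rw [nhdsWithin, ← map_comap_setCoe_val, tendsto_map'_iff]
  refine tendsto_of_subseq_tendsto fun X hX => ?_
  have hX' : Tendsto (fun n => (X n : R3)) atTop (𝓝 (ξ : R3)) := tendsto_comap_iff.1 hX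
  have hlt : ∀ n, ‖douadyEarle φ (X n : R3)‖ < 1 := fun n =>
    norm_douadyEarle_lt_one hφ (mem_ball_zero_iff.1 (X n).2)
  obtain ⟨w, hw, ms, hms, hlim⟩ := (isCompact_closedBall (0 : R3) 1).tendsto_subseq
    (x := fun n => douadyEarle φ (X n : R3)) fun n => mem_closedBall_zero_iff.2 (hlt n).le
  refine ⟨ms, ?_⟩
  suffices h : w = φ ξ by rw [← h]; exact hlim
  by_contra hne
  have hXm : Tendsto (fun n => (X (ms n) : R3)) atTop (𝓝 (ξ : R3)) := hX'.comp hms.tendsto_atTop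
  have hzero : ∀ n, ∫ ζ : S2, moebius (-douadyEarle φ (X (ms n) : R3))
      (φ (moebiusSphere (X (ms n)) ζ)) ∂uniformS2 = 0 := by
    intro n
    have h1 := (isConformalBarycenter_douadyEarle hφ (X (ms n))).1.2
    have h2 := one_sub_norm_sq_pos (hlt (ms n))
    rw [baryField, smul_eq_zero_iff_right (by positivity)] at h1
    rw [harmonicMeasure, Measure.map_map φ.continuous.measurable
      (continuous_moebiusSphere _).measurable, integral_map
      (φ.continuous.comp (continuous_moebiusSphere _)).aemeasurable] at h1
    · exact h1
    · refine Measurable.aestronglyMeasurable ?_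
      unfold moebius
      fun_prop
  have hne' : (φ ξ : R3) ≠ - -w := by rw [neg_neg]; exact Ne.symm hne
  have hpt : ∀ᵐ ζ : S2 ∂uniformS2, Tendsto (fun n => moebius (-douadyEarle φ (X (ms n) : R3))
      (φ (moebiusSphere (X (ms n)) ζ))) atTop (𝓝 (moebius (-w) (φ ξ))) := by
    filter_upwards [compl_mem_ae_iff.2 (measure_singleton (-ξ))] with ζ hζ
    have hζ' : (ζ : R3) ≠ -(ξ : R3) := fun h => hζ (Subtype.ext h)
    have h1 : Tendsto (fun n => moebiusSphere (X (ms n)) ζ) atTop (𝓝 ξ) := by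
      rw [tendsto_subtype_rng]
      have hc := tendsto_moebius hXm (tendsto_const_nhds (x := (ζ : R3))) (moebius_denom_ne_zero hζ')
      rwa [moebius_of_norm_eq_one (norm_S2 ξ) hζ'] at hc
    have h2 : Tendsto (fun n => (φ (moebiusSphere (X (ms n)) ζ) : R3)) atTop (𝓝 (φ ξ : R3)) :=
      ((continuous_subtype_val.comp φ.continuous).tendsto ξ).comp h1
    exact tendsto_moebius hlim.neg h2 (moebius_denom_ne_zero hne')
  have hDCT := tendsto_integral_of_dominated_convergence (μ := uniformS2) (fun _ => (1 : ℝ))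
    (F := fun n ζ => moebius (-douadyEarle φ (X (ms n) : R3)) (φ (moebiusSphere (X (ms n)) ζ)))
    (f := fun _ => moebius (-w) (φ ξ)) ?_ (integrable_const _) ?_ hpt
  · simp only [hzero] at hDCT
    have h0 : moebius (-w) (φ ξ) = 0 := by
      have := tendsto_nhds_unique hDCT tendsto_const_nhds
      simpa using this
    have h1 : ‖moebius (-w) (φ ξ)‖ = 1 := by
      rcases (mem_closedBall_zero_iff.1 hw).lt_or_eq with h | h
      · exact norm_moebius_of_mem_sphere (by rwa [norm_neg]) (norm_S2 _)
      · rw [moebius_of_norm_eq_one (by rwa [norm_neg]) hne', norm_neg, h]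
    rw [h0, norm_zero] at h1
    exact zero_ne_one h1
  · intro n
    refine Measurable.aestronglyMeasurable ?_
    have h1 : Measurable fun ζ => (φ (moebiusSphere (X (ms n)) ζ) : R3) :=
      (continuous_subtype_val.comp (φ.continuous.comp (continuous_moebiusSphere _))).measurable
    have h2 : Measurable fun x : R3 => moebius (-douadyEarle φ (X (ms n) : R3)) x := by
      unfold moebius
      fun_prop
    exact h2.comp h1
  · refine fun n => Eventually.of_forall fun ζ => norm_moebius_le_one ?_ _
    rw [norm_neg]
    exact hlt _

theorem continuousOn_douadyEarle (hφ : ∀ ξ : S2, (φ ⁻¹' {ξ}).Finite) :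
    ContinuousOn (douadyEarle φ) (closedBall (0 : R3) 1) := by
  intro x hx
  rcases (mem_closedBall_zero_iff.1 hx).lt_or_eq with h | h
  · exact (contDiffAt_douadyEarle hφ h).continuousAt.continuousWithinAt
  · obtain ⟨ξ, rfl⟩ : ∃ ξ : S2, (ξ : R3) = x := ⟨⟨x, mem_sphere_zero_iff_norm.2 h⟩, rfl⟩
    rw [ContinuousWithinAt, ← ball_union_sphere, nhdsWithin_union, tendsto_sup,
      douadyEarle_coe_sphere]
    refine ⟨tendsto_douadyEarle_nhdsWithin_ball hφ ξ, ?_⟩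
    rw [nhdsWithin, ← map_comap_setCoe_val, tendsto_map'_iff]
    have h1 : (douadyEarle φ ∘ Subtype.val : S2 → R3) = fun ζ => (φ ζ : R3) :=
      funext fun ζ => douadyEarle_coe_sphere φ ζ
    have h2 : comap (Subtype.val : S2 → R3) (𝓝 (ξ : R3)) = 𝓝 ξ := (nhds_subtype_eq_comap).symm
    refine Tendsto.congr (fun ζ => (congrFun h1 ζ).symm) ?_
    rw [h2]
    exact (continuous_subtype_val.comp φ.continuous).tendsto ξ

/-! ### The two half-balls -/

theorem inner_e3 (x : R3) : inner ℝ e3 x = x 2 := by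
  simp [e3, PiLp.inner_apply]

theorem inner_equatorReflection_left (x y : R3) :
    inner ℝ (equatorReflection x) y = inner ℝ x (equatorReflection y) := by
  simp [PiLp.inner_apply, Fin.sum_univ_three, equatorReflection_apply]

theorem inner_equatorReflection_right (x y : R3) :
    inner ℝ x (equatorReflection y) = inner ℝ x y - 2 * (x 2 * y 2) := by
  simp [PiLp.inner_apply, Fin.sum_univ_three, equatorReflection_apply]
  ring

theorem equatorReflection_eq_self {x : R3} (hx : x 2 = 0) : equatorReflection x = x := by
  ext i
  fin_cases i <;> simp [equatorReflection_apply, hx]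

/-- The harmonic measure of a point of the upper half-ball is larger above the equator. -/
theorem harmonicDensity_equatorReflection_lt {x : R3} (hx : ‖x‖ < 1) (hx2 : 0 < x 2) {ζ : S2}
    (hζ : 0 < (ζ : R3) 2) :
    harmonicDensity x (sphereIsometry equatorReflection ζ) < harmonicDensity x ζ := by
  have h1 := harmonicDensity_denom_pos hx ζ
  have h2 := harmonicDensity_denom_pos hx (sphereIsometry equatorReflection ζ)
  have h3 := one_sub_norm_sq_pos hx
  unfold harmonicDensity
  refine pow_lt_pow_left₀ ?_ (by positivity) two_ne_zero
  refine div_lt_div_of_pos_left h3 h1 ?_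
  rw [coe_sphereIsometry, inner_equatorReflection_right]
  have := mul_pos hx2 hζ
  linarith

variable (hR : ∀ ζ, φ (sphereIsometry equatorReflection ζ)
    = sphereIsometry equatorReflection (φ ζ))
  (hup : ∀ ζ : S2, 0 < (ζ : R3) 2 → 0 < (φ ζ : R3) 2)

include hR hup in
theorem coord_two_neg_of_neg {ζ : S2} (hζ : (ζ : R3) 2 < 0) : (φ ζ : R3) 2 < 0 := by
  have h := hup (sphereIsometry equatorReflection ζ) (by simpa using hζ)
  rw [hR] at h
  simpa using h

include hR hup in
/-- An odd function that is positive above the equator has a positive integral against the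
push-forward of a harmonic measure with its center above the equator. -/
theorem integral_odd_pos (x : ball (0 : R3) 1) (hx2 : 0 < (x : R3) 2) {k : S2 → ℝ}
    (hk : Continuous k) (hodd : ∀ ζ, k (sphereIsometry equatorReflection ζ) = -k ζ)
    (hpos : ∀ ζ : S2, 0 < (ζ : R3) 2 → 0 < k ζ) :
    0 < ∫ ζ, k ζ ∂((harmonicMeasure x).map φ) := by
  have hx := mem_ball_zero_iff.1 x.2
  have hdc := continuous_harmonicDensity hx
  have hkc : Continuous fun ζ => k (φ ζ) := hk.comp φ.continuous
  have hRc := continuous_sphereIsometry equatorReflection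
  have c1 : Continuous fun ζ => harmonicDensity x ζ * k (φ ζ) := hdc.mul hkc
  have c2 : Continuous fun ζ =>
      harmonicDensity x (sphereIsometry equatorReflection ζ) * k (φ ζ) := (hdc.comp hRc).mul hkc
  rw [integral_map_harmonicMeasure x hk]
  simp only [smul_eq_mul]
  have h1 := integral_sphereIsometry equatorReflection c1
  simp only [hR, hodd, mul_neg] at h1
  rw [integral_neg] at h1
  have h2 : 0 < ∫ ζ, (harmonicDensity x ζ * k (φ ζ) -
      harmonicDensity x (sphereIsometry equatorReflection ζ) * k (φ ζ)) ∂uniformS2 := by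
    refine integral_pos_of_ae_pos
      ((integrable_of_continuous c1).sub (integrable_of_continuous c2)) ?_
    filter_upwards [ae_uniformS2_coord_two_ne_zero] with ζ hζ
    rw [← sub_mul]
    rcases hζ.lt_or_gt with h | h
    · have h3 : 0 < (sphereIsometry equatorReflection ζ : R3) 2 := by simpa using h
      have h4 := harmonicDensity_equatorReflection_lt hx hx2 h3
      rw [sphereIsometry_equatorReflection_twice] at h4
      have h5 := hpos _ (hup _ h3)
      rw [hR, hodd] at h5
      nlinarith
    · exact mul_pos (sub_pos.2 (harmonicDensity_equatorReflection_lt hx hx2 h)) (hpos _ (hup _ h))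
  rw [integral_sub (integrable_of_continuous c1) (integrable_of_continuous c2)] at h2
  linarith

include hR hup in
theorem kleinExtension_two_pos (hφ : ∀ ξ : S2, (φ ⁻¹' {ξ}).Finite) {x : R3} (hx : ‖x‖ < 1)
    (hx2 : 0 < x 2) : 0 < kleinExtension φ x 2 := by
  set x' : ball (0 : R3) 1 := ⟨x, mem_ball_zero_iff.2 hx⟩
  have hy := norm_kleinExtension_lt_one hφ hx
  have hc : KleinCritical ((harmonicMeasure x').map φ) (kleinExtension φ x) :=
    kleinCritical_kleinExtension hφ x'
  have := nullSingletonClass_map hφ x'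
  have := isProbabilityMeasure_map (φ := φ) x'
  set y := kleinExtension φ x
  have hs := one_sub_norm_sq_pos hy
  by_contra hneg
  rcases (not_lt.1 hneg).lt_or_eq with h | h
  · -- Below the equator, `y` and its mirror image violate the comparison inequality.
    have hRy : ‖equatorReflection y‖ < 1 := by rwa [equatorReflection.norm_map]
    have hne : y ≠ equatorReflection y := by
      intro he
      have := congrArg (fun v : R3 => v 2) he
      simp only [equatorReflection_apply_two] at this
      linarith
    have h1 := integral_ratio_add_lt (μ := (harmonicMeasure x').map φ) hy hRy hne
    have h2 := hc.integral_ratio hy (equatorReflection y)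
    rw [equatorReflection.norm_map, ← mul_add] at h1
    have c1 := continuous_ratio hy (equatorReflection y)
    have c2 := continuous_ratio hRy y
    have hsw : ∀ ζ : S2, inner ℝ (equatorReflection y) (equatorReflection (ζ : R3))
        = inner ℝ y (ζ : R3) := fun ζ => equatorReflection.inner_map_map _ _
    have h3 := integral_odd_pos hR hup x' hx2 (c2.sub c1) (fun ζ => ?_) (fun ζ hζ => ?_)
    · rw [integral_sub' (integrable_of_continuous c2) (integrable_of_continuous c1)] at h3
      rw [real_inner_comm y] at h2
      set A := ∫ ζ : S2, (1 - inner ℝ (equatorReflection y) (ζ : R3)) / (1 - inner ℝ y (ζ : R3))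
        ∂((harmonicMeasure x').map φ)
      have h4 : (1 - ‖y‖ ^ 2) * A = 1 - inner ℝ y (equatorReflection y) := by
        rw [h2]; field_simp
      nlinarith
    · simp only [Pi.sub_apply, coe_sphereIsometry, hsw, ← inner_equatorReflection_left]
      ring
    · have u1 := one_sub_inner_pos hy ζ
      have u2 := one_sub_inner_pos hRy ζ
      have h5 : inner ℝ y (ζ : R3) < inner ℝ (equatorReflection y) (ζ : R3) := by
        rw [inner_equatorReflection_left, inner_equatorReflection_right]
        nlinarith [mul_pos (neg_pos.2 h) hζ]
      simp only [Pi.sub_apply, sub_pos]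
      rw [div_lt_div_iff₀ u1 u2]
      nlinarith
  · have h1 := hc.integral_inner_div hy e3
    rw [inner_e3, h, zero_div] at h1
    have h2 := integral_odd_pos hR hup x' hx2 (continuous_inner_div hy e3) (fun ζ => ?_)
      (fun ζ hζ => ?_)
    · exact h2.ne' h1
    · rw [coe_sphereIsometry, inner_e3, equatorReflection_apply_two, inner_e3,
        ← inner_equatorReflection_left, equatorReflection_eq_self h, neg_div]
    · rw [inner_e3]
      exact div_pos hζ (one_sub_inner_pos hy ζ)

include hR hup in
theorem douadyEarle_two_pos (hφ : ∀ ξ : S2, (φ ⁻¹' {ξ}).Finite) {x : R3} (hx : ‖x‖ < 1)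
    (hx2 : 0 < x 2) : 0 < douadyEarle φ x 2 := by
  have h := kleinExtension_two_pos hR hup hφ hx hx2
  rw [kleinExtension, toKlein, PiLp.smul_apply, smul_eq_mul] at h
  exact pos_of_mul_pos_right h (by positivity)

include hR in
theorem douadyEarle_equatorReflection (hφ : ∀ ξ : S2, (φ ⁻¹' {ξ}).Finite) {x : R3}
    (hx : ‖x‖ < 1) :
    douadyEarle φ (equatorReflection x) = equatorReflection (douadyEarle φ x) :=
  douadyEarle_isometry hφ _ _ hR hx

include hR hup in
theorem douadyEarle_two_neg (hφ : ∀ ξ : S2, (φ ⁻¹' {ξ}).Finite) {x : R3} (hx : ‖x‖ < 1)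
    (hx2 : x 2 < 0) : douadyEarle φ x 2 < 0 := by
  have h := douadyEarle_two_pos hR hup hφ (x := equatorReflection x)
    (by rwa [equatorReflection.norm_map]) (by simpa using hx2)
  rw [douadyEarle_equatorReflection hR hφ hx] at h
  simpa using h

include hR in
theorem douadyEarle_two_eq_zero (hφ : ∀ ξ : S2, (φ ⁻¹' {ξ}).Finite) {x : R3} (hx : ‖x‖ < 1)
    (hx2 : x 2 = 0) : douadyEarle φ x 2 = 0 := by
  have h := douadyEarle_equatorReflection hR hφ hx
  rw [equatorReflection_eq_self hx2] at h
  have h2 := congrArg (fun v : R3 => v 2) h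
  simp only [equatorReflection_apply_two] at h2
  linarith

end Extension

section Extension

variable {φ : C(S2, S2)}

/-! ### The normal derivative along the equatorial disc -/

theorem e3_ne_zero : e3 ≠ 0 := fun h => by simpa [e3] using congrArg (fun v : R3 => v 2) h

theorem equatorReflection_e3 : equatorReflection e3 = -e3 := by
  ext i
  fin_cases i <;> simp [equatorReflection_apply, e3]

theorem hasDerivAt_add_smul (x v : R3) : HasDerivAt (fun t : ℝ => x + t • v) v 0 := by
  simpa using ((hasDerivAt_id (0 : ℝ)).smul_const v).const_add x

theorem hasDerivAt_douadyEarle_line (hφ : ∀ ξ : S2, (φ ⁻¹' {ξ}).Finite) {x : R3} (hx : ‖x‖ < 1)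
    (v : R3) :
    HasDerivAt (fun t : ℝ => douadyEarle φ (x + t • v)) (fderiv ℝ (douadyEarle φ) x v) 0 := by
  have hd : HasFDerivAt (douadyEarle φ) (fderiv ℝ (douadyEarle φ) x)
      ((fun t : ℝ => x + t • v) 0) := by
    simpa using ((contDiffAt_douadyEarle hφ hx).differentiableAt (by simp)).hasFDerivAt
  exact hd.comp_hasDerivAt 0 (hasDerivAt_add_smul x v)

variable (hR : ∀ ζ, φ (sphereIsometry equatorReflection ζ)
    = sphereIsometry equatorReflection (φ ζ))
  (hup : ∀ ζ : S2, 0 < (ζ : R3) 2 → 0 < (φ ζ : R3) 2)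

include hR in
/-- The reflection symmetry makes the normal derivative vertical. -/
theorem fderiv_douadyEarle_e3 (hφ : ∀ ξ : S2, (φ ⁻¹' {ξ}).Finite) {x : R3} (hx : ‖x‖ < 1)
    (hx2 : x 2 = 0) :
    fderiv ℝ (douadyEarle φ) x e3 = (fderiv ℝ (douadyEarle φ) x e3 2) • e3 := by
  set D := fderiv ℝ (douadyEarle φ) x with hD
  have h1 : HasDerivAt (fun t : ℝ => equatorReflection (douadyEarle φ (x + t • e3)))
      (equatorReflection (D e3)) 0 :=
    equatorReflection.toContinuousLinearEquiv.hasFDerivAt.comp_hasDerivAt 0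
      (hasDerivAt_douadyEarle_line hφ hx e3)
  have h2 := hasDerivAt_douadyEarle_line hφ hx (-e3)
  have heq : (fun t : ℝ => douadyEarle φ (x + t • -e3))
      =ᶠ[𝓝 0] fun t : ℝ => equatorReflection (douadyEarle φ (x + t • e3)) := by
    have hlt : ∀ᶠ t : ℝ in 𝓝 0, ‖x + t • e3‖ < 1 := by
      have : ContinuousAt (fun t : ℝ => ‖x + t • e3‖) 0 := by fun_prop
      exact this.eventually_lt continuousAt_const (by simpa using hx)
    filter_upwards [hlt] with t ht
    rw [← douadyEarle_equatorReflection hR hφ ht, map_add, map_smul, equatorReflection_e3,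
      equatorReflection_eq_self hx2]
  have h3 := (h1.congr_of_eventuallyEq heq).unique h2
  rw [← hD, map_neg] at h3
  have hc : ∀ i : Fin 3, equatorReflection (D e3) i = -(D e3 i) := fun i => by rw [h3]; rfl
  have h0 := hc 0
  have h1' := hc 1
  ext i
  fin_cases i
  · have : equatorReflection (D e3) 0 = D e3 0 := rfl
    simp [e3]
    change D e3 0 = 0
    linarith
  · have : equatorReflection (D e3) 1 = D e3 1 := rfl
    simp [e3]
    change D e3 1 = 0
    linarith
  · simp [e3]

include hR hup in
theorem mul_coord_two_pos {ζ : S2} (hζ : (ζ : R3) 2 ≠ 0) : 0 < (ζ : R3) 2 * (φ ζ : R3) 2 := by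
  rcases hζ.lt_or_gt with h | h
  · exact mul_pos_of_neg_of_neg h (coord_two_neg_of_neg hR hup h)
  · exact mul_pos h (hup ζ h)

include hR hup in
/-- Moving the center of the harmonic measure upwards from the equatorial disc moves mass, and hence
the Klein equation, upwards. -/
theorem inner_fderiv_kleinEquation_inl_pos {x y : R3} (hx : ‖x‖ < 1) (hx2 : x 2 = 0)
    (hy : ‖y‖ < 1) : 0 < inner ℝ e3 (fderiv ℝ (kleinEquation φ) (x, y) (e3, 0)) := by
  have hs := one_sub_norm_sq_pos hx
  have hline := hasDerivAt_add_smul x e3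
  have h1 : HasDerivAt (fun t : ℝ => kleinEquation φ (x + t • e3, y))
      (fderiv ℝ (kleinEquation φ) (x, y) (e3, 0)) 0 := by
    have hd : HasFDerivAt (kleinEquation φ) (fderiv ℝ (kleinEquation φ) (x, y))
        ((fun t : ℝ => (x + t • e3, y)) 0) := by
      simpa using ((contDiffAt_kleinEquation (φ := φ) hx hy).differentiableAt
        (by simp)).hasFDerivAt
    exact hd.comp_hasDerivAt 0 (hline.prodMk (hasDerivAt_const (0 : ℝ) y))
  have hn : HasDerivAt (fun t : ℝ => ‖x + t • e3‖ ^ 2) 0 0 := by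
    have := hline.norm_sq
    simp only [zero_smul, add_zero] at this
    rwa [real_inner_comm, inner_e3, hx2, mul_zero] at this
  set L := innerFun (ContinuousMap.id S2) e3 with hL
  set I := Ring.inverse (densityDenom x) with hI
  set J := Ring.inverse (1 - innerFun φ y) with hJ
  have hden : HasDerivAt (fun t : ℝ => densityDenom (x + t • e3)) (-((2 : ℝ) • L)) 0 := by
    have ha := (hn.const_add 1).smul_const (1 : C(S2, ℝ))
    have hb := ((innerFun (ContinuousMap.id S2)).hasFDerivAt.comp_hasDerivAt 0 hline).const_smul
      (2 : ℝ)
    refine (ha.sub hb).congr_deriv ?_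
    simp [hL]
  have hinv : HasDerivAt (fun t : ℝ => Ring.inverse (densityDenom (x + t • e3)))
      (I * ((2 : ℝ) • L) * I) 0 := by
    have := hden.ringInverse (by simpa using densityDenom_ne_zero hx)
    simpa [hI] using this
  have hdens : HasDerivAt (fun t : ℝ => densityFun (x + t • e3))
      ((2 : ℝ) • (((1 - ‖x‖ ^ 2) • I) * ((1 - ‖x‖ ^ 2) • (I * ((2 : ℝ) • L) * I)))) 0 := by
    have := ((hn.const_sub 1).smul hinv).pow 2
    refine this.congr_deriv ?_
    ext ζ
    have htwo : (2 : C(S2, ℝ)) ζ = 2 := rfl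
    simp [← hI, htwo]
    ring
  have h2 : HasDerivAt (fun t : ℝ => kleinEquation φ (x + t • e3, y)) (integralAgainst φ
      ((2 : ℝ) • (((1 - ‖x‖ ^ 2) • I) * ((1 - ‖x‖ ^ 2) • (I * ((2 : ℝ) • L) * I))) * J)) 0 := by
    have := ((integralAgainst φ).hasFDerivAt.comp_hasDerivAt 0 (hdens.mul_const J)).sub_const
      ((1 - ‖y‖ ^ 2)⁻¹ • y)
    exact this
  rw [h1.unique h2, inner_integralAgainst]
  refine integral_pos_of_ae_pos (integrable_of_continuous (by fun_prop)) ?_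
  filter_upwards [ae_uniformS2_coord_two_ne_zero] with ζ hζ
  have h3 := mul_coord_two_pos hR hup hζ
  have h4 := harmonicDensity_denom_pos hx ζ
  have h5 := one_sub_inner_pos hy (φ ζ)
  simp only [ContinuousMap.mul_apply, ContinuousMap.smul_apply, hI, hJ, hL,
    ringInverse_apply (densityDenom_ne_zero hx), ringInverse_one_sub_innerFun hy,
    densityDenom_apply, innerFun_apply, inner_e3, ContinuousMap.id_apply, smul_eq_mul]
  set n := 1 + ‖x‖ ^ 2 - 2 * inner ℝ x (ζ : R3)
  set u := 1 - inner ℝ y (φ ζ : R3)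
  have h6 : 2 * ((1 - ‖x‖ ^ 2) * n⁻¹ * ((1 - ‖x‖ ^ 2) * (n⁻¹ * (2 * (ζ : R3) 2) * n⁻¹))) * u⁻¹ *
      (φ ζ : R3) 2 = 4 * (1 - ‖x‖ ^ 2) ^ 2 * n⁻¹ ^ 3 * u⁻¹ * ((ζ : R3) 2 * (φ ζ : R3) 2) := by
    ring
  rw [h6]
  positivity

include hR hup in
/-- The normal derivative points upwards. Along the normal line the identity
`kleinEquation φ (x, kleinExtension φ x) = 0` is differentiated; the partial derivative in the
first argument is positive and the one in the second argument is negative definite. -/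
theorem fderiv_douadyEarle_e3_two_pos (hφ : ∀ ξ : S2, (φ ⁻¹' {ξ}).Finite) {x : R3} (hx : ‖x‖ < 1)
    (hx2 : x 2 = 0) : 0 < fderiv ℝ (douadyEarle φ) x e3 2 := by
  set x' : ball (0 : R3) 1 := ⟨x, mem_ball_zero_iff.2 hx⟩
  have hy := norm_kleinExtension_lt_one hφ hx
  have hw2 := douadyEarle_two_eq_zero hR hφ hx hx2
  have hline := hasDerivAt_add_smul x e3
  have hΦ := hasDerivAt_douadyEarle_line hφ hx e3
  have hvert := fderiv_douadyEarle_e3 hR hφ hx hx2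
  set c := fderiv ℝ (douadyEarle φ) x e3 2
  rw [hvert] at hΦ
  set m := 2 / (1 + ‖douadyEarle φ x‖ ^ 2) with hm
  have hΨ : HasDerivAt (fun t : ℝ => kleinExtension φ (x + t • e3)) ((m * c) • e3) 0 := by
    have hn : HasDerivAt (fun t : ℝ => ‖douadyEarle φ (x + t • e3)‖ ^ 2) 0 0 := by
      have := hΦ.norm_sq
      simp only [zero_smul, add_zero] at this
      rwa [inner_smul_right, real_inner_comm, inner_e3, hw2, mul_zero, mul_zero] at this
    have hq : HasDerivAt (fun t : ℝ => 2 / (1 + ‖douadyEarle φ (x + t • e3)‖ ^ 2)) 0 0 := by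
      have := (hasDerivAt_const (0 : ℝ) (2 : ℝ)).div (hn.const_add 1) (by positivity)
      refine this.congr_deriv ?_
      simp
    refine (hq.smul hΦ).congr_deriv ?_
    simp [hm, mul_smul]
  have h0 : HasDerivAt (fun t : ℝ => kleinEquation φ (x + t • e3, kleinExtension φ (x + t • e3)))
      (fderiv ℝ (kleinEquation φ) (x, kleinExtension φ x) (e3, (m * c) • e3)) 0 := by
    have hd : HasFDerivAt (kleinEquation φ) (fderiv ℝ (kleinEquation φ) (x, kleinExtension φ x))
        ((fun t : ℝ => (x + t • e3, kleinExtension φ (x + t • e3))) 0) := by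
      simpa using ((contDiffAt_kleinEquation (φ := φ) hx hy).differentiableAt
        (by simp)).hasFDerivAt
    exact hd.comp_hasDerivAt 0 (hline.prodMk hΨ)
  have hz : (fun t : ℝ => kleinEquation φ (x + t • e3, kleinExtension φ (x + t • e3)))
      =ᶠ[𝓝 0] fun _ => 0 := by
    have hlt : ∀ᶠ t : ℝ in 𝓝 0, ‖x + t • e3‖ < 1 := by
      have : ContinuousAt (fun t : ℝ => ‖x + t • e3‖) 0 := by fun_prop
      exact this.eventually_lt continuousAt_const (by simpa using hx)
    filter_upwards [hlt] with t ht
    exact (kleinEquation_eq_zero_iff ⟨x + t • e3, mem_ball_zero_iff.2 ht⟩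
      (norm_kleinExtension_lt_one hφ ht)).2 (kleinCritical_kleinExtension hφ ⟨_, _⟩)
  have h1 := h0.unique ((hasDerivAt_const (0 : ℝ) (0 : R3)).congr_of_eventuallyEq hz)
  have h2 : ((e3, (m * c) • e3) : R3 × R3) = (e3, 0) + (m * c) • ((0 : R3), e3) := by simp
  rw [h2, map_add, map_smul] at h1
  have h3 := congrArg (inner ℝ e3) h1
  rw [inner_add_right, inner_smul_right, inner_zero_right] at h3
  have h4 := inner_fderiv_kleinEquation_inl_pos hR hup hx hx2 hy
  have h5 := inner_fderiv_kleinEquation_inr_neg hφ x' hy (kleinCritical_kleinExtension hφ x')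
    e3_ne_zero
  have hm0 : 0 < m := by positivity
  have h6 : 0 < m * c := by
    by_contra hneg
    have := mul_nonneg_of_nonpos_of_nonpos (not_lt.1 hneg) h5.le
    change 0 ≤ m * c * inner ℝ e3 (fderiv ℝ (kleinEquation φ) (x, kleinExtension φ x) (0, e3))
      at this
    linarith
  exact pos_of_mul_pos_right h6 hm0.le

end Extension

/-! ### Surjectivity of continuous extensions of Blaschke products -/

/-- The map `z ↦ z ^ d` on the unit circle has no continuous logarithm if `d ≠ 0`. -/
theorem not_exists_continuous_log_pow {d : ℕ} (hd : d ≠ 0) {E : ℂ → ℂ}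
    (hE : Continuous fun θ : ℝ => E (Complex.exp (θ * Complex.I)))
    (h : ∀ z : ℂ, ‖z‖ = 1 → Complex.exp (E z) = z ^ d) : False := by
  have hlift := Complex.isCoveringMap_exp.eq_of_comp_eq (A := ℝ)
    (g₁ := fun θ : ℝ => E (Complex.exp (θ * Complex.I)))
    (g₂ := fun θ : ℝ => d * (θ * Complex.I) + E 1) hE (by fun_prop)
    (by
      funext θ
      refine Subtype.ext ?_
      have h1 := h 1 (by simp)
      rw [one_pow] at h1
      simp only [Function.comp_apply]
      rw [h _ (Complex.norm_exp_ofReal_mul_I θ), Complex.exp_add, h1, mul_one, Complex.exp_nat_mul])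
    0 (by simp)
  have := congrFun hlift (2 * Real.pi)
  simp [Complex.exp_two_pi_mul_I, hd, Real.pi_ne_zero] at this

theorem continuous_log_one_add {X : Type*} [TopologicalSpace X] {u : X → ℂ} (hu : Continuous u)
    (h : ∀ x, ‖u x‖ < 1) : Continuous fun x => Complex.log (1 + u x) :=
  (continuous_const.add hu).clog fun x => Complex.mem_slitPlane_of_norm_lt_one (h x)

theorem exp_log_one_add {u : ℂ} (h : ‖u‖ < 1) : Complex.exp (Complex.log (1 + u)) = 1 + u :=
  Complex.exp_log (Complex.slitPlane_ne_zero (Complex.mem_slitPlane_of_norm_lt_one h))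

section Blaschke

variable {d : ℕ} {σ : ℂ} {a : Fin d → ℂ}

theorem mul_conj_eq_one {z : ℂ} (hz : ‖z‖ = 1) : z * conj z = 1 := by
  rw [Complex.mul_conj', hz]
  simp

/-- On the unit circle a Blaschke product of degree `d`, shifted by a point of the disc, is `z ^ d`
up to factors which have logarithms. -/
theorem blaschkeFun_sub_eq (hσ : ‖σ‖ = 1) (ha : ∀ j, ‖a j‖ < 1) {p z : ℂ} (hz : ‖z‖ = 1) :
    blaschkeFun σ a z - p = σ * z ^ d *
      ((∏ j, (1 + a j * conj z) / (1 + conj (a j) * z)) * (1 + -p * conj (blaschkeFun σ a z))) := by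
  have h1 := mul_conj_eq_one hz
  have h2 := mul_conj_eq_one (norm_blaschkeFun_eq_one hσ ha hz)
  have h3 : blaschkeFun σ a z
      = σ * z ^ d * ∏ j, (1 + a j * conj z) / (1 + conj (a j) * z) := by
    have : ∀ j, (z + a j) / (1 + conj (a j) * z)
        = z * ((1 + a j * conj z) / (1 + conj (a j) * z)) := fun j => by
      rw [← mul_div_assoc]
      congr 1
      linear_combination (-a j) * h1
    rw [blaschkeFun, Finset.prod_congr rfl fun j _ => this j, Finset.prod_mul_distrib]
    simp [mul_assoc]
  rw [← mul_assoc, ← h3]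
  linear_combination p * h2

/-- A continuous map of the closed disc which agrees on the circle with a Blaschke product of
positive degree covers the disc: the shifted map `F - p` would otherwise have a continuous
logarithm, hence so would `z ^ d` on the circle. -/
theorem exists_eq_of_eqOn_circle (hd : 1 ≤ d) (hσ : ‖σ‖ = 1) (ha : ∀ j, ‖a j‖ < 1) {F : ℂ → ℂ}
    (hF : ContinuousOn F (closedBall 0 1)) (hFB : ∀ z, ‖z‖ = 1 → F z = blaschkeFun σ a z)
    {p : ℂ} (hp : ‖p‖ < 1) : ∃ z, ‖z‖ ≤ 1 ∧ F z = p := by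
  by_contra! hne
  -- the retraction of the plane onto the closed disc
  set ρ : ℂ → ℂ := fun z => ((max 1 ‖z‖ : ℝ) : ℂ)⁻¹ * z with hρ
  have hpos : ∀ z : ℂ, 0 < max 1 ‖z‖ := fun z => lt_max_of_lt_left one_pos
  have hρn : ∀ z, ‖ρ z‖ ≤ 1 := fun z => by
    rw [hρ, norm_mul, norm_inv, Complex.norm_real, Real.norm_eq_abs, abs_of_pos (hpos z),
      inv_mul_le_one₀ (hpos z)]
    exact le_max_right _ _
  have hρ1 : ∀ z, ‖z‖ = 1 → ρ z = z := fun z hz => by simp [hρ, hz]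
  have hρc : Continuous ρ := by
    refine Continuous.mul (Continuous.inv₀ (by fun_prop) fun z => ?_) continuous_id
    exact_mod_cast (hpos z).ne'
  obtain ⟨L, ⟨-, hL⟩, -⟩ := Complex.isCoveringMapOn_exp.existsUnique_continuousMap_lifts
    (A := ℂ) (a₀ := 0) ⟨fun z => F (ρ z) - p, (hF.comp_continuous hρc fun z =>
      mem_closedBall_zero_iff.2 (hρn z)).sub continuous_const⟩
    (Complex.exp_log (sub_ne_zero.2 (hne (ρ 0) (hρn 0))))
    (fun z => sub_ne_zero.2 (hne (ρ z) (hρn z)))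
  have hLz : ∀ z, ‖z‖ = 1 → Complex.exp (L z) = blaschkeFun σ a z - p := fun z hz => by
    have := congrFun hL z
    simpa [hρ1 z hz, hFB z hz] using this
  have hσ0 : σ ≠ 0 := norm_ne_zero_iff.1 (by rw [hσ]; exact one_ne_zero)
  have hn1 : ∀ j z, ‖z‖ = 1 → ‖a j * conj z‖ < 1 := fun j z hz => by simp [hz, ha j]
  have hn2 : ∀ j z, ‖z‖ = 1 → ‖conj (a j) * z‖ < 1 := fun j z hz => by simp [hz, ha j]
  have hn3 : ∀ z, ‖z‖ = 1 → ‖-p * conj (blaschkeFun σ a z)‖ < 1 := fun z hz => by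
    simp [norm_blaschkeFun_eq_one hσ ha hz, hp]
  have hc : Continuous fun θ : ℝ => Complex.exp (θ * Complex.I) := by fun_prop
  have hcn : ∀ θ : ℝ, ‖Complex.exp (θ * Complex.I)‖ = 1 := Complex.norm_exp_ofReal_mul_I
  refine not_exists_continuous_log_pow (d := d) (by omega) (E := fun z => L z - Complex.log σ
    - (∑ j, (Complex.log (1 + a j * conj z) - Complex.log (1 + conj (a j) * z)))
    - Complex.log (1 + -p * conj (blaschkeFun σ a z))) ?_ fun z hz => ?_
  · have hB : Continuous fun θ : ℝ => blaschkeFun σ a (Complex.exp (θ * Complex.I)) :=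
      continuous_iff_continuousAt.2 fun θ => ContinuousAt.comp (g := blaschkeFun σ a)
        (continuousAt_blaschkeFun fun j => one_add_conj_mul_ne_zero (ha j) (hcn θ).le)
        hc.continuousAt
    refine (((L.continuous.comp hc).sub continuous_const).sub
      (continuous_finsetSum _ fun j _ => ?_)).sub ?_
    · exact (continuous_log_one_add (by fun_prop) fun θ => hn1 j _ (hcn θ)).sub
        (continuous_log_one_add (by fun_prop) fun θ => hn2 j _ (hcn θ))
    · exact continuous_log_one_add (by fun_prop) fun θ => hn3 _ (hcn θ)
  · rw [Complex.exp_sub, Complex.exp_sub, Complex.exp_sub, hLz z hz, Complex.exp_log hσ0,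
      Complex.exp_sum, exp_log_one_add (hn3 z hz), blaschkeFun_sub_eq hσ ha hz]
    have h1 : ∏ j, Complex.exp (Complex.log (1 + a j * conj z) - Complex.log (1 + conj (a j) * z))
        = ∏ j, (1 + a j * conj z) / (1 + conj (a j) * z) :=
      Finset.prod_congr rfl fun j _ => by
        rw [Complex.exp_sub, exp_log_one_add (hn1 j z hz), exp_log_one_add (hn2 j z hz)]
    rw [h1]
    have h2 : ∏ j, (1 + a j * conj z) / (1 + conj (a j) * z) ≠ 0 := by
      rw [← h1]
      exact Finset.prod_ne_zero_iff.2 fun j _ => Complex.exp_ne_zero _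
    have h3 : 1 + -p * conj (blaschkeFun σ a z) ≠ 0 :=
      Complex.slitPlane_ne_zero (Complex.mem_slitPlane_of_norm_lt_one (hn3 z hz))
    generalize (∏ j, (1 + a j * conj z) / (1 + conj (a j) * z)) = Q at h2 ⊢
    generalize 1 + -p * conj (blaschkeFun σ a z) = u at h3 ⊢
    field_simp

end Blaschke

/-! ### Rotation-equivariant real-analytic maps of the disc -/

/-- `F` is multiplied by `τ ^ k` when its variable is multiplied by the unimodular number `τ`. -/
def HasRotationWeight (F : ℂ → ℂ) (k : ℤ) : Prop :=
  ∀ τ : ℂ, ‖τ‖ = 1 → ∀ z : ℂ, ‖z‖ < 1 → F (τ * z) = τ ^ k * F z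

/-- The Wirtinger derivative `∂F/∂z`. -/
def wirtinger (F : ℂ → ℂ) (z : ℂ) : ℂ :=
  (fderiv ℝ F z 1 - Complex.I * fderiv ℝ F z Complex.I) / 2

/-- The Wirtinger derivative `∂F/∂z̄`. -/
def wirtingerBar (F : ℂ → ℂ) (z : ℂ) : ℂ :=
  (fderiv ℝ F z 1 + Complex.I * fderiv ℝ F z Complex.I) / 2

theorem fderiv_eq_wirtinger (F : ℂ → ℂ) (z v : ℂ) :
    fderiv ℝ F z v = wirtinger F z * v + wirtingerBar F z * conj v := by
  have h : v = v.re • (1 : ℂ) + v.im • Complex.I := by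
    simp [Complex.re_add_im]
  conv_lhs => rw [h]
  have h2 : conj v = v.re - v.im * Complex.I := by
    apply Complex.ext <;> simp
  rw [map_add, map_smul, map_smul, h2]
  conv_rhs => rw [← Complex.re_add_im v]
  simp only [wirtinger, wirtingerBar, Complex.real_smul, Complex.ofReal_re, Complex.add_re,
    Complex.add_im, Complex.mul_re, Complex.mul_im, Complex.ofReal_im, Complex.I_re, Complex.I_im]
  ring_nf
  rw [Complex.I_sq]
  ring_nf

section Weight

variable {F : ℂ → ℂ} {k : ℤ}

theorem analyticOnNhd_wirtinger (hF : AnalyticOnNhd ℝ F (ball 0 1)) :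
    AnalyticOnNhd ℝ (wirtinger F) (ball 0 1) ∧ AnalyticOnNhd ℝ (wirtingerBar F) (ball 0 1) := by
  have h : ∀ v, AnalyticOnNhd ℝ (fun z => fderiv ℝ F z v) (ball 0 1) := fun v =>
    ((ContinuousLinearMap.apply ℝ ℂ v).analyticOnNhd univ).comp hF.fderiv fun _ _ => mem_univ _
  exact ⟨fun z hz => ((h 1 z hz).sub (analyticAt_const.mul (h _ z hz))).div analyticAt_const
      two_ne_zero, fun z hz => ((h 1 z hz).add (analyticAt_const.mul (h _ z hz))).div
      analyticAt_const two_ne_zero⟩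

theorem HasRotationWeight.fderiv_mul (hF : AnalyticOnNhd ℝ F (ball 0 1)) (hk : HasRotationWeight F k)
    {τ : ℂ} (hτ : ‖τ‖ = 1) {z : ℂ} (hz : ‖z‖ < 1) (v : ℂ) :
    fderiv ℝ F (τ * z) (τ * v) = τ ^ k * fderiv ℝ F z v := by
  have hτz : ‖τ * z‖ < 1 := by rwa [norm_mul, hτ, one_mul]
  have h1 : HasFDerivAt (fun z => F (τ * z))
      ((fderiv ℝ F (τ * z)).comp (ContinuousLinearMap.mul ℝ ℂ τ)) z :=
    HasFDerivAt.comp (g := F) z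
      (hF _ (mem_ball_zero_iff.2 hτz)).differentiableAt.hasFDerivAt
      (ContinuousLinearMap.mul ℝ ℂ τ).hasFDerivAt
  have h2 : HasFDerivAt (fun z => τ ^ k * F z) (τ ^ k • fderiv ℝ F z) z :=
    (hF _ (mem_ball_zero_iff.2 hz)).differentiableAt.hasFDerivAt.const_mul _
  have h3 : (fun z => F (τ * z)) =ᶠ[𝓝 z] fun z => τ ^ k * F z := by
    filter_upwards [isOpen_ball.mem_nhds (mem_ball_zero_iff.2 hz)] with w hw
    exact hk τ hτ w (mem_ball_zero_iff.1 hw)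
  exact congrArg (fun T : ℂ →L[ℝ] ℂ => T v) (h1.unique (h2.congr_of_eventuallyEq h3))

theorem HasRotationWeight.of_wirtinger (hF : AnalyticOnNhd ℝ F (ball 0 1))
    (hk : HasRotationWeight F k) :
    HasRotationWeight (wirtinger F) (k - 1) ∧ HasRotationWeight (wirtingerBar F) (k + 1) := by
  have key : ∀ τ : ℂ, ‖τ‖ = 1 → ∀ z : ℂ, ‖z‖ < 1 →
      wirtinger F (τ * z) * τ = τ ^ k * wirtinger F z ∧
      wirtingerBar F (τ * z) = τ ^ k * wirtingerBar F z * τ := by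
    intro τ hτ z hz
    have hc := mul_conj_eq_one hτ
    have h1 := hk.fderiv_mul hF hτ hz 1
    have h2 := hk.fderiv_mul hF hτ hz Complex.I
    simp only [fderiv_eq_wirtinger, map_mul, map_one, Complex.conj_I] at h1 h2
    have hI := Complex.I_mul_I
    constructor
    · linear_combination (1 / 2) * h1 - (Complex.I / 2) * h2 +
        (wirtinger F (τ * z) * τ - wirtingerBar F (τ * z) * conj τ -
          τ ^ k * wirtinger F z + τ ^ k * wirtingerBar F z) / 2 * hI
    · have h3 : wirtingerBar F (τ * z) * conj τ = τ ^ k * wirtingerBar F z := by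
        linear_combination (1 / 2) * h1 + (Complex.I / 2) * h2 -
        (wirtinger F (τ * z) * τ - wirtingerBar F (τ * z) * conj τ -
          τ ^ k * wirtinger F z + τ ^ k * wirtingerBar F z) / 2 * hI
      linear_combination τ * h3 - wirtingerBar F (τ * z) * hc
  refine ⟨fun τ hτ z hz => ?_, fun τ hτ z hz => ?_⟩ <;>
    have hτ0 : τ ≠ 0 := norm_ne_zero_iff.1 (by rw [hτ]; exact one_ne_zero)
  · rw [zpow_sub_one₀ hτ0]
    field_simp
    linear_combination (key τ hτ z hz).1
  · rw [zpow_add_one₀ hτ0, (key τ hτ z hz).2]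
    ring

/-- The infinitesimal form of the equivariance: `F` is an eigenfunction of the angular
derivative. -/
theorem HasRotationWeight.angular (hF : AnalyticOnNhd ℝ F (ball 0 1)) (hk : HasRotationWeight F k)
    {z : ℂ} (hz : ‖z‖ < 1) :
    k * F z = z * wirtinger F z - conj z * wirtingerBar F z := by
  have hrot : HasDerivAt (fun θ : ℝ => Complex.exp (θ * Complex.I)) Complex.I 0 := by
    simpa using (((hasDerivAt_id (0 : ℝ)).ofReal_comp).mul_const Complex.I).cexp
  have h1 : HasDerivAt (fun θ : ℝ => F (Complex.exp (θ * Complex.I) * z))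
      (fderiv ℝ F z (Complex.I * z)) 0 := by
    have hd : HasFDerivAt F (fderiv ℝ F z)
        ((fun θ : ℝ => Complex.exp (θ * Complex.I) * z) 0) := by
      simpa using (hF _ (mem_ball_zero_iff.2 hz)).differentiableAt.hasFDerivAt
    exact hd.comp_hasDerivAt 0 (hrot.mul_const z)
  have h2 : HasDerivAt (fun θ : ℝ => Complex.exp (k * (θ * Complex.I)) * F z)
      (k * Complex.I * F z) 0 := by
    have := ((((hasDerivAt_id (0 : ℝ)).ofReal_comp).mul_const Complex.I).const_mul
      (k : ℂ)).cexp.mul_const (F z)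
    simpa using this
  have h3 : (fun θ : ℝ => F (Complex.exp (θ * Complex.I) * z))
      = fun θ : ℝ => Complex.exp (k * (θ * Complex.I)) * F z := by
    funext θ
    rw [hk _ (Complex.norm_exp_ofReal_mul_I θ) z hz, Complex.exp_int_mul]
  rw [h3] at h1
  have h4 := h1.unique h2
  rw [fderiv_eq_wirtinger, map_mul, Complex.conj_I] at h4
  have hI := Complex.I_mul_I
  linear_combination Complex.I * h4 + (wirtingerBar F z * conj z - wirtinger F z * z
    + k * F z) * hI

/-- A real-analytic map of rotation weight at least `n` vanishes to order `n` at the center: the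
angular equation expresses it through its Wirtinger derivatives, whose weights are at least
`n - 1`. -/
theorem HasRotationWeight.isBigO (n : ℕ) {F : ℂ → ℂ} {k : ℤ} (hn : n ≤ k)
    (hF : AnalyticOnNhd ℝ F (ball 0 1)) (hk : HasRotationWeight F k) :
    F =O[𝓝 0] fun z => ‖z‖ ^ n := by
  induction n generalizing F k with
  | zero =>
    simp only [pow_zero]
    exact ((hF 0 (mem_ball_self one_pos)).continuousAt.tendsto).isBigO_one ℝ
  | succ n ih =>
    have hk0 : (k : ℂ) ≠ 0 := by
      have : k ≠ 0 := by push_cast at hn; omega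
      exact_mod_cast this
    have h1 := ih (by push_cast at hn; omega) (analyticOnNhd_wirtinger hF).1 (hk.of_wirtinger hF).1
    have h2 := ih (by push_cast at hn; omega) (analyticOnNhd_wirtinger hF).2 (hk.of_wirtinger hF).2
    have hid : (fun z : ℂ => z) =O[𝓝 0] fun z => ‖z‖ := (Asymptotics.isBigO_refl _ _).norm_right
    have hconj : (fun z : ℂ => conj z) =O[𝓝 0] fun z => ‖z‖ :=
      Asymptotics.isBigO_of_le _ fun z => by simp
    have h3 := (((hid.mul h1).sub (hconj.mul h2)).const_mul_left (k : ℂ)⁻¹)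
    refine (h3.congr' ?_ (Eventually.of_forall fun z => by simp only [pow_succ']))
    filter_upwards [isOpen_ball.mem_nhds (mem_ball_self one_pos)] with z hz
    rw [← hk.angular hF (mem_ball_zero_iff.1 hz)]
    field_simp

end Weight

/-! ### Radial profiles -/

/-- A real-analytic function of size `O(|x| ^ n)` at the origin is divisible by `x ^ n`. -/
theorem AnalyticAt.exists_eq_pow_mul_of_isBigO {u : ℝ → ℝ} (hu : AnalyticAt ℝ u 0) {n : ℕ}
    (h : u =O[𝓝 0] fun x => |x| ^ n) :
    ∃ v : ℝ → ℝ, AnalyticAt ℝ v 0 ∧ ∀ᶠ x in 𝓝 0, u x = x ^ n * v x := by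
  suffices hle : (n : ℕ∞) ≤ analyticOrderAt u 0 by
    simpa using (natCast_le_analyticOrderAt hu).1 hle
  by_contra! hlt
  obtain ⟨m, hm⟩ := ENat.ne_top_iff_exists.1 hlt.ne_top
  rw [← hm, Nat.cast_lt] at hlt
  obtain ⟨g, hg, hg0, hug⟩ := (hu.analyticOrderAt_eq_natCast).1 hm.symm
  obtain ⟨C, hC⟩ := h.bound
  have hlim : Tendsto (fun x => ‖g x‖) (𝓝[≠] 0) (𝓝 ‖g 0‖) :=
    hg.continuousAt.norm.tendsto.mono_left nhdsWithin_le_nhds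
  have hzero : Tendsto (fun x : ℝ => C * |x| ^ (n - m)) (𝓝[≠] 0) (𝓝 0) := by
    have : ContinuousAt (fun x : ℝ => C * |x| ^ (n - m)) 0 := by fun_prop
    have h0 := this.tendsto.mono_left (nhdsWithin_le_nhds (s := {0}ᶜ))
    simpa [Nat.sub_ne_zero_of_lt hlt] using h0
  have hle : ∀ᶠ x in 𝓝[≠] (0 : ℝ), ‖g x‖ ≤ C * |x| ^ (n - m) := by
    filter_upwards [nhdsWithin_le_nhds hug, nhdsWithin_le_nhds hC, self_mem_nhdsWithin]
      with x h1 h2 hx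
    have hx0 : 0 < |x| ^ m := pow_pos (abs_pos.2 hx) m
    rw [h1, sub_zero, smul_eq_mul, norm_mul, norm_pow, norm_pow, Real.norm_eq_abs,
      Real.norm_eq_abs |x|, abs_abs, ← Nat.sub_add_cancel hlt.le, pow_add] at h2
    refine le_of_mul_le_mul_left ?_ hx0
    linarith
  exact hg0 (norm_le_zero_iff.1 (le_of_tendsto_of_tendsto hlim hzero hle))

/-- An even real-analytic function is a real-analytic function of the square of its variable. -/
theorem AnalyticAt.exists_comp_sq {v : ℝ → ℝ} (hv : AnalyticAt ℝ v 0)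
    (heven : ∀ᶠ x in 𝓝 0, v (-x) = v x) :
    ∃ h : ℝ → ℝ, AnalyticAt ℝ h 0 ∧ ∀ᶠ x in 𝓝 0, v x = h (x ^ 2) := by
  obtain ⟨p, R, hp⟩ := hv
  -- the power series of `h` keeps the even coefficients of the one of `v`
  set c : ℕ → ℝ := p.coeff with hc
  set q := FormalMultilinearSeries.ofScalars ℝ fun n => c (2 * n) with hq
  obtain ⟨ρ, hρ0, hρR⟩ := ENNReal.lt_iff_exists_nnreal_btwn.1 hp.r_pos
  have hρ0' : (0 : NNReal) < ρ := by exact_mod_cast hρ0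
  obtain ⟨C, -, hC⟩ := p.norm_mul_pow_le_of_lt_radius (hρR.trans_le hp.r_le)
  have hrad : ((ρ ^ 2 : NNReal) : ENNReal) ≤ q.radius := by
    refine q.le_radius_of_bound C fun n => ?_
    have := hC (2 * n)
    rw [FormalMultilinearSeries.norm_apply_eq_norm_coef, pow_mul] at this
    rw [hq, FormalMultilinearSeries.ofScalars_norm]
    exact_mod_cast this
  have hqpos : 0 < q.radius := lt_of_lt_of_le (by exact_mod_cast pow_pos hρ0' 2) hrad
  have hqs := q.hasFPowerSeriesOnBall hqpos
  refine ⟨q.sum, hqs.analyticAt, ?_⟩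
  have hball : ∀ᶠ x in 𝓝 (0 : ℝ), x ∈ Metric.eball (0 : ℝ) R := Metric.eball_mem_nhds _ hp.r_pos
  have hball' : ∀ᶠ x in 𝓝 (0 : ℝ), x ^ 2 ∈ Metric.eball (0 : ℝ) q.radius := by
    have : Tendsto (fun x : ℝ => x ^ 2) (𝓝 0) (𝓝 0) := by
      have : ContinuousAt (fun x : ℝ => x ^ 2) 0 := by fun_prop
      simpa using this.tendsto
    exact this (Metric.eball_mem_nhds _ hqpos)
  filter_upwards [hball, hball', heven] with x h1 h2 h3
  have hs : ∀ y ∈ Metric.eball (0 : ℝ) R, HasSum (fun n => c n * y ^ n) (v y) := fun y hy => by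
    have := hp.hasSum hy
    simpa [mul_comm] using this
  have hs1 := hs x h1
  have hs2 := hs (-x) (by simpa using h1)
  rw [h3] at hs2
  have hs3 := (hs1.add hs2).mul_left (1 / 2)
  have hinj : Function.Injective fun n : ℕ => 2 * n := fun a b hab => by
    simpa using hab
  have hs4 : HasSum (fun n => c (2 * n) * (x ^ 2) ^ n) (v x) := by
    have h5 := (hinj.hasSum_iff (f := fun n => 1 / 2 * (c n * x ^ n + c n * (-x) ^ n))
      (a := 1 / 2 * (v x + v x)) ?_).2 hs3
    · convert h5 using 1
      · funext n
        simp only [Function.comp_apply]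
        rw [Even.neg_pow (even_two_mul n), pow_mul]
        ring
      · ring
    · intro n hn
      have hodd : Odd n := by
        rw [← Nat.not_even_iff_odd]
        rintro ⟨m, hm⟩
        exact hn ⟨m, by simp only; omega⟩
      rw [hodd.neg_pow]
      ring
  have hs5 : HasSum (fun n => c (2 * n) * (x ^ 2) ^ n) (q.sum (x ^ 2)) := by
    have := hqs.hasSum h2
    simpa [hq, mul_comm] using this
  exact hs4.unique hs5

/-- A real-analytic map `F` of the disc with the rotation weight `d` that is real on the real axis
has the form `z ^ d * h (|z| ^ 2)`. -/
theorem exists_radial_profile {d : ℕ} (hd : d ≠ 0) {F : ℂ → ℂ}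
    (hF : AnalyticOnNhd ℝ F (ball 0 1)) (hw : HasRotationWeight F d)
    (hreal : ∀ r : ℝ, |r| < 1 → (F r).im = 0) (h1 : Tendsto F (𝓝[ball 0 1] 1) (𝓝 1)) :
    ∃ h : ℝ → ℝ, AnalyticOnNhd ℝ h (Ico 0 1) ∧ Tendsto h (𝓝[<] 1) (𝓝 1) ∧
      ∀ z ∈ ball (0 : ℂ) 1, F z = z ^ d * (h (‖z‖ ^ 2) : ℂ) := by
  set u : ℝ → ℝ := fun r => (F r).re with hu
  have hur : ∀ r : ℝ, |r| < 1 → F r = u r := fun r hr =>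
    Complex.ext (by simp [hu]) (by simp [hreal r hr])
  have hua : ∀ r : ℝ, |r| < 1 → AnalyticAt ℝ u r := fun r hr => by
    have h2 : AnalyticAt ℝ F (Complex.ofRealCLM r) := hF _ (by simpa using hr)
    exact (Complex.reCLM.analyticAt _).comp (h2.comp (Complex.ofRealCLM.analyticAt r))
  have hO : u =O[𝓝 0] fun x => |x| ^ d := by
    have h2 := HasRotationWeight.isBigO d le_rfl hF hw
    have h3 : Tendsto (fun r : ℝ => (r : ℂ)) (𝓝 0) (𝓝 0) := by
      simpa using Complex.continuous_ofReal.tendsto 0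
    refine Asymptotics.IsBigO.trans (Asymptotics.isBigO_of_le _ fun r => ?_)
      ((h2.comp_tendsto h3).congr_right fun r => by simp)
    exact Complex.abs_re_le_norm _
  obtain ⟨v, hv, huv⟩ := (hua 0 (by simp)).exists_eq_pow_mul_of_isBigO hO
  have hsmall : ∀ᶠ x : ℝ in 𝓝 0, |x| < 1 := by
    have : ContinuousAt (fun x : ℝ => |x|) 0 := by fun_prop
    exact this.eventually_lt continuousAt_const (by simp)
  have heven : ∀ᶠ x in 𝓝 0, v (-x) = v x := by
    have hneg : Tendsto (fun x : ℝ => -x) (𝓝 0) (𝓝 0) := by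
      simpa using (continuous_neg (G := ℝ)).tendsto 0
    filter_upwards [huv, hneg huv, hsmall] with x h2 h3 hx
    rcases eq_or_ne x 0 with rfl | hx0
    · simp
    have h4 := hw (-1) (by simp) x (by simpa using hx)
    have h5 : ((-1 : ℂ) * x) = ((-x : ℝ) : ℂ) := by push_cast; ring
    rw [h5, hur x hx, hur (-x) (by simpa using hx)] at h4
    have h6 : u (-x) = (-1) ^ d * u x := by exact_mod_cast h4
    have h3' : u (-x) = (-x) ^ d * v (-x) := h3
    rw [h3', h2, neg_pow x, mul_assoc] at h6
    exact mul_left_cancel₀ (pow_ne_zero d hx0)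
      (mul_left_cancel₀ (pow_ne_zero d (by norm_num : (-1 : ℝ) ≠ 0)) h6)
  obtain ⟨h₀, hh₀, hvh⟩ := hv.exists_comp_sq heven
  -- the first formula is not analytic at the origin as it stands; there it agrees with `h₀`
  refine ⟨fun s => if 0 < s then u (√s) / √s ^ d else h₀ s, ?_, ?_, fun z hz => ?_⟩
  · rintro s ⟨hs0, hs1⟩
    rcases hs0.eq_or_lt with rfl | hs
    · refine hh₀.congr ?_
      have hsq : Tendsto (fun s : ℝ => √s) (𝓝 0) (𝓝 0) := by
        simpa using Real.continuous_sqrt.tendsto 0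
      filter_upwards [hsq huv, hsq hvh] with s h2 h3
      split_ifs with hs
      · have h2' : u (√s) = √s ^ d * v (√s) := h2
        have h3' : v (√s) = h₀ (√s ^ 2) := h3
        rw [h2', h3', Real.sq_sqrt hs.le, mul_div_cancel_left₀ _ (by positivity)]
      · rfl
    · have hsqrt : AnalyticAt ℝ (fun s : ℝ => √s) s := (Real.contDiffAt_sqrt hs.ne').analyticAt
      have h2 : |√s| < 1 := by
        rw [abs_of_nonneg (Real.sqrt_nonneg s)]
        exact (Real.sqrt_lt' one_pos).2 (by simpa using hs1)
      have h3 : AnalyticAt ℝ (fun s => u (√s) / √s ^ d) s :=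
        (AnalyticAt.fun_comp (hua _ h2) hsqrt).div (hsqrt.pow d) (by positivity)
      refine h3.congr ?_
      filter_upwards [lt_mem_nhds hs] with t ht
      rw [if_pos ht]
  · have hsq : Tendsto (fun s : ℝ => √s) (𝓝[<] 1) (𝓝 1) := by
      have := (Real.continuous_sqrt.tendsto 1).mono_left (nhdsWithin_le_nhds (s := Iio 1))
      simpa using this
    have hF1 : Tendsto (fun s : ℝ => F ((√s : ℝ) : ℂ)) (𝓝[<] 1) (𝓝 1) := by
      refine h1.comp (tendsto_nhdsWithin_iff.2 ⟨?_, ?_⟩)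
      · exact (Complex.continuous_ofReal.tendsto' 1 1 (by simp)).comp hsq
      · filter_upwards [self_mem_nhdsWithin] with s hs
        rw [mem_ball_zero_iff, Complex.norm_real, Real.norm_eq_abs,
          abs_of_nonneg (Real.sqrt_nonneg s)]
        exact (Real.sqrt_lt' one_pos).2 (by simpa using hs)
    have hu1 : Tendsto (fun s : ℝ => u (√s) / √s ^ d) (𝓝[<] 1) (𝓝 1) := by
      have := Tendsto.div ((Complex.continuous_re.tendsto' 1 1 (by simp)).comp hF1) (hsq.pow d)
        (by simp)
      rwa [one_pow, div_one] at this
    refine hu1.congr' ?_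
    filter_upwards [nhdsWithin_le_nhds (lt_mem_nhds one_pos)] with s hs
    rw [if_pos hs]
  · rcases eq_or_ne z 0 with rfl | hz0
    · have h2 := HasRotationWeight.isBigO 1 (by omega) hF hw
      have h3 : F 0 = 0 := Asymptotics.IsBigO.eq_zero_of_norm_pow (n := 1) (by simpa using h2)
        one_ne_zero
      rw [h3, zero_pow hd, zero_mul]
    · have hn : 0 < ‖z‖ := norm_pos_iff.2 hz0
      have hz1 : |‖z‖| < 1 := by rwa [abs_norm, ← mem_ball_zero_iff]
      set τ : ℂ := z / (‖z‖ : ℂ) with hτ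
      have hnc : (‖z‖ : ℂ) ≠ 0 := by exact_mod_cast hn.ne'
      have hτ1 : ‖τ‖ = 1 := by rw [hτ, norm_div, Complex.norm_real, norm_norm, div_self hn.ne']
      have hz : z = τ * (‖z‖ : ℂ) := by rw [hτ, div_mul_cancel₀ _ hnc]
      have h2 := hw τ hτ1 (‖z‖ : ℂ) (by simpa using hz1)
      rw [← hz, hur _ hz1, zpow_natCast] at h2
      simp only
      rw [h2, if_pos (by positivity), Real.sqrt_sq hn.le, hτ, div_pow]
      push_cast
      field_simp

/-! ### The extension on the equatorial disc -/

/-- The inclusion of the equatorial plane, as a continuous linear map. -/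
def planeInclusion : ℂ →L[ℝ] R3 :=
  LinearMap.toContinuousLinearMap
    { toFun := planePt
      map_add' := fun z w => by ext i; fin_cases i <;> simp [planePt]
      map_smul' := fun r z => by ext i; fin_cases i <;> simp [planePt] }

@[simp]
theorem planeInclusion_apply (z : ℂ) : planeInclusion z = planePt z := rfl

/-- The vertical projection to the equatorial plane. -/
def planeProjection : R3 →L[ℝ] ℂ :=
  (EuclideanSpace.proj 0 : R3 →L[ℝ] ℝ).smulRight 1
    + (EuclideanSpace.proj 1 : R3 →L[ℝ] ℝ).smulRight Complex.I

theorem planeProjection_apply (x : R3) : planeProjection x = ⟨x 0, x 1⟩ := by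
  apply Complex.ext <;> simp [planeProjection]

@[simp]
theorem planeProjection_planePt (z : ℂ) : planeProjection (planePt z) = z := by
  rw [planeProjection_apply]
  rfl

/-- The extension of `φ`, restricted to the equatorial disc and projected back to it. -/
def discExtension (φ : S2 → S2) (z : ℂ) : ℂ := planeProjection (douadyEarle φ (planePt z))

section Extension

variable {φ : C(S2, S2)} (hφ : ∀ ξ : S2, (φ ⁻¹' {ξ}).Finite)
  (hR : ∀ ζ, φ (sphereIsometry equatorReflection ζ) = sphereIsometry equatorReflection (φ ζ))

include hφ hR in
theorem douadyEarle_planePt {z : ℂ} (hz : ‖z‖ < 1) :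
    douadyEarle φ (planePt z) = planePt (discExtension φ z) := by
  rw [discExtension, planeProjection_apply]
  exact eq_planePt_of_coord_two_eq_zero
    (douadyEarle_two_eq_zero hR hφ (by rwa [norm_planePt]) rfl)

include hφ in
theorem continuousOn_discExtension : ContinuousOn (discExtension φ) (closedBall 0 1) := by
  refine planeProjection.continuous.comp_continuousOn
    ((continuousOn_douadyEarle hφ).comp planeInclusion.continuous.continuousOn fun z hz => ?_)
  simpa [norm_planePt] using hz

include hφ in
theorem analyticOnNhd_discExtension : AnalyticOnNhd ℝ (discExtension φ) (ball 0 1) := by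
  intro z hz
  have h : AnalyticAt ℝ (douadyEarle φ) (planeInclusion z) :=
    (contDiffAt_douadyEarle hφ (by simpa [norm_planePt] using hz)).analyticAt
  exact (planeProjection.analyticAt _).comp (h.comp (planeInclusion.analyticAt z))

include hφ in
/-- A pair of plane isometries intertwined by `φ` is intertwined by its extension to the disc. -/
theorem discExtension_isometry (A A' : ℂ ≃ₗᵢ[ℝ] ℂ)
    (h : ∀ ζ, φ (sphereIsometry (cylinderIsometry A (LinearIsometryEquiv.refl ℝ ℝ)) ζ)
      = sphereIsometry (cylinderIsometry A' (LinearIsometryEquiv.refl ℝ ℝ)) (φ ζ))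
    {z : ℂ} (hz : ‖z‖ < 1) : discExtension φ (A z) = A' (discExtension φ z) := by
  have h1 := douadyEarle_isometry hφ _ _ h (x := planePt z) (by rwa [norm_planePt])
  rw [cylinderIsometry_planePt] at h1
  rw [discExtension, h1, discExtension, planeProjection_apply, planeProjection_apply,
    cylinderIsometry_apply]
  rfl

include hφ in
theorem tendsto_discExtension {z w : ℂ} (ζ : S2) (hζ : (ζ : R3) = planePt z)
    (hw : (φ ζ : R3) = planePt w) : Tendsto (discExtension φ) (𝓝[ball 0 1] z) (𝓝 w) := by
  have h1 := tendsto_douadyEarle_nhdsWithin_ball hφ ζ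
  rw [hζ, hw] at h1
  have h2 : Tendsto planePt (𝓝[ball 0 1] z) (𝓝[ball (0 : R3) 1] (planePt z)) := by
    refine tendsto_nhdsWithin_iff.2 ⟨?_, ?_⟩
    · exact (planeInclusion.continuous.tendsto z).mono_left nhdsWithin_le_nhds
    · filter_upwards [self_mem_nhdsWithin] with u hu
      simpa [norm_planePt] using hu
  have h3 := (planeProjection.continuous.tendsto (planePt w)).comp (h1.comp h2)
  rwa [planeProjection_planePt] at h3

end Extension

section Blaschke

variable {d : ℕ} {σ : ℂ} {a : Fin d → ℂ}

/-- A finite Blaschke product as a continuous self-map of the sphere. -/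
def blaschkeSphereMap (hσ : ‖σ‖ = 1) (ha : ∀ j, ‖a j‖ < 1) : C(S2, S2) :=
  ⟨sphereConj (blaschke σ a), continuous_sphereConj_blaschke hσ ha⟩

theorem exists_coe_eq_planePt {z : ℂ} (hz : ‖z‖ = 1) : ∃ ζ : S2, (ζ : R3) = planePt z :=
  ⟨⟨planePt z, by rw [mem_sphere_zero_iff_norm, norm_planePt, hz]⟩, rfl⟩

/-- The extension is onto the disc, since it has the boundary values of a Blaschke product of
positive degree. -/
theorem douadyEarle_image_equatorialDisc (hd : 1 ≤ d) (hσ : ‖σ‖ = 1) (ha : ∀ j, ‖a j‖ < 1) :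
    douadyEarle (sphereConj (blaschke σ a)) '' equatorialDisc = equatorialDisc := by
  set φ := blaschkeSphereMap hσ ha with hφdef
  have hφ : ∀ ξ : S2, (φ ⁻¹' {ξ}).Finite := finite_preimage_sphereConj_blaschke hd hσ ha
  have hR := sphereConj_blaschke_equatorReflection hσ ha
  have hB : ∀ z, ‖z‖ = 1 → discExtension φ z = blaschkeFun σ a z := fun z hz => by
    obtain ⟨ζ, hζ⟩ := exists_coe_eq_planePt hz
    rw [discExtension, ← hζ, douadyEarle_coe_sphere]
    exact (congrArg planeProjection (sphereConj_blaschke_planePt hσ ha hz hζ)).trans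
      (planeProjection_planePt _)
  refine Subset.antisymm ?_ ?_
  · rintro _ ⟨x, hx, rfl⟩
    obtain ⟨h1, h2⟩ := mem_equatorialDisc_iff.1 hx
    exact mem_equatorialDisc_iff.2
      ⟨norm_douadyEarle_lt_one hφ h1, douadyEarle_two_eq_zero (φ := φ) hR hφ h1 h2⟩
  · rintro _ ⟨p, hp, rfl⟩
    have hp1 := mem_ball_zero_iff.1 hp
    obtain ⟨z, hz, hzp⟩ :=
      exists_eq_of_eqOn_circle hd hσ ha (continuousOn_discExtension hφ) hB hp1
    have hz1 : ‖z‖ < 1 := by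
      refine hz.lt_of_ne fun h => ?_
      rw [← hzp, hB z h, norm_blaschkeFun_eq_one hσ ha h] at hp1
      exact lt_irrefl _ hp1
    refine ⟨planePt z, ⟨z, mem_ball_zero_iff.2 hz1, rfl⟩, ?_⟩
    rw [← hzp]
    exact douadyEarle_planePt (φ := φ) hφ hR hz1

/-- Symmetries of `z ^ d` in the plane are symmetries of its conjugate on the sphere. -/
theorem sphereConj_blaschke_cylinderIsometry (hd : 1 ≤ d) (hσ : ‖σ‖ = 1) (ha : ∀ j, ‖a j‖ < 1)
    (hpow : ∀ z : ℂ, blaschke σ a z = ((z ^ d : ℂ) : OnePoint ℂ)) (A A' : ℂ ≃ₗᵢ[ℝ] ℂ)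
    (hA : ∀ z, A z ^ d = A' (z ^ d)) (ζ : S2) :
    sphereConj (blaschke σ a)
        (sphereIsometry (cylinderIsometry A (LinearIsometryEquiv.refl ℝ ℝ)) ζ)
      = sphereIsometry (cylinderIsometry A' (LinearIsometryEquiv.refl ℝ ℝ))
        (sphereConj (blaschke σ a) ζ) := by
  obtain ⟨p, rfl⟩ : ∃ p, ζ = stereo p := ⟨stereoInv ζ, (stereo_stereoInv ζ).symm⟩
  induction p using OnePoint.rec with
  | infty =>
    have h : sphereConj (blaschke σ a) (stereo OnePoint.infty) = stereo OnePoint.infty := by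
      rw [← equatorReflection_stereo_zero, sphereConj_blaschke_equatorReflection hσ ha,
        sphereConj_stereo, hpow, zero_pow (by omega)]
    rw [cylinderIsometry_stereo_infty, h, cylinderIsometry_stereo_infty]
  | coe z =>
    rw [cylinderIsometry_stereo_coe, sphereConj_stereo, sphereConj_stereo, hpow, hpow,
      cylinderIsometry_stereo_coe, hA]

/-- The rotations make the extension of `z ^ d` equivariant, and the complex conjugation makes it
real on the real axis. -/
theorem exists_radial_profile_douadyEarle (hd : 1 ≤ d) (hσ : ‖σ‖ = 1) (ha : ∀ j, ‖a j‖ < 1)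
    (hpow : ∀ z : ℂ, blaschke σ a z = ((z ^ d : ℂ) : OnePoint ℂ)) :
    ∃ h : ℝ → ℝ, AnalyticOnNhd ℝ h (Ico 0 1) ∧ Tendsto h (𝓝[<] 1) (𝓝 1) ∧
      ∀ z ∈ ball (0 : ℂ) 1, douadyEarle (sphereConj (blaschke σ a)) (planePt z)
        = planePt (z ^ d * (h (‖z‖ ^ 2) : ℂ)) := by
  set φ := blaschkeSphereMap hσ ha with hφdef
  have hφ : ∀ ξ : S2, (φ ⁻¹' {ξ}).Finite := finite_preimage_sphereConj_blaschke hd hσ ha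
  have hsym := sphereConj_blaschke_cylinderIsometry hd hσ ha hpow
  have hw : HasRotationWeight (discExtension φ) d := by
    intro τ hτ z hz
    set c : Circle := ⟨τ, mem_sphere_zero_iff_norm.2 hτ⟩
    have h1 := discExtension_isometry hφ (rotation c) (rotation (c ^ d))
      (hsym _ _ fun z => by rw [rotation_apply, rotation_apply, mul_pow, Circle.coe_pow]) hz
    rwa [rotation_apply, rotation_apply, Circle.coe_pow, ← zpow_natCast] at h1
  have hreal : ∀ r : ℝ, |r| < 1 → (discExtension φ r).im = 0 := by
    intro r hr
    have h1 := discExtension_isometry hφ Complex.conjLIE Complex.conjLIE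
      (hsym _ _ fun z => by simp) (z := r) (by simpa using hr)
    rw [Complex.conjLIE_apply, Complex.conjLIE_apply, Complex.conj_ofReal] at h1
    exact Complex.conj_eq_iff_im.1 h1.symm
  have h1 : Tendsto (discExtension φ) (𝓝[ball 0 1] 1) (𝓝 1) := by
    obtain ⟨ζ, hζ⟩ := exists_coe_eq_planePt (z := 1) (by simp)
    refine tendsto_discExtension hφ ζ hζ ?_
    have h2 := sphereConj_blaschke_planePt hσ ha (by simp) hζ
    have h3 : blaschkeFun σ a 1 = 1 := by
      have h4 := hpow 1
      rw [blaschke_coe_of_forall_ne fun j => one_add_conj_mul_ne_zero (ha j) (by simp),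
        OnePoint.coe_eq_coe, one_pow] at h4
      exact h4
    rwa [h3] at h2
  obtain ⟨h, hh, hlim, hFh⟩ := exists_radial_profile (by omega : d ≠ 0)
    (analyticOnNhd_discExtension hφ) hw hreal h1
  refine ⟨h, hh, hlim, fun z hz => ?_⟩
  rw [← hFh z hz]
  exact douadyEarle_planePt (φ := φ) hφ (sphereConj_blaschke_equatorReflection hσ ha)
    (mem_ball_zero_iff.1 hz)

theorem exists_normal_derivative_douadyEarle (hd : 1 ≤ d) (hσ : ‖σ‖ = 1) (ha : ∀ j, ‖a j‖ < 1) :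
    ∃ g : ℂ → ℝ, AnalyticOnNhd ℝ g (ball (0 : ℂ) 1) ∧ ∀ z ∈ ball (0 : ℂ) 1, 0 < g z ∧
      HasLineDerivAt ℝ (douadyEarle (sphereConj (blaschke σ a))) (g z • e3) (planePt z) e3 := by
  set φ := blaschkeSphereMap hσ ha with hφdef
  have hφ : ∀ ξ : S2, (φ ⁻¹' {ξ}).Finite := finite_preimage_sphereConj_blaschke hd hσ ha
  have hR : ∀ ζ, φ (sphereIsometry equatorReflection ζ)
      = sphereIsometry equatorReflection (φ ζ) := sphereConj_blaschke_equatorReflection hσ ha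
  have hup : ∀ ζ : S2, 0 < (ζ : R3) 2 → 0 < (φ ζ : R3) 2 := fun ζ =>
    sphereConj_blaschke_two_pos hd hσ ha
  refine ⟨fun z => fderiv ℝ (douadyEarle φ) (planePt z) e3 2, fun z hz => ?_, fun z hz => ?_⟩ <;>
    have hz1 : ‖planePt z‖ < 1 := by rwa [norm_planePt, ← mem_ball_zero_iff]
  · have h : AnalyticAt ℝ (fderiv ℝ (douadyEarle φ)) (planeInclusion z) :=
      (contDiffAt_douadyEarle hφ hz1).analyticAt.fderiv
    exact (((EuclideanSpace.proj 2 : R3 →L[ℝ] ℝ).comp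
      (ContinuousLinearMap.apply ℝ R3 e3)).analyticAt _).comp
        (h.comp (planeInclusion.analyticAt z))
  · refine ⟨fderiv_douadyEarle_e3_two_pos hR hup hφ hz1 rfl, ?_⟩
    have h := hasDerivAt_douadyEarle_line hφ hz1 e3
    rw [fderiv_douadyEarle_e3 hR hφ hz1 rfl] at h
    exact h

end Blaschke

theorem mainTheorem5 (d : ℕ) (hd : 1 ≤ d) (σ : ℂ) (hσ : ‖σ‖ = 1)
    (a : Fin d → ℂ) (ha : ∀ j, ‖a j‖ < 1) :
    -- the extension is defined: `f̂` is in the domain of `E`, and the barycenters exist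
    (IsExtendable (sphereConj (blaschke σ a)) ∧
      ∀ x : ball (0 : R3) 1,
        IsConformalBarycenter ((harmonicMeasure x).map (sphereConj (blaschke σ a)))
          (douadyEarle (sphereConj (blaschke σ a)) x)) ∧
    -- it maps the disc onto the disc
    douadyEarle (sphereConj (blaschke σ a)) '' equatorialDisc = equatorialDisc ∧
    -- it preserves the upper and the lower half, on the sphere and in the ball
    MapsTo (douadyEarle (sphereConj (blaschke σ a))) upperHemisphere upperHemisphere ∧
    MapsTo (douadyEarle (sphereConj (blaschke σ a))) lowerHemisphere lowerHemisphere ∧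
    MapsTo (douadyEarle (sphereConj (blaschke σ a))) upperHalfBall upperHalfBall ∧
    MapsTo (douadyEarle (sphereConj (blaschke σ a))) lowerHalfBall lowerHalfBall ∧
    -- the derivative with respect to the third coordinate on the disc
    (∃ g : ℂ → ℝ, AnalyticOnNhd ℝ g (ball (0 : ℂ) 1) ∧
      ∀ z ∈ ball (0 : ℂ) 1, 0 < g z ∧
        HasLineDerivAt ℝ (douadyEarle (sphereConj (blaschke σ a))) (g z • e3) (planePt z) e3) ∧
    -- the case `f(z) = z ^ d`
    ((∀ z : ℂ, blaschke σ a z = ((z ^ d : ℂ) : OnePoint ℂ)) →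
      ∃ h : ℝ → ℝ, AnalyticOnNhd ℝ h (Ico 0 1) ∧ Tendsto h (𝓝[<] 1) (𝓝 1) ∧
        ∀ z ∈ ball (0 : ℂ) 1,
          douadyEarle (sphereConj (blaschke σ a)) (planePt z)
            = planePt (z ^ d * (h (‖z‖ ^ 2) : ℂ))) := by
  have hφ : ∀ ξ : S2, (blaschkeSphereMap hσ ha ⁻¹' {ξ}).Finite :=
    finite_preimage_sphereConj_blaschke hd hσ ha
  have hR : ∀ ζ, blaschkeSphereMap hσ ha (sphereIsometry equatorReflection ζ)
      = sphereIsometry equatorReflection (blaschkeSphereMap hσ ha ζ) :=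
    sphereConj_blaschke_equatorReflection hσ ha
  have hup : ∀ ζ : S2, 0 < (ζ : R3) 2 → 0 < (blaschkeSphereMap hσ ha ζ : R3) 2 := fun ζ =>
    sphereConj_blaschke_two_pos hd hσ ha
  have hcoe : ⇑(blaschkeSphereMap hσ ha) = sphereConj (blaschke σ a) := rfl
  refine ⟨?_, douadyEarle_image_equatorialDisc hd hσ ha, ?_, ?_, ?_, ?_,
    exists_normal_derivative_douadyEarle hd hσ ha, exists_radial_profile_douadyEarle hd hσ ha⟩
  · rw [← hcoe]
    exact ⟨isExtendable_of_finite_fibres hφ, isConformalBarycenter_douadyEarle hφ⟩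
  · rintro x ⟨hx, hx2⟩
    obtain ⟨ζ, rfl⟩ : ∃ ζ : S2, (ζ : R3) = x := ⟨⟨x, mem_sphere_zero_iff_norm.2 hx⟩, rfl⟩
    rw [douadyEarle_coe_sphere]
    exact ⟨norm_S2 _, sphereConj_blaschke_two_pos hd hσ ha hx2⟩
  · rintro x ⟨hx, hx2⟩
    obtain ⟨ζ, rfl⟩ : ∃ ζ : S2, (ζ : R3) = x := ⟨⟨x, mem_sphere_zero_iff_norm.2 hx⟩, rfl⟩
    rw [douadyEarle_coe_sphere]
    exact ⟨norm_S2 _, sphereConj_blaschke_two_neg hd hσ ha hx2⟩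
  · rintro x ⟨hx, hx2⟩
    rw [← hcoe]
    exact ⟨norm_douadyEarle_lt_one hφ hx, douadyEarle_two_pos hR hup hφ hx hx2⟩
  · rintro x ⟨hx, hx2⟩
    rw [← hcoe]
    exact ⟨norm_douadyEarle_lt_one hφ hx, douadyEarle_two_neg hR hup hφ hx hx2⟩

end
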